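/- Let $T\ge 1$, $\mu\ge 1$, $n\ge 0$, $M\ge 0$ be integers and put $N=[M/T]$, $K=N+\mu n$. For a sequence $x$ write $x^{(n)}(m,s)=\sum_{l=0}^{n}(-1)^l\binom nl x(m-ls)$, $m,s\in\mathbb Z$. All random variables are complex-valued (real ones included), and spectral densities are taken with respect to $\frac{d\lambda}{2\pi}$ on $[-\pi,\pi)$. **Assumptions.** Let $\vartheta(m)$, $m\in\mathbb Z$, have periodically stationary $n$th increments of period $T$: the variables $\vartheta^{(n)}(m,sT)$ have finite second moments, and their means and covariances $\mathsf E\,\vartheta^{(n)}(m,s_1T)\overline{\vartheta^{(n)}(k,s_2T)}$ do not change under $(m,k)\mapsto(m+T,k+T)$. Let $\vec\xi(m)=(\xi_p(m))_{p=1}^T$, $\xi_p(m)=\vartheta(mT+p-1)$, have mean zero increments with the spectral density $f$, that is, $f$ is an integrable, a.e. positive semidefinite $T\times T$ matrix function with $$\mathsf E\,\xi_p^{(n)}(m,s_1)\overline{\xi_q^{(n)}(k,s_2)}=\frac1{2\pi}\int_{-\pi}^{\pi}e^{i\lambda(m-k)}(1-e^{-is_1\lambda})^n(1-e^{is_2\lambda})^n\lambda^{-2n}f_{pq}(\lambda)\,d\lambda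 .$$ Let $\eta(m)$ be such that $\vec\eta(m)=(\eta(mT+p-1))_{p=1}^T$ is a mean zero stationary sequence with the spectral density $g$, uncorrelated with (the increments of) $\vec\xi$. Put $\vec\zeta=\vec\xi+\vec\eta$ and $p(\lambda)=f(\lambda)+\lambda^{2n}g(\lambda)$. Assume the minimality condition: $p(\lambda)$ is a.e. invertible and $$\int_{-\pi}^{\pi}\operatorname{Tr}\Big[\tfrac{\lambda^{2n}}{|1-e^{i\lambda\mu}|^{2n}}\,p(\lambda)^{-1}\Big]d\lambda<\infty ,$$ and assume that the entries of $\frac{\lambda^{2n}}{|1-e^{i\lambda\mu}|^{2n}}g(\lambda)p(\lambda)^{-1}$ are integrable, so that the Fourier coefficients $T^\mu_{j,k}$ below exist. **Coefficients.** Given numbers $a(k)\in\mathbb C$, let $A_M\vartheta=\sum_{k=0}^{M}a(k)\vartheta(k)$, and let $\vec a(m)$, $0\le m\le N$, have the components $a_p(m)=a(mT+p-1)$ if $mT+p-1\le M$ and $a_p(m)=0$ otherwise. Let $\sum_k d_\mu(k)x^k=\big(\sum_j x^{\mu j}\big)^n$, $\vec b(k)=\sum_{m=k}^{N}d_\mu(m-k)\vec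 a(m)$ for $0\le k\le N$, and $$\vec v(k)=\sum_{l=\lceil -k/\mu\rceil}^{\min\{[(N-k)/\mu],\,n\}}(-1)^l\tbinom nl\,\vec b(l\mu+k)\quad(-\mu n\le k\le -1),$$ $$\vec a_\mu(m)=\sum_{l=\max\{\lceil (m-N)/\mu\rceil,\,0\}}^{\min\{[m/\mu],\,n\}}(-1)^l\tbinom nl\,\vec a(m-\mu l)\quad(0\le m\le K).$$ Let $\mathbf a$, $\mathbf a^\mu$, $\mathbf b$ be the stacked vectors $(\vec a(k))_{k=0}^N$, $(\vec a_\mu(k))_{k=0}^{K}$, $(\vec b(0),\dots,\vec b(N),0,\dots,0)$ (with $\mu n$ zero blocks). Let $\mathbf P$, $\mathbf T$ (with block indices $0\le j,k\le K$) and $\mathbf Q$ (with $0\le j,k\le N$) be the block matrices with the $T\times T$ blocks $$P^\mu_{j,k}=\frac1{2\pi}\int_{-\pi}^{\pi}e^{i\lambda(k-j)}\tfrac{\lambda^{2n}}{|1-e^{i\lambda\mu}|^{2n}}\big[p^{-1}\big]^{\top}d\lambda,\qquad T^\mu_{j,k}=\frac1{2\pi}\int_{-\pi}^{\pi}e^{i\lambda(k-j)}\tfrac{\lambda^{2n}}{|1-e^{i\lambda\mu}|^{2n}}\big[g\,p^{-1}\big]^{\top}d\lambda,$$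 $$Q_{j,k}=\frac1{2\pi}\int_{-\pi}^{\pi}e^{i\lambda(k-j)}\big[f\,p^{-1}g\big]^{\top}d\lambda .$$ **Estimates.** The observations are $\zeta(m)=\vartheta(m)+\eta(m)$ in all blocks except those with the numbers $0,\dots,N$, i.e. $\vec\zeta(m)$, $m\in\mathbb Z\setminus\{0,\dots,N\}$. Let $V_N\vec\zeta=\sum_{k=-\mu n}^{-1}\vec v(k)^\top\vec\zeta(k)$, and let $\mathcal H$ be the closed linear span in $L_2(\Omega)$ of $\zeta_p^{(n)}(k,\mu)$, $k\le -1$, and $\zeta_p^{(n)}(k,-\mu)$, $k\ge N+1$, $1\le p\le T$. The linear estimates are the random variables $u-V_N\vec\zeta$ with $u\in\mathcal H$; such an estimate is optimal if its mean-square error $\mathsf E|A_M\vartheta-(u-V_N\vec\zeta)|^2$ is the least possible. Let $Z$ be the orthogonal vector stochastic measure in $\vec\zeta^{(n)}(m,s)=\int_{-\pi}^{\pi}e^{im\lambda}(1-e^{-is\lambda})^n(i\lambda)^{-n}dZ(\lambda)$; the stochastic integral is the isometry from $L_2(p)$ to $L_2(\Omega)$ that extends this correspondence. **Theorem.** The entries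 of $\mathbf P$ and $\mathbf Q$ exist, $\mathbf P$ is invertible, and the optimal linear estimate $\widehat A_M\vartheta$ exists, is unique almost surely, and is $$\widehat A_M\vartheta=\int_{-\pi}^{\pi}\vec h(\lambda)^\top dZ(\lambda)-V_N\vec\zeta .$$ Its spectral characteristic is $$\vec h(\lambda)^{\top}=\vec B(e^{i\lambda})^{\top}\frac{(1-e^{-i\lambda\mu})^n}{(i\lambda)^n}-\vec A(e^{i\lambda})^{\top}g(\lambda)(-i\lambda)^n p(\lambda)^{-1}-\frac{(-i\lambda)^n}{(1-e^{i\lambda\mu})^n}\vec C(e^{i\lambda})^{\top}p(\lambda)^{-1},$$ where $\vec A(e^{i\lambda})=\sum_{k=0}^N\vec a(k)e^{i\lambda k}$, $\vec B(e^{i\lambda})=\sum_{k=0}^N\vec b(k)e^{i\lambda k}$, $\vec C(e^{i\lambda})=\sum_{k=0}^{K}\vec c(k)e^{i\lambda k}$, and $\vec c(0),\dots,\vec c(K)$ are the blocks of $\mathbf c=\mathbf P^{-1}\mathbf b-\mathbf P^{-1}\mathbf T\mathbf a^\mu$. The error $A_M\vartheta-\widehat A_M\vartheta$ is square integrable, and,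 with the rows $r_1=(1-e^{i\lambda\mu})^n\vec A(e^{i\lambda})^\top g+\vec C(e^{i\lambda})^\top$ and $r_2=(1-e^{i\lambda\mu})^n\vec A(e^{i\lambda})^\top f-\lambda^{2n}\vec C(e^{i\lambda})^\top$, $$\mathsf E|A_M\vartheta-\widehat A_M\vartheta|^2=\frac1{2\pi}\int_{-\pi}^{\pi}\frac{\lambda^{2n}}{|1-e^{i\lambda\mu}|^{2n}}\,r_1p^{-1}f\,p^{-1}r_1^{*}\,d\lambda+\frac1{2\pi}\int_{-\pi}^{\pi}\frac{1}{|1-e^{i\lambda\mu}|^{2n}}\,r_2p^{-1}g\,p^{-1}r_2^{*}\,d\lambda$$ $$=\big\langle\mathbf b-\mathbf T\mathbf a^\mu,\ \mathbf P^{-1}\mathbf b-\mathbf P^{-1}\mathbf T\mathbf a^\mu\big\rangle+\langle\mathbf Q\mathbf a,\mathbf a\rangle ,$$ where both integrands are integrable and $\langle u,v\rangle=\sum_i u_i\overline{v_i}$. -/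

import Mathlib

open MeasureTheory
open scoped Matrix ComplexOrder ENNReal

namespace PerStat

noncomputable section

/-! ### Sequences, increments, blocks -/

/-- The `n`-th increment with step `s` of a sequence of random variables:
`x^{(n)}(m, s) = ∑_{l=0}^n (-1)^l C(n,l) x(m - l s)`. -/
def increment {Ω : Type*} (n : ℕ) (s : ℤ) (x : ℤ → Ω → ℂ) (m : ℤ) : Ω → ℂ := fun ω =>
  ∑ l ∈ Finset.range (n + 1), (-1 : ℂ) ^ l * (n.choose l : ℂ) * x (m - l * s) ω

/-- The `T`-dimensional blocking of a scalar sequence. The component with index `p : Fin T`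
(counted from `0`) of the block `m` is `x(m T + p)`. -/
def block {Ω : Type*} (T : ℕ) (x : ℤ → Ω → ℂ) (m : ℤ) (p : Fin T) : Ω → ℂ :=
  x (m * T + (p : ℕ))

/-- The `n`-th increment with step `s` of the component `p` of a vector sequence. -/
def vecIncrement {Ω : Type*} {T : ℕ} (n : ℕ) (s : ℤ) (X : ℤ → Fin T → Ω → ℂ) (m : ℤ)
    (p : Fin T) : Ω → ℂ :=
  increment n s (fun k => X k p) m

/-- Periodically stationary (periodically correlated) `n`-th increments with period `T`: the
increments `x^{(n)}(m, s T)` have finite second moments, and their means and covariances do not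
change when time is shifted by `T`. -/
structure HasPeriodicallyStationaryIncrements {Ω : Type*} [MeasurableSpace Ω] (P : Measure Ω)
    (n T : ℕ) (x : ℤ → Ω → ℂ) : Prop where
  aemeasurable : ∀ m, AEMeasurable (x m) P
  memLp : ∀ s m : ℤ, MemLp (increment n (s * T) x m) 2 P
  mean : ∀ s m : ℤ,
    ∫ ω, increment n (s * T) x (m + T) ω ∂P = ∫ ω, increment n (s * T) x m ω ∂P
  cov : ∀ s₁ s₂ m k : ℤ,
    ∫ ω, increment n (s₁ * T) x (m + T) ω * star (increment n (s₂ * T) x (k + T) ω) ∂P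
      = ∫ ω, increment n (s₁ * T) x m ω * star (increment n (s₂ * T) x k ω) ∂P

/-! ### Spectral densities -/

/-- The normalized Lebesgue measure `dλ / (2π)` on `[-π, π)`. -/
def freq : Measure ℝ :=
  ENNReal.ofReal (1 / (2 * Real.pi)) • volume.restrict (Set.Ico (-Real.pi) Real.pi)

/-- An integrable matrix function on `[-π, π)` with positive semidefinite Hermitian values. -/
structure IsDensity {T : ℕ} (f : ℝ → Matrix (Fin T) (Fin T) ℂ) : Prop where
  integrable : ∀ p q, Integrable (fun x => f x p q) freq
  posSemidef : ∀ᵐ x ∂freq, (f x).PosSemidef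

/-- The character `e^{i k λ}`, for an integer `k`. -/
def character (k : ℤ) (x : ℝ) : ℂ := Complex.exp (Complex.I * (k : ℂ) * (x : ℂ))

/-- The frequency factor of the increment with step `s`: `(1 - e^{-i s λ})^n / (i λ)^n`. -/
def incFactor (n : ℕ) (s : ℤ) (x : ℝ) : ℂ :=
  (1 - character (-s) x) ^ n / (Complex.I * (x : ℂ)) ^ n

/-- The vector sequence `X` has mean zero stationary `n`-th increments with the spectral density
`f` (with respect to `dλ / (2π)`): the structural function is
`∫ e^{i(m-k)λ} (1 - e^{-i s₁ λ})^n (1 - e^{i s₂ λ})^n λ^{-2n} f(λ) dλ / (2π)`. -/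
structure HasIncrementSpectralDensity {Ω : Type*} [MeasurableSpace Ω] (P : Measure Ω) {T : ℕ}
    (n : ℕ) (X : ℤ → Fin T → Ω → ℂ) (f : ℝ → Matrix (Fin T) (Fin T) ℂ) : Prop where
  isDensity : IsDensity f
  memLp : ∀ (s m : ℤ) (p : Fin T), MemLp (vecIncrement n s X m p) 2 P
  mean : ∀ (s m : ℤ) (p : Fin T), ∫ ω, vecIncrement n s X m p ω ∂P = 0
  cov : ∀ (s₁ s₂ m k : ℤ) (p q : Fin T),
    ∫ ω, vecIncrement n s₁ X m p ω * star (vecIncrement n s₂ X k q ω) ∂P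
      = ∫ x, character (m - k) x * (1 - character (-s₁) x) ^ n * (1 - character s₂ x) ^ n
          / (x : ℂ) ^ (2 * n) * f x p q ∂freq

/-- The vector sequence `Y` is mean zero, (wide sense) stationary, with the spectral density `g`
(with respect to `dλ / (2π)`). -/
structure HasSpectralDensity {Ω : Type*} [MeasurableSpace Ω] (P : Measure Ω) {T : ℕ}
    (Y : ℤ → Fin T → Ω → ℂ) (g : ℝ → Matrix (Fin T) (Fin T) ℂ) : Prop where
  isDensity : IsDensity g
  memLp : ∀ (m : ℤ) (p : Fin T), MemLp (Y m p) 2 P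
  mean : ∀ (m : ℤ) (p : Fin T), ∫ ω, Y m p ω ∂P = 0
  cov : ∀ (m k : ℤ) (p q : Fin T),
    ∫ ω, Y m p ω * star (Y k q ω) ∂P = ∫ x, character (m - k) x * g x p q ∂freq

/-- The sequences `X` and `Y` are uncorrelated. Only the increments of `X` need to have second
moments, so the condition is imposed on them. -/
def Uncorrelated {Ω : Type*} [MeasurableSpace Ω] (P : Measure Ω) {T : ℕ} (n : ℕ)
    (X Y : ℤ → Fin T → Ω → ℂ) : Prop :=
  ∀ (s m k : ℤ) (p q : Fin T), ∫ ω, vecIncrement n s X m p ω * star (Y k q ω) ∂P = 0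

/-- The spectral density `p(λ) = f(λ) + λ^{2n} g(λ)` of the increments of the observed sequence. -/
def obsDensity {T : ℕ} (n : ℕ) (f g : ℝ → Matrix (Fin T) (Fin T) ℂ) (x : ℝ) :
    Matrix (Fin T) (Fin T) ℂ :=
  f x + ((x : ℂ) ^ (2 * n)) • g x

/-- The weight `λ^{2n} / |1 - e^{i λ μ}|^{2n}`. -/
def weight (n μ : ℕ) (x : ℝ) : ℂ := (x : ℂ) ^ (2 * n) / ((‖1 - character μ x‖ : ℝ) : ℂ) ^ (2 * n)

/-- The minimality condition: `p(λ)` is invertible for almost all `λ`, and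
`∫ Tr [λ^{2n} |1 - e^{i λ μ}|^{-2n} p(λ)^{-1}] dλ < ∞`. -/
def MinimalityCondition {T : ℕ} (n μ : ℕ) (f g : ℝ → Matrix (Fin T) (Fin T) ℂ) : Prop :=
  (∀ᵐ x ∂freq, IsUnit (obsDensity n f g x)) ∧
    Integrable (fun x => weight n μ x * ((obsDensity n f g x)⁻¹).trace) freq

/-! ### The stochastic integral -/

/-- The squared seminorm `∫ h(λ)ᵀ p(λ) conj(h(λ)) dλ / (2π)` of a vector function. -/
def sqNorm {T : ℕ} (p : ℝ → Matrix (Fin T) (Fin T) ℂ) (h : ℝ → Fin T → ℂ) : ℝ≥0∞ :=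
  ∫⁻ x, ENNReal.ofReal (((h x) ᵥ* (p x)) ⬝ᵥ star (h x)).re ∂freq

/-- `Y = ∫ h(λ)ᵀ dZ(λ)`, where `Z` is the orthogonal vector stochastic measure in the spectral
representation `X^{(n)}(m, s) = ∫ e^{imλ} (1 - e^{-isλ})^n (iλ)^{-n} dZ(λ)` (all `m`, `s`) of
the increments of `X`, and `p` is the spectral density of these increments. The integral is the
isometric extension, from `L₂(p)` to `L₂(P)`, of the correspondence given by this representation:
`h` and `Y` are simultaneous limits of corresponding finite linear combinations. -/
def IsSpectralIntegral {Ω : Type*} [MeasurableSpace Ω] (P : Measure Ω) {T : ℕ} (n : ℕ)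
    (X : ℤ → Fin T → Ω → ℂ) (p : ℝ → Matrix (Fin T) (Fin T) ℂ) (h : ℝ → Fin T → ℂ)
    (Y : Ω → ℂ) : Prop :=
  AEMeasurable h freq ∧ MemLp Y 2 P ∧
    ∀ ε : ℝ≥0∞, 0 < ε → ∃ c : (ℤ × ℤ × Fin T) →₀ ℂ,
      sqNorm p (fun x => h x - c.sum fun i z =>
        Pi.single i.2.2 (z * (character i.1 x * incFactor n i.2.1 x))) < ε ∧
      eLpNorm (fun ω => Y ω - c.sum fun i z => z * vecIncrement n i.2.1 X i.1 i.2.2 ω) 2 P < ε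

/-! ### Linear estimates -/

/-- The closed linear span in `L₂(P)` of the observed increments: those of step `μ` at the points
`k ≤ -1`, and those of step `-μ` at the points `k ≥ N + 1`. -/
def observedIncrements {Ω : Type*} [MeasurableSpace Ω] (P : Measure Ω) {T : ℕ} (n μ N : ℕ)
    (Z : ℤ → Fin T → Ω → ℂ) : Submodule ℂ (Lp ℂ 2 P) :=
  (Submodule.span ℂ {u : Lp ℂ 2 P |
    (∃ k : ℤ, k ≤ -1 ∧ ∃ p, u =ᵐ[P] vecIncrement n (μ : ℤ) Z k p) ∨
    (∃ k : ℤ, (N : ℤ) + 1 ≤ k ∧ ∃ p, u =ᵐ[P] vecIncrement n (-(μ : ℤ)) Z k p)}).topologicalClosure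

/-- The linear estimates with the initial value functional `V`: the random variables `u - V` with
`u` in the closed span of the observed increments. -/
def IsLinearEstimate {Ω : Type*} [MeasurableSpace Ω] (P : Measure Ω) {T : ℕ} (n μ N : ℕ)
    (Z : ℤ → Fin T → Ω → ℂ) (V : Ω → ℂ) (E : Ω → ℂ) : Prop :=
  ∃ u ∈ observedIncrements P n μ N Z, E =ᵐ[P] fun ω => u ω - V ω

/-- The mean square error of `E` as an estimate of `A`. -/
def mse {Ω : Type*} [MeasurableSpace Ω] (P : Measure Ω) (A E : Ω → ℂ) : ℝ :=
  ∫ ω, ‖A ω - E ω‖ ^ 2 ∂P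

/-- `E` is a linear estimate of `A` of the least mean square error. -/
def IsOptimalEstimate {Ω : Type*} [MeasurableSpace Ω] (P : Measure Ω) {T : ℕ} (n μ N : ℕ)
    (Z : ℤ → Fin T → Ω → ℂ) (V A : Ω → ℂ) (E : Ω → ℂ) : Prop :=
  IsLinearEstimate P n μ N Z V E ∧
    ∀ E', IsLinearEstimate P n μ N Z V E' → mse P A E ≤ mse P A E'

/-! ### Coefficients -/

/-- The functional `∑_{k=0}^M a(k) x(k)`. -/
def scalarFunctional {Ω : Type*} (M : ℕ) (a : ℕ → ℂ) (x : ℤ → Ω → ℂ) (ω : Ω) : ℂ :=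
  ∑ k ∈ Finset.range (M + 1), a k * x k ω

/-- The vector coefficients of the blocked functional: the component `p` (counted from `0`) of the
`m`-th one is `a(m T + p)` if `m T + p ≤ M`, and `0` otherwise. -/
def blockCoeff (T M : ℕ) (a : ℕ → ℂ) (m : ℕ) (p : Fin T) : ℂ :=
  if m * T + p ≤ M then a (m * T + p) else 0

/-- The coefficient at `x^k` of `(∑_j x^{μ j})^n`. -/
def dCoeff (n μ k : ℕ) : ℂ :=
  PowerSeries.coeff k ((PowerSeries.mk fun j => if μ ∣ j then (1 : ℂ) else 0) ^ n)

/-- `b(k) = ∑_{m=k}^N d_μ(m - k) a(m)`, which is `0` for `k > N`. -/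
def bCoeff {T : ℕ} (n μ N : ℕ) (a : ℕ → Fin T → ℂ) (k : ℕ) (p : Fin T) : ℂ :=
  ∑ m ∈ Finset.Icc k N, a m p * dCoeff n μ (m - k)

/-- `v(-j) = ∑_l (-1)^l C(n,l) b(l μ - j)`, over `⌈j / μ⌉ ≤ l ≤ min (⌊(N + j) / μ⌋, n)`. -/
def vCoeff {T : ℕ} (n μ N : ℕ) (a : ℕ → Fin T → ℂ) (j : ℕ) (p : Fin T) : ℂ :=
  ∑ l ∈ Finset.Icc ⌈(j : ℚ) / μ⌉₊ (min ((N + j) / μ) n),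
    (-1 : ℂ) ^ l * (n.choose l : ℂ) * bCoeff n μ N a (l * μ - j) p

/-- The initial value functional `∑_{k=-μn}^{-1} v(k)ᵀ Z(k)`. -/
def initialValues {Ω : Type*} {T : ℕ} (n μ N : ℕ) (a : ℕ → Fin T → ℂ)
    (Z : ℤ → Fin T → Ω → ℂ) (ω : Ω) : ℂ :=
  ∑ j ∈ Finset.Icc 1 (μ * n), ∑ p, vCoeff n μ N a j p * Z (-(j : ℤ)) p ω

/-- `a_μ(m) = ∑_l (-1)^l C(n,l) a(m - μ l)`, over
`max (⌈(m - N) / μ⌉, 0) ≤ l ≤ min (⌊m / μ⌋, n)`. The subtraction `m - N` truncates at `0`, which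
accounts for the maximum. -/
def aMuCoeff {T : ℕ} (n μ N : ℕ) (a : ℕ → Fin T → ℂ) (m : ℕ) (p : Fin T) : ℂ :=
  ∑ l ∈ Finset.Icc ⌈((m - N : ℕ) : ℚ) / μ⌉₊ (min (m / μ) n),
    (-1 : ℂ) ^ l * (n.choose l : ℂ) * a (m - μ * l) p

/-- The vector with the blocks `c(0), …, c(L)`. -/
def stack {T : ℕ} (L : ℕ) (c : ℕ → Fin T → ℂ) : Fin (L + 1) × Fin T → ℂ := fun i => c i.1 i.2

/-- The vector trigonometric polynomial `∑_{k=0}^L c(k) e^{i k λ}`, for a vector with the blocks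
`c(0), …, c(L)`. -/
def trigPoly {T : ℕ} {L : ℕ} (c : Fin (L + 1) × Fin T → ℂ) (x : ℝ) (p : Fin T) : ℂ :=
  ∑ k : Fin (L + 1), c (k, p) * character (k : ℕ) x

/-- The block Toeplitz matrix with the `T × T` blocks
`(1 / (2π)) ∫ e^{i λ (k - j)} F(λ)ᵀ dλ`, `0 ≤ j, k ≤ L`. -/
def blockToeplitz {T : ℕ} (L : ℕ) (F : ℝ → Matrix (Fin T) (Fin T) ℂ) :
    Matrix (Fin (L + 1) × Fin T) (Fin (L + 1) × Fin T) ℂ :=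
  fun j k => ∫ x, character ((k.1 : ℕ) - (j.1 : ℕ) : ℤ) x * (F x)ᵀ j.2 k.2 ∂freq

/-- The function `λ^{2n} |1 - e^{iλμ}|^{-2n} p(λ)^{-1}`. -/
def pSymbol {T : ℕ} (n μ : ℕ) (f g : ℝ → Matrix (Fin T) (Fin T) ℂ) (x : ℝ) :
    Matrix (Fin T) (Fin T) ℂ :=
  weight n μ x • (obsDensity n f g x)⁻¹

/-- The function `λ^{2n} |1 - e^{iλμ}|^{-2n} g(λ) p(λ)^{-1}`. -/
def tSymbol {T : ℕ} (n μ : ℕ) (f g : ℝ → Matrix (Fin T) (Fin T) ℂ) (x : ℝ) :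
    Matrix (Fin T) (Fin T) ℂ :=
  weight n μ x • (g x * (obsDensity n f g x)⁻¹)

/-- The function `f(λ) p(λ)^{-1} g(λ)`. -/
def qSymbol {T : ℕ} (n : ℕ) (f g : ℝ → Matrix (Fin T) (Fin T) ℂ) (x : ℝ) :
    Matrix (Fin T) (Fin T) ℂ :=
  f x * (obsDensity n f g x)⁻¹ * g x

/-- The matrix with the blocks given by the Fourier coefficients of the transpose of
`λ^{2n} |1 - e^{iλμ}|^{-2n} p(λ)^{-1}`. -/
def pMatrix {T : ℕ} (n μ N : ℕ) (f g : ℝ → Matrix (Fin T) (Fin T) ℂ) :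
    Matrix (Fin (N + μ * n + 1) × Fin T) (Fin (N + μ * n + 1) × Fin T) ℂ :=
  blockToeplitz (N + μ * n) (pSymbol n μ f g)

/-- The vector `[D a]_{+μn} - T a_μ`, where `[D a]_{+μn}` has the blocks
`b(0), …, b(N), 0, …, 0`. -/
def rhsVector {T : ℕ} (n μ N : ℕ) (f g : ℝ → Matrix (Fin T) (Fin T) ℂ) (a : ℕ → Fin T → ℂ) :
    Fin (N + μ * n + 1) × Fin T → ℂ :=
  stack (N + μ * n) (bCoeff n μ N a)
    - blockToeplitz (N + μ * n) (tSymbol n μ f g) *ᵥ stack (N + μ * n) (aMuCoeff n μ N a)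

/-- The vector `P⁻¹ [D a]_{+μn} - P⁻¹ T a_μ` of the coefficients of `C(e^{iλ})`. -/
def cVector {T : ℕ} (n μ N : ℕ) (f g : ℝ → Matrix (Fin T) (Fin T) ℂ) (a : ℕ → Fin T → ℂ) :
    Fin (N + μ * n + 1) × Fin T → ℂ :=
  (pMatrix n μ N f g)⁻¹ *ᵥ rhsVector n μ N f g a

/-- The spectral characteristic
`hᵀ = Bᵀ (1 - e^{-iλμ})^n / (iλ)^n - Aᵀ g (-iλ)^n p⁻¹ - (-iλ)^n / (1 - e^{iλμ})^n Cᵀ p⁻¹`. -/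
def spectralChar {T : ℕ} (n μ N : ℕ) (f g : ℝ → Matrix (Fin T) (Fin T) ℂ)
    (a : ℕ → Fin T → ℂ) (x : ℝ) : Fin T → ℂ :=
  incFactor n μ x • trigPoly (stack N (bCoeff n μ N a)) x
    - (-(Complex.I * (x : ℂ))) ^ n •
        (trigPoly (stack N a) x ᵥ* (g x * (obsDensity n f g x)⁻¹))
    - ((-(Complex.I * (x : ℂ))) ^ n / (1 - character μ x) ^ n) •
        (trigPoly (cVector n μ N f g a) x ᵥ* (obsDensity n f g x)⁻¹)

/-- The row `(1 - e^{iλμ})^n Aᵀ g + Cᵀ`. -/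
def errorRow₁ {T : ℕ} (n μ N : ℕ) (f g : ℝ → Matrix (Fin T) (Fin T) ℂ)
    (a : ℕ → Fin T → ℂ) (x : ℝ) : Fin T → ℂ :=
  (1 - character μ x) ^ n • (trigPoly (stack N a) x ᵥ* g x) + trigPoly (cVector n μ N f g a) x

/-- The row `(1 - e^{iλμ})^n Aᵀ f - λ^{2n} Cᵀ`. -/
def errorRow₂ {T : ℕ} (n μ N : ℕ) (f g : ℝ → Matrix (Fin T) (Fin T) ℂ)
    (a : ℕ → Fin T → ℂ) (x : ℝ) : Fin T → ℂ :=
  (1 - character μ x) ^ n • (trigPoly (stack N a) x ᵥ* f x)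
    - ((x : ℂ) ^ (2 * n)) • trigPoly (cVector n μ N f g a) x

/-- `λ^{2n} |1 - e^{iλμ}|^{-2n} r₁ p⁻¹ f p⁻¹ r₁^*`, for the row `r₁ = (1 - e^{iλμ})^n Aᵀ g + Cᵀ`. -/
def errorDensity₁ {T : ℕ} (n μ N : ℕ) (f g : ℝ → Matrix (Fin T) (Fin T) ℂ)
    (a : ℕ → Fin T → ℂ) (x : ℝ) : ℂ :=
  weight n μ x *
    ((errorRow₁ n μ N f g a x ᵥ* ((obsDensity n f g x)⁻¹ * f x * (obsDensity n f g x)⁻¹))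
      ⬝ᵥ star (errorRow₁ n μ N f g a x))

/-- `|1 - e^{iλμ}|^{-2n} r₂ p⁻¹ g p⁻¹ r₂^*`, for the row
`r₂ = (1 - e^{iλμ})^n Aᵀ f - λ^{2n} Cᵀ`. -/
def errorDensity₂ {T : ℕ} (n μ N : ℕ) (f g : ℝ → Matrix (Fin T) (Fin T) ℂ)
    (a : ℕ → Fin T → ℂ) (x : ℝ) : ℂ :=
  (1 / ((‖1 - character μ x‖ : ℝ) : ℂ) ^ (2 * n)) *
    ((errorRow₂ n μ N f g a x ᵥ* ((obsDensity n f g x)⁻¹ * g x * (obsDensity n f g x)⁻¹))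
      ⬝ᵥ star (errorRow₂ n μ N f g a x))

/-- `⟨[D a]_{+μn} - T a_μ, P⁻¹ [D a]_{+μn} - P⁻¹ T a_μ⟩ + ⟨Q a, a⟩`, where
`⟨u, v⟩ = ∑ u_i conj(v_i)`. -/
def errorForm {T : ℕ} (n μ N : ℕ) (f g : ℝ → Matrix (Fin T) (Fin T) ℂ)
    (a : ℕ → Fin T → ℂ) : ℂ :=
  rhsVector n μ N f g a ⬝ᵥ star (cVector n μ N f g a)
    + (blockToeplitz N (qSymbol n f g) *ᵥ stack N a) ⬝ᵥ star (stack N a)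

end

end PerStat

/-! The functional `A` need not have a second moment, but `Y = A + V` does. The coefficients `b`
invert the `n`-fold difference of step `μ`, so summation by parts turns `Y` into the combination of
the increments `ζ^{(n)}(k, μ)` with coefficients `b(k)`, minus the functional `∑ a(m) η(m)` of the
noise (`scalarFunctional_add_initialValues`). The error of an estimate `u - V` is `Y - u`, hence the
optimal `u` is the orthogonal projection of `Y` onto the closed span of the observed increments, and
existence, uniqueness and optimality are Pythagoras (`isOptimalEstimate_iff`).

The projection is computed in a spectral domain for the pair of signal and noise. Its elements are
rows with `2T` entries, normed by the density `S = diag(f, g)`. Increments of `ξ` correspond to rows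
`(·, 0)`, values of `η` to rows `(0, ·)`; the two families have equal Gram matrices, so the closed
graph of the correspondence is isometric (`exists_isSpectralIsometry`). To stay in an ordinary `L₂`
space, `S` is factored as `R R^*` and a row `w` is replaced by `w R`. An integral `∫ hᵀ dZ` of the
observations becomes `(h, (iλ)^n h)`, whose squared norm is that of `h` in `L₂(p)`. With `χ = (1 -
e^{-iλμ})^n / (iλ)^n`, the row of `Y` is `(χ B, (iλ)^n χ B - A)`. Since `h = χ B - E₁` with `E₁ =
(-iλ)^n (1 - e^{iλμ})^{-n} r₁ p⁻¹`, the error row is `(E₁, (iλ)^n E₁ - A)`.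

An increment of step `-μ` is, up to sign, one of step `μ` shifted by `μn`, so the unobserved indices
are exactly `0, …, K`, `K = N + μn`. Two facts identify the projection.

Orthogonality: pairing the error row with the row of `ζ_p^{(n)}(k, μ)` leaves `e^{-ikλ} C_p`
(`errorPart_form_incRow`), and `C` has frequencies only in `0, …, K`.

Membership: `h = χ r` with `r` integrable, and the system `P c = b - T a_μ` says that the Fourier
coefficients of `r` at `0, …, K` vanish (`integral_character_mul_charQuotient`). If `ψ` is
orthogonal to all observed rows, its pairing with `χ` times a coordinate is an integrable function
with frequencies only in `0, …, K`, hence a trigonometric polynomial; so `⟨ψ, h⟩` is a combination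
of vanishing coefficients of `r` (`mem_closure_span_rowLp`).

`P` is invertible because its symbol is positive definite almost everywhere
(`isUnit_blockToeplitz`). The two error densities are the `f`- and `g`-forms of the two halves of
the error row. In their sum the cross terms cancel because `g p⁻¹ f = f p⁻¹ g`, leaving the form of
`f p⁻¹ g` at `A` plus the form of the symbol of `P` at `C` (`error_form_eq`). This gives both
integrability and the closed formula for the error. -/

namespace PerStat

/-! ### Square roots of matrix functions -/

section MatrixSqrt

open scoped Matrix.Norms.L2Operator MatrixOrder

/-- The continuous functional calculus of a fixed continuous function depends continuously on the
element. This is the source of measurability of the factor `R`. -/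
theorem continuousOn_matrix_sqrt {ι : Type*} [Fintype ι] [DecidableEq ι] :
    ContinuousOn (fun A : Matrix ι ι ℂ => CFC.sqrt A) {A | A.PosSemidef} := by
  have h : ContinuousOn (fun A : Matrix ι ι ℂ => cfc NNReal.sqrt A) {A | A.PosSemidef} :=
    ContinuousOn.cfc_nnreal_of_mem_nhdsSet (s := Set.univ) NNReal.sqrt Filter.univ_mem
      continuousOn_id (fun A hA => Matrix.nonneg_iff_posSemidef.2 hA)
      NNReal.continuous_sqrt.continuousOn
  refine h.congr fun A hA => ?_
  exact CFC.sqrt_eq_cfc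

theorem isClosed_posSemidef {ι : Type*} [Fintype ι] [DecidableEq ι] :
    IsClosed {A : Matrix ι ι ℂ | A.PosSemidef} := by
  have : {A : Matrix ι ι ℂ | A.PosSemidef} = {A | 0 ≤ A} := by
    ext A; exact Matrix.nonneg_iff_posSemidef.symm
  rw [this]
  exact CStarAlgebra.isClosed_nonneg

/-- A measurable positive semidefinite matrix function has a measurable square root. -/
theorem exists_aemeasurable_mul_conjTranspose {X : Type*} [MeasurableSpace X] {ν : Measure X}
    {ι : Type*} [Fintype ι] [DecidableEq ι] {S : X → Matrix ι ι ℂ}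
    (hS : ∀ i j, AEMeasurable (fun x => S x i j) ν) (hpos : ∀ᵐ x ∂ν, (S x).PosSemidef) :
    ∃ R : X → Matrix ι ι ℂ, (∀ i j, AEMeasurable (fun x => R x i j) ν) ∧
      ∀ᵐ x ∂ν, R x * (R x)ᴴ = S x := by
  classical
  let _ : MeasurableSpace (Matrix ι ι ℂ) := MeasurableSpace.pi (X := fun _ : ι => ι → ℂ)
  have _ : BorelSpace (Matrix ι ι ℂ) := Pi.borelSpace (X := fun _ : ι => ι → ℂ)
  have hSm : AEMeasurable S ν :=
    aemeasurable_pi_lambda (X := fun _ : ι => ι → ℂ) S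
      fun i => aemeasurable_pi_lambda (fun x => S x i) fun j => hS i j
  -- The square root is continuous on the closed cone only; extended by `0` it is Borel on all
  -- matrices, so it can be composed with `S`, which is semidefinite only almost everywhere.
  have hG : Measurable ({A : Matrix ι ι ℂ | A.PosSemidef}.piecewise
      (fun A => CFC.sqrt A) (fun _ => 0)) :=
    continuousOn_matrix_sqrt.measurable_piecewise continuousOn_const
      isClosed_posSemidef.measurableSet
  have hR := hG.comp_aemeasurable hSm
  refine ⟨fun x => ({A : Matrix ι ι ℂ | A.PosSemidef}.piecewise
      (fun A => CFC.sqrt A) (fun _ => 0)) (S x), fun i j => ?_, ?_⟩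
  · exact ((measurable_pi_apply j).comp
      (measurable_pi_apply (X := fun _ : ι => ι → ℂ) i)).comp_aemeasurable hR
  · filter_upwards [hpos] with x hx
    have h0 : (0 : Matrix ι ι ℂ) ≤ S x := Matrix.nonneg_iff_posSemidef.2 hx
    have hmem : S x ∈ {A : Matrix ι ι ℂ | A.PosSemidef} := hx
    rw [Set.piecewise_eq_of_mem _ _ _ hmem]
    have hsa : (CFC.sqrt (S x))ᴴ = CFC.sqrt (S x) :=
      (Matrix.nonneg_iff_posSemidef.1 (CFC.sqrt_nonneg (S x))).1
    rw [hsa]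
    exact CFC.sqrt_mul_sqrt_self (S x) h0

end MatrixSqrt

/-! ### Families of vectors with the same Gram matrix -/

section Gram

variable {ι E F : Type*} [NormedAddCommGroup E] [InnerProductSpace ℂ E]
  [NormedAddCommGroup F] [InnerProductSpace ℂ F]

/-- The closed graph of the correspondence `x i ↦ y i`, for `i` in `s`. -/
noncomputable def corrGraph (x : ι → E) (y : ι → F) (s : Set ι) : Submodule ℂ (E × F) :=
  (Submodule.span ℂ ((fun i => (x i, y i)) '' s)).topologicalClosure

theorem corrGraph_mono (x : ι → E) (y : ι → F) {s t : Set ι} (h : s ⊆ t) :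
    corrGraph x y s ≤ corrGraph x y t :=
  Submodule.topologicalClosure_mono (Submodule.span_mono (Set.image_mono h))

theorem mem_corrGraph (x : ι → E) (y : ι → F) {s : Set ι} {i : ι} (hi : i ∈ s) :
    (x i, y i) ∈ corrGraph x y s :=
  Submodule.le_topologicalClosure _ (Submodule.subset_span ⟨i, hi, rfl⟩)

/-- The identity is sesquilinear, so it passes from generators to the span, and it is a closed
condition on pairs, so it passes to the closure. -/
theorem inner_fst_eq_inner_snd {x : ι → E} {y : ι → F}
    (h : ∀ i j, inner ℂ (x i) (x j) = inner ℂ (y i) (y j)) {a b : E × F}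
    (ha : a ∈ corrGraph x y Set.univ) (hb : b ∈ corrGraph x y Set.univ) :
    inner ℂ a.1 b.1 = inner ℂ a.2 b.2 := by
  have hspan : ∀ a ∈ Submodule.span ℂ ((fun i => (x i, y i)) '' Set.univ),
      ∀ b ∈ Submodule.span ℂ ((fun i => (x i, y i)) '' Set.univ),
      inner ℂ a.1 b.1 = inner ℂ a.2 b.2 := by
    intro a ha b hb
    induction ha, hb using Submodule.span_induction₂ with
    | mem_mem a b ha hb =>
      obtain ⟨i, -, rfl⟩ := ha
      obtain ⟨j, -, rfl⟩ := hb
      exact h i j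
    | zero_left => simp
    | zero_right => simp
    | add_left _ _ _ _ _ _ h1 h2 => simp [h1, h2]
    | add_right _ _ _ _ _ _ h1 h2 => simp [h1, h2]
    | smul_left _ _ _ _ _ h1 => simp [h1]
    | smul_right _ _ _ _ _ h1 => simp [h1]
  have hcl : IsClosed {p : (E × F) × (E × F) | inner ℂ p.1.1 p.2.1 = inner ℂ p.1.2 p.2.2} :=
    isClosed_eq (by fun_prop) (by fun_prop)
  have hmem : (a, b) ∈ closure
      ((Submodule.span ℂ ((fun i => (x i, y i)) '' Set.univ) : Set (E × F)) ×ˢ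
        (Submodule.span ℂ ((fun i => (x i, y i)) '' Set.univ) : Set (E × F))) := by
    rw [closure_prod_eq]
    exact ⟨ha, hb⟩
  exact hcl.closure_subset_iff.2 (fun p hp => hspan _ hp.1 _ hp.2) hmem

theorem norm_fst_eq_norm_snd {x : ι → E} {y : ι → F}
    (h : ∀ i j, inner ℂ (x i) (x j) = inner ℂ (y i) (y j)) {a : E × F}
    (ha : a ∈ corrGraph x y Set.univ) : ‖a.1‖ = ‖a.2‖ := by
  rw [@norm_eq_sqrt_re_inner ℂ, @norm_eq_sqrt_re_inner ℂ F, inner_fst_eq_inner_snd h ha ha]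

theorem fst_mem_closure_span {x : ι → E} {y : ι → F} {s : Set ι} {a : E × F}
    (ha : a ∈ corrGraph x y s) : a.1 ∈ (Submodule.span ℂ (x '' s)).topologicalClosure := by
  have hcl : IsClosed {p : E × F | p.1 ∈ (Submodule.span ℂ (x '' s)).topologicalClosure} :=
    (Submodule.isClosed_topologicalClosure _).preimage continuous_fst
  refine hcl.closure_subset_iff.2 (fun p hp => ?_) ha
  have : Submodule.span ℂ ((fun i => (x i, y i)) '' s) ≤
      (Submodule.span ℂ (x '' s)).topologicalClosure.comap (LinearMap.fst ℂ E F) := by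
    rw [Submodule.span_le]
    rintro _ ⟨i, hi, rfl⟩
    exact Submodule.le_topologicalClosure _ (Submodule.subset_span ⟨i, hi, rfl⟩)
  exact this hp

/-- Every element of the closed span of the `y i` corresponds to an element of the closed span of
the `x i`. -/
theorem exists_mem_corrGraph [CompleteSpace E] [CompleteSpace F] {x : ι → E} {y : ι → F}
    (h : ∀ i j, inner ℂ (x i) (x j) = inner ℂ (y i) (y j)) {s : Set ι} {v : F}
    (hv : v ∈ (Submodule.span ℂ (y '' s)).topologicalClosure) :
    ∃ u, (u, v) ∈ corrGraph x y s := by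
  have hle := corrGraph_mono x y (Set.subset_univ s)
  let φ : corrGraph x y s →ₗ[ℂ] F := (LinearMap.snd ℂ E F).comp (corrGraph x y s).subtype
  -- On the graph both components have the same norm and the product norm is their maximum, so the
  -- second projection is isometric. Its domain is complete, hence its range is closed.
  have hanti : AntilipschitzWith 1 φ := by
    refine AddMonoidHomClass.antilipschitz_of_bound φ fun a => ?_
    have h1 := norm_fst_eq_norm_snd h (hle a.2)
    have h2 : ‖(a : E × F)‖ = max ‖(a : E × F).1‖ ‖(a : E × F).2‖ := rfl
    rw [h1, max_self] at h2
    simp only [NNReal.coe_one, one_mul]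
    exact h2.le
  have hcont : UniformContinuous φ :=
    (uniformContinuous_snd).comp uniformContinuous_subtype_val
  have : CompleteSpace (corrGraph x y s) :=
    (Submodule.isClosed_topologicalClosure _).completeSpace_coe
  have hcl : IsClosed (Set.range φ) := hanti.isClosed_range hcont
  have hsub : (Submodule.span ℂ (y '' s)) ≤ LinearMap.range φ := by
    rw [Submodule.span_le]
    rintro _ ⟨i, hi, rfl⟩
    exact ⟨⟨(x i, y i), mem_corrGraph x y hi⟩, rfl⟩
  have hv' : v ∈ (LinearMap.range φ : Set F) := by
    rw [LinearMap.coe_range]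
    exact hcl.closure_subset_iff.2 (fun p hp => hsub hp) hv
  obtain ⟨a, rfl⟩ := hv'
  exact ⟨(a : E × F).1, a.2⟩

end Gram

end PerStat

namespace PerStat

/-! ### The frequency measure and the characters -/

instance isFiniteMeasure_freq : IsFiniteMeasure freq := by
  unfold freq
  exact Measure.smul_finite _ ENNReal.ofReal_ne_top

theorem freq_ne_zero_coeff : ENNReal.ofReal (1 / (2 * Real.pi)) ≠ 0 := by
  have := Real.pi_pos
  rw [ne_eq, ENNReal.ofReal_eq_zero, not_le]
  positivity

theorem ae_freq_iff {q : ℝ → Prop} :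
    (∀ᵐ x ∂freq, q x) ↔ ∀ᵐ x ∂volume.restrict (Set.Ico (-Real.pi) Real.pi), q x := by
  unfold freq
  rw [Measure.ae_ennreal_smul_measure_iff freq_ne_zero_coeff]

theorem integral_freq (F : ℝ → ℂ) :
    ∫ x, F x ∂freq = (1 / (2 * Real.pi) : ℂ) * ∫ x in Set.Ico (-Real.pi) Real.pi, F x := by
  unfold freq
  have := Real.pi_pos
  rw [integral_smul_measure, ENNReal.toReal_ofReal (by positivity), Complex.real_smul]
  push_cast
  rfl

theorem integrable_freq_iff {F : ℝ → ℂ} :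
    Integrable F freq ↔ IntegrableOn F (Set.Ico (-Real.pi) Real.pi) := by
  unfold freq
  exact integrable_smul_measure freq_ne_zero_coeff ENNReal.ofReal_ne_top

theorem ae_freq_of_countable {s : Set ℝ} (hs : s.Countable) : ∀ᵐ x ∂freq, x ∉ s := by
  rw [ae_freq_iff]
  exact hs.ae_notMem _

theorem ae_ne_zero : ∀ᵐ x ∂freq, x ≠ 0 := by
  simpa using ae_freq_of_countable (Set.countable_singleton (0 : ℝ))

theorem character_eq_exp (k : ℤ) (x : ℝ) :
    character k x = Complex.exp (((k * x : ℝ) : ℂ) * Complex.I) := by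
  unfold character
  congr 1
  push_cast
  ring

@[simp] theorem character_zero (x : ℝ) : character 0 x = 1 := by simp [character]

theorem character_add (k l : ℤ) (x : ℝ) : character (k + l) x = character k x * character l x := by
  unfold character
  rw [← Complex.exp_add]
  congr 1
  push_cast
  ring

@[simp] theorem norm_character (k : ℤ) (x : ℝ) : ‖character k x‖ = 1 := by
  rw [character_eq_exp]
  exact Complex.norm_exp_ofReal_mul_I _

@[simp] theorem star_character (k : ℤ) (x : ℝ) : star (character k x) = character (-k) x := by
  unfold character
  rw [Complex.star_def, ← Complex.exp_conj]
  congr 1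
  simp

theorem character_pow (k : ℤ) (m : ℕ) (x : ℝ) : character k x ^ m = character (m * k) x := by
  unfold character
  rw [← Complex.exp_nat_mul]
  congr 1
  push_cast
  ring

@[fun_prop] theorem continuous_character (k : ℤ) : Continuous (character k) := by
  unfold character
  fun_prop

theorem integrable_character_mul {k : ℤ} {F : ℝ → ℂ} (hF : Integrable F freq) :
    Integrable (fun x => character k x * F x) freq :=
  hF.bdd_mul (c := 1) (continuous_character k).aestronglyMeasurable
    (Filter.Eventually.of_forall fun x => (norm_character k x).le)

theorem ae_character_ne_one {k : ℤ} (hk : k ≠ 0) : ∀ᵐ x ∂freq, character k x ≠ 1 := by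
  have hc : (Set.range fun m : ℤ => (m * (2 * Real.pi) / k : ℝ)).Countable := Set.countable_range _
  filter_upwards [ae_freq_of_countable hc] with x hx h
  unfold character at h
  obtain ⟨m, hm⟩ := Complex.exp_eq_one_iff.1 h
  apply hx
  refine ⟨m, ?_⟩
  have hk' : (k : ℝ) ≠ 0 := by exact_mod_cast hk
  have h2 : ((k * x : ℝ) : ℂ) * Complex.I = ((m * (2 * Real.pi) : ℝ) : ℂ) * Complex.I := by
    push_cast
    linear_combination hm
  have h3 : (k * x : ℝ) = m * (2 * Real.pi) := by
    exact_mod_cast mul_right_cancel₀ Complex.I_ne_zero h2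
  simp only
  rw [← h3]
  field_simp

theorem integral_character (k : ℤ) : ∫ x, character k x ∂freq = if k = 0 then 1 else 0 := by
  have hpi := Real.pi_pos
  rw [integral_freq, integral_Ico_eq_integral_Ioo, ← integral_Ioc_eq_integral_Ioo,
    ← intervalIntegral.integral_of_le (by linarith)]
  have hpi' : (Real.pi : ℂ) ≠ 0 := by exact_mod_cast hpi.ne'
  split_ifs with h
  · subst h
    simp
    field_simp
    norm_num
  · have hk : Complex.I * (k : ℂ) ≠ 0 := mul_ne_zero Complex.I_ne_zero (by exact_mod_cast h)
    unfold character
    rw [integral_exp_mul_complex hk]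
    have : Complex.exp (Complex.I * k * (Real.pi : ℝ)) =
        Complex.exp (Complex.I * k * ((-Real.pi : ℝ) : ℂ)) := by
      rw [Complex.exp_eq_exp_iff_exists_int]
      exact ⟨k, by push_cast; ring⟩
    rw [this]
    simp

/-- An integrable function on `[-π, π)` with vanishing Fourier coefficients vanishes almost
everywhere. -/
theorem ae_eq_zero_of_integral_character_mul {F : ℝ → ℂ} (hF : Integrable F freq)
    (h : ∀ k : ℤ, ∫ x, character k x * F x ∂freq = 0) : ∀ᵐ x ∂freq, F x = 0 := by
  have hpi := Real.pi_pos
  have hfact : Fact (0 < 2 * Real.pi) := ⟨by positivity⟩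
  have hbdd : ∀ H : C(AddCircle (2 * Real.pi), ℂ), Integrable (fun x : ℝ => H x * F x) freq := by
    intro H
    refine hF.bdd_mul (c := ‖H‖) ?_ (Filter.Eventually.of_forall fun x => H.norm_coe_le_norm _)
    exact (H.continuous.comp (AddCircle.continuous_mk' _)).aestronglyMeasurable
  let L : C(AddCircle (2 * Real.pi), ℂ) →ₗ[ℂ] ℂ :=
    { toFun := fun H => ∫ x : ℝ, H x * F x ∂freq
      map_add' := fun H K => by
        simp only [ContinuousMap.add_apply, add_mul]
        exact integral_add (hbdd H) (hbdd K)
      map_smul' := fun c H => by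
        simp only [ContinuousMap.smul_apply, smul_eq_mul, mul_assoc, RingHom.id_apply]
        exact integral_const_mul c _ }
  -- Integration against `F` is a bounded functional for the uniform norm, with bound the `L₁` norm
  -- of `F`; it vanishes on the exponentials, whose span is dense.
  let L' : C(AddCircle (2 * Real.pi), ℂ) →L[ℂ] ℂ :=
    L.mkContinuous (∫ x, ‖F x‖ ∂freq) fun H => by
      rw [mul_comm (∫ x, ‖F x‖ ∂freq), ← integral_const_mul]
      refine norm_integral_le_of_norm_le (hF.norm.const_mul _)
        (Filter.Eventually.of_forall fun x => ?_)
      rw [norm_mul]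
      exact mul_le_mul_of_nonneg_right (H.norm_coe_le_norm _) (norm_nonneg _)
  have hL : ∀ H, L' H = 0 := by
    have hle : (⊤ : Submodule ℂ C(AddCircle (2 * Real.pi), ℂ)) ≤ L'.ker := by
      rw [← span_fourier_closure_eq_top]
      refine Submodule.topologicalClosure_minimal _ ?_ L'.isClosed_ker
      rw [Submodule.span_le]
      rintro _ ⟨k, rfl⟩
      change ∫ x : ℝ, (fourier k (x : AddCircle (2 * Real.pi))) * F x ∂freq = 0
      rw [← h k]
      congr 1
      ext x
      rw [fourier_coe_apply]
      unfold character
      congr 2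
      have hpi' : (Real.pi : ℂ) ≠ 0 := by exact_mod_cast hpi.ne'
      push_cast
      field_simp
    exact fun H => hle (Submodule.mem_top (x := H))
  have hU : ∀ᵐ x ∂volume, x ∈ Set.Ioo (-Real.pi) Real.pi → F x = 0 := by
    refine isOpen_Ioo.ae_eq_zero_of_integral_contDiff_smul_eq_zero ?_ ?_
    · exact ((integrable_freq_iff.1 hF).mono_set Set.Ioo_subset_Ico_self).locallyIntegrableOn
    · intro g hg _ hgU
      -- A test function supported in the open interval vanishes at both endpoints, so it descends
      -- to a continuous function on the circle.
      have hout : ∀ x, x ∉ Set.Ioo (-Real.pi) Real.pi → g x = 0 := fun x hx =>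
        image_eq_zero_of_notMem_tsupport fun hx' => hx (hgU hx')
      let G : C(AddCircle (2 * Real.pi), ℂ) :=
        ⟨AddCircle.liftIco (2 * Real.pi) (-Real.pi) (fun x => (g x : ℂ)), by
          refine AddCircle.liftIco_continuous ?_ ?_
          · rw [hout _ (by simp), hout _ (by intro hx; have := hx.2; linarith)]
          · exact (Complex.continuous_ofReal.comp hg.continuous).continuousOn⟩
      have hG : ∫ x : ℝ, G x * F x ∂freq = 0 := hL G
      rw [integral_freq] at hG
      have hpi' : (1 / (2 * Real.pi) : ℂ) ≠ 0 := by
        have : (Real.pi : ℂ) ≠ 0 := by exact_mod_cast hpi.ne'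
        simp [this]
      have hG' := (mul_eq_zero.1 hG).resolve_left hpi'
      rw [← hG', ← setIntegral_eq_integral_of_forall_compl_eq_zero
        (s := Set.Ico (-Real.pi) Real.pi)]
      · refine setIntegral_congr_fun measurableSet_Ico fun x hx => ?_
        simp only [Complex.real_smul]
        congr 1
        symm
        exact AddCircle.liftIco_coe_apply (f := fun x => (g x : ℂ)) (by rwa [show -Real.pi + 2 * Real.pi = Real.pi by ring])
      · intro x hx
        rw [hout x fun hx' => hx (Set.Ioo_subset_Ico_self hx'), zero_smul]
  rw [ae_freq_iff, ae_restrict_iff' measurableSet_Ico]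
  have hne : ∀ᵐ x ∂(volume : Measure ℝ), x ≠ -Real.pi := by
    simpa using (Set.countable_singleton (-Real.pi)).ae_notMem (volume : Measure ℝ)
  filter_upwards [hU, hne] with x hx hx' hm
  exact hx ⟨lt_of_le_of_ne hm.1 (Ne.symm hx'), hm.2⟩

/-- An integrable function with finitely many nonzero Fourier coefficients is a trigonometric
polynomial. -/
theorem ae_eq_sum_character {F : ℝ → ℂ} (hF : Integrable F freq) (s : Finset ℤ)
    (h : ∀ k : ℤ, k ∉ s → ∫ x, character k x * F x ∂freq = 0) :
    ∃ c : ℤ → ℂ, ∀ᵐ x ∂freq, F x = ∑ k ∈ s, c k * character (-k) x := by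
  refine ⟨fun k => ∫ x, character k x * F x ∂freq, ?_⟩
  set c : ℤ → ℂ := fun k => ∫ x, character k x * F x ∂freq
  have hint : ∀ k : ℤ, Integrable (character k) freq := fun k => by
    simpa using integrable_character_mul (k := k) (integrable_const (1 : ℂ) (μ := freq))
  have hS : Integrable (fun x => ∑ k ∈ s, c k * character (-k) x) freq :=
    integrable_finsetSum _ fun k _ => (hint _).const_mul _
  have := ae_eq_zero_of_integral_character_mul (hF.sub hS) fun j => ?_
  · filter_upwards [this] with x hx
    exact sub_eq_zero.1 hx
  · simp only [Pi.sub_apply, mul_sub]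
    rw [integral_sub (integrable_character_mul hF) (integrable_character_mul hS)]
    simp only [Finset.mul_sum]
    rw [integral_finsetSum _ fun k _ => integrable_character_mul ((hint _).const_mul _)]
    have : ∀ k ∈ s, ∫ x, character j x * (c k * character (-k) x) ∂freq
        = if k = j then c k else 0 := by
      intro k _
      have : ∀ x, character j x * (c k * character (-k) x) = c k * character (j + -k) x := by
        intro x
        rw [character_add]
        ring
      simp only [this]
      rw [integral_const_mul, integral_character]
      by_cases hk : k = j
      · simp [hk]
      · have : j + -k ≠ 0 := by omega
        simp [hk, this]
    rw [Finset.sum_congr rfl this, Finset.sum_ite_eq' s j]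
    split_ifs with hj
    · exact sub_self _
    · rw [h j hj, sub_zero]

end PerStat

namespace PerStat

/-! ### Coefficients -/

theorem one_sub_X_pow_mul_mk {μ : ℕ} (hμ : 0 < μ) :
    (1 - PowerSeries.X ^ μ : PowerSeries ℂ) *
      (PowerSeries.mk fun j => if μ ∣ j then (1 : ℂ) else 0) = 1 := by
  ext t
  rw [sub_mul, one_mul, map_sub, PowerSeries.coeff_X_pow_mul', PowerSeries.coeff_mk,
    PowerSeries.coeff_one]
  by_cases h : μ ≤ t
  · have ht : t ≠ 0 := by omega
    have hd : μ ∣ t - μ ↔ μ ∣ t := by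
      rw [Nat.dvd_sub_iff_left h dvd_rfl]
    simp [h, PowerSeries.coeff_mk, hd, ht]
  · rcases Nat.eq_zero_or_pos t with rfl | ht
    · simp [h]
    · have : ¬ μ ∣ t := fun hd => h (Nat.le_of_dvd ht hd)
      simp [h, this, ht.ne']

/-- Compare coefficients in `(1 - x^μ)^n · (∑ x^{μj})^n = 1`: the `d_μ` invert the `n`-fold
difference of step `μ`. -/
theorem sum_alternating_choose_dCoeff {n μ : ℕ} (hμ : 0 < μ) (t : ℕ) :
    ∑ l ∈ Finset.range (n + 1), (if l * μ ≤ t then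
      (-1 : ℂ) ^ l * (n.choose l : ℂ) * dCoeff n μ (t - l * μ) else 0) = if t = 0 then 1 else 0 := by
  have h : (1 - PowerSeries.X ^ μ : PowerSeries ℂ) ^ n *
      (PowerSeries.mk fun j => if μ ∣ j then (1 : ℂ) else 0) ^ n = 1 := by
    rw [← mul_pow, one_sub_X_pow_mul_mk hμ, one_pow]
  have h2 : (1 - PowerSeries.X ^ μ : PowerSeries ℂ) ^ n =
      ∑ l ∈ Finset.range (n + 1),
        PowerSeries.C ((-1 : ℂ) ^ l * (n.choose l : ℂ)) * PowerSeries.X ^ (l * μ) := by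
    rw [sub_eq_neg_add, add_pow]
    refine Finset.sum_congr rfl fun l _ => ?_
    rw [one_pow, mul_one, neg_pow, ← pow_mul, mul_comm μ l, map_mul, map_pow, map_neg, map_one,
      map_natCast]
    ring
  rw [h2, Finset.sum_mul] at h
  have h3 := congrArg (PowerSeries.coeff t) h
  rw [map_sum, PowerSeries.coeff_one] at h3
  rw [← h3]
  refine Finset.sum_congr rfl fun l _ => ?_
  rw [mul_assoc (PowerSeries.C _), PowerSeries.coeff_C_mul, PowerSeries.coeff_X_pow_mul']
  split_ifs <;> simp [dCoeff]

variable {T : ℕ}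

theorem bCoeff_eq_zero {n μ N : ℕ} (a : ℕ → Fin T → ℂ) {k : ℕ} (hk : N < k) (p : Fin T) :
    bCoeff n μ N a k p = 0 := by
  unfold bCoeff
  rw [Finset.Icc_eq_empty (by omega), Finset.sum_empty]

theorem sum_alternating_choose_bCoeff {n μ N : ℕ} (hμ : 0 < μ) (a : ℕ → Fin T → ℂ) {m : ℕ}
    (hm : m ≤ N) (p : Fin T) :
    ∑ l ∈ Finset.range (n + 1),
      (-1 : ℂ) ^ l * (n.choose l : ℂ) * bCoeff n μ N a (m + l * μ) p = a m p := by
  have h : ∀ l ∈ Finset.range (n + 1),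
      (-1 : ℂ) ^ l * (n.choose l : ℂ) * bCoeff n μ N a (m + l * μ) p =
      ∑ r ∈ Finset.Icc m N, a r p * (if l * μ ≤ r - m then
        (-1 : ℂ) ^ l * (n.choose l : ℂ) * dCoeff n μ (r - m - l * μ) else 0) := by
    intro l _
    unfold bCoeff
    -- The summation range of `b(m + lμ)` is enlarged to one independent of `l`, with the new terms
    -- zero, so that the sums can be exchanged.
    rw [Finset.mul_sum, ← Finset.sum_subset (Finset.Icc_subset_Icc_left (Nat.le_add_right m (l * μ)))]
    · refine Finset.sum_congr rfl fun r hr => ?_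
      rw [Finset.mem_Icc] at hr
      rw [if_pos (by omega), Nat.sub_sub]
      ring
    · intro r hr hr'
      rw [Finset.mem_Icc] at hr hr'
      rw [if_neg (by omega), mul_zero]
  rw [Finset.sum_congr rfl h, Finset.sum_comm]
  simp_rw [← Finset.mul_sum, sum_alternating_choose_dCoeff hμ]
  rw [Finset.sum_eq_single m]
  · simp
  · intro r hr hne
    rw [Finset.mem_Icc] at hr
    rw [if_neg (by omega), mul_zero]
  · intro h'
    exact absurd (Finset.mem_Icc.2 ⟨le_rfl, hm⟩) h'

/-- The upper limit may be dropped because `b` vanishes beyond `N`; the lower one must stay, since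
`l * μ - j` truncates at `0`. -/
theorem vCoeff_eq {n μ N : ℕ} (hμ : 0 < μ) (a : ℕ → Fin T → ℂ) (j : ℕ) (p : Fin T) :
    vCoeff n μ N a j p = ∑ l ∈ Finset.range (n + 1), if j ≤ l * μ then
      (-1 : ℂ) ^ l * (n.choose l : ℂ) * bCoeff n μ N a (l * μ - j) p else 0 := by
  unfold vCoeff
  rw [← Finset.sum_filter]
  have hμ' : (0 : ℚ) < μ := by exact_mod_cast hμ
  have hl : ∀ l : ℕ, ⌈(j : ℚ) / μ⌉₊ ≤ l ↔ j ≤ l * μ := by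
    intro l
    rw [Nat.ceil_le, div_le_iff₀ hμ']
    exact_mod_cast Iff.rfl
  refine Finset.sum_subset_zero_on_sdiff ?_ ?_ fun _ _ => rfl
  · intro l h
    rw [Finset.mem_Icc, hl, le_min_iff] at h
    rw [Finset.mem_filter, Finset.mem_range]
    exact ⟨by omega, h.1⟩
  · intro l h
    rw [Finset.mem_sdiff, Finset.mem_filter, Finset.mem_range, Finset.mem_Icc, hl, le_min_iff,
      Nat.le_div_iff_mul_le hμ] at h
    rw [bCoeff_eq_zero a (by omega), mul_zero]

theorem aMuCoeff_eq {n μ N : ℕ} (hμ : 0 < μ) (a : ℕ → Fin T → ℂ) (m : ℕ) (p : Fin T) :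
    aMuCoeff n μ N a m p = ∑ l ∈ Finset.range (n + 1), ∑ k ∈ Finset.range (N + 1),
      if m = k + μ * l then (-1 : ℂ) ^ l * (n.choose l : ℂ) * a k p else 0 := by
  unfold aMuCoeff
  have hμ' : (0 : ℚ) < μ := by exact_mod_cast hμ
  have hl : ∀ l : ℕ, ⌈((m - N : ℕ) : ℚ) / μ⌉₊ ≤ l ↔ m - N ≤ l * μ := by
    intro l
    rw [Nat.ceil_le, div_le_iff₀ hμ']
    exact_mod_cast Iff.rfl
  have hcomm : ∀ l : ℕ, μ * l = l * μ := fun l => mul_comm _ _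
  refine Finset.sum_subset_zero_on_sdiff ?_ ?_ ?_
  · intro l h
    rw [Finset.mem_Icc, le_min_iff] at h
    rw [Finset.mem_range]
    omega
  · intro l h
    rw [Finset.mem_sdiff, Finset.mem_range, Finset.mem_Icc, hl, le_min_iff,
      Nat.le_div_iff_mul_le hμ] at h
    refine Finset.sum_eq_zero fun k hk => ?_
    rw [Finset.mem_range] at hk
    rw [hcomm, if_neg (by omega)]
  · intro l h
    rw [Finset.mem_Icc, hl, le_min_iff, Nat.le_div_iff_mul_le hμ] at h
    rw [Finset.sum_eq_single (m - μ * l)]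
    · rw [hcomm, if_pos (by omega)]
    · intro k _ hk
      rw [if_neg (by omega)]
    · intro hk
      rw [Finset.mem_range, hcomm] at hk
      omega

/-- The point `k - lμ` lies in `[-μn, N]`. Writing the value as indicator sums over the two signs
makes the later exchange of summations mechanical. -/
theorem increment_eq_sum_add_sum {n μ N : ℕ} (x : ℤ → ℂ) {k l : ℕ} (hk : k ≤ N) (hl : l ≤ n) :
    x ((k : ℤ) - l * μ) = (∑ m ∈ Finset.range (N + 1), if k = m + l * μ then x m else 0) +
      ∑ j ∈ Finset.Icc 1 (μ * n), if k + j = l * μ then x (-(j : ℤ)) else 0 := by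
  have hln : l * μ ≤ μ * n := by rw [mul_comm]; exact Nat.mul_le_mul_left _ hl
  by_cases h : l * μ ≤ k
  · rw [Finset.sum_eq_single (k - l * μ), if_pos (by omega), Finset.sum_eq_zero, add_zero]
    · congr 1
      push_cast [h]
      ring
    · intro j hj
      rw [Finset.mem_Icc] at hj
      rw [if_neg (by omega)]
    · intro m _ hm
      rw [if_neg (by omega)]
    · intro hm
      rw [Finset.mem_range] at hm
      omega
  · rw [Finset.sum_eq_zero, zero_add, Finset.sum_eq_single (l * μ - k), if_pos (by omega)]
    · congr 1
      push_cast [(not_le.1 h).le]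
      ring
    · intro j _ hm
      rw [if_neg (by omega)]
    · intro hm
      rw [Finset.mem_Icc] at hm
      omega
    · intro m _
      rw [if_neg (by omega)]

/-- Summation by parts. Collecting the coefficient of `x(m)` gives the alternating sum of `b(m +
lμ)`, which is `a(m)` for `0 ≤ m ≤ N`; at `m = -j` the same sum, over the `l` with `lμ ≥ j`, is
`v(-j)`. -/
theorem sum_bCoeff_mul_increment {n μ N : ℕ} (hμ : 0 < μ) (a : ℕ → Fin T → ℂ) (p : Fin T)
    (x : ℤ → ℂ) :
    ∑ k ∈ Finset.range (N + 1), bCoeff n μ N a k p *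
        ∑ l ∈ Finset.range (n + 1), (-1 : ℂ) ^ l * (n.choose l : ℂ) * x ((k : ℤ) - l * μ) =
      ∑ m ∈ Finset.range (N + 1), a m p * x m +
        ∑ j ∈ Finset.Icc 1 (μ * n), vCoeff n μ N a j p * x (-(j : ℤ)) := by
  have h1 : ∀ k ∈ Finset.range (N + 1), bCoeff n μ N a k p *
        ∑ l ∈ Finset.range (n + 1), (-1 : ℂ) ^ l * (n.choose l : ℂ) * x ((k : ℤ) - l * μ) =
      (∑ m ∈ Finset.range (N + 1), ∑ l ∈ Finset.range (n + 1), if k = m + l * μ then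
        (-1 : ℂ) ^ l * (n.choose l : ℂ) * bCoeff n μ N a k p * x m else 0) +
      ∑ j ∈ Finset.Icc 1 (μ * n), ∑ l ∈ Finset.range (n + 1), if k + j = l * μ then
        (-1 : ℂ) ^ l * (n.choose l : ℂ) * bCoeff n μ N a k p * x (-(j : ℤ)) else 0 := by
    intro k hk
    rw [Finset.sum_comm, Finset.sum_comm (s := Finset.Icc 1 (μ * n)), ← Finset.sum_add_distrib,
      Finset.mul_sum]
    refine Finset.sum_congr rfl fun l hl => ?_
    rw [increment_eq_sum_add_sum (n := n) (N := N) x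
      (Nat.lt_succ_iff.1 (Finset.mem_range.1 hk)) (Nat.lt_succ_iff.1 (Finset.mem_range.1 hl)),
      mul_add, mul_add, Finset.mul_sum, Finset.mul_sum, Finset.mul_sum, Finset.mul_sum]
    congr 1
    all_goals
      refine Finset.sum_congr rfl fun m _ => ?_
      split_ifs
      · ring
      · ring
  rw [Finset.sum_congr rfl h1, Finset.sum_add_distrib]
  congr 1
  · rw [Finset.sum_comm]
    refine Finset.sum_congr rfl fun m hm => ?_
    rw [Finset.sum_comm, ← sum_alternating_choose_bCoeff hμ a
      (Nat.lt_succ_iff.1 (Finset.mem_range.1 hm)) p, Finset.sum_mul]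
    refine Finset.sum_congr rfl fun l _ => ?_
    rw [Finset.sum_ite_eq' (Finset.range (N + 1)) (m + l * μ) fun k =>
      (-1 : ℂ) ^ l * (n.choose l : ℂ) * bCoeff n μ N a k p * x m]
    split_ifs with h
    · rfl
    · rw [Finset.mem_range] at h
      rw [bCoeff_eq_zero a (by omega)]
      ring
  · rw [Finset.sum_comm]
    refine Finset.sum_congr rfl fun j _ => ?_
    rw [Finset.sum_comm, vCoeff_eq hμ, Finset.sum_mul]
    refine Finset.sum_congr rfl fun l _ => ?_
    by_cases h : j ≤ l * μ
    · rw [if_pos h]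
      have hiff : ∀ k : ℕ, k + j = l * μ ↔ k = l * μ - j := fun k => by omega
      simp_rw [hiff]
      rw [Finset.sum_ite_eq' (Finset.range (N + 1)) (l * μ - j) fun k =>
        (-1 : ℂ) ^ l * (n.choose l : ℂ) * bCoeff n μ N a k p * x (-(j : ℤ))]
      split_ifs with h'
      · rfl
      · rw [Finset.mem_range] at h'
        rw [bCoeff_eq_zero a (by omega)]
        ring
    · rw [if_neg h, zero_mul]
      refine Finset.sum_eq_zero fun k _ => ?_
      rw [if_neg (by omega)]

/-- The functional of a vector sequence and its initial values add up to a functional of the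
increments. -/
theorem sum_add_initialValues {Ω : Type*} {n μ N : ℕ} (hμ : 0 < μ) (a : ℕ → Fin T → ℂ)
    (Z : ℤ → Fin T → Ω → ℂ) (ω : Ω) :
    (∑ m ∈ Finset.range (N + 1), ∑ p, a m p * Z m p ω) + initialValues n μ N a Z ω =
      ∑ k ∈ Finset.range (N + 1), ∑ p, bCoeff n μ N a k p * vecIncrement n μ Z k p ω := by
  unfold initialValues vecIncrement increment
  rw [Finset.sum_comm, Finset.sum_comm (s := Finset.Icc 1 (μ * n)), ← Finset.sum_add_distrib,
    Finset.sum_comm (s := Finset.range (N + 1))]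
  refine Finset.sum_congr rfl fun p _ => ?_
  exact (sum_bCoeff_mul_increment hμ a p fun m => Z m p ω).symm

theorem sum_range_mul_add {R : Type*} [AddCommMonoid R] (F : ℕ → R) (K T : ℕ) :
    ∑ m ∈ Finset.range K, ∑ p : Fin T, F (m * T + p) = ∑ q ∈ Finset.range (K * T), F q := by
  induction K with
  | zero => simp
  | succ K ih =>
    rw [Finset.sum_range_succ, ih, Nat.succ_mul, Finset.sum_range_add, Finset.sum_range (n := T)]

theorem scalarFunctional_eq {Ω : Type*} (hT : 0 < T) (M : ℕ) (α : ℕ → ℂ) (x : ℤ → Ω → ℂ) (ω : Ω) :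
    scalarFunctional M α x ω =
      ∑ m ∈ Finset.range (M / T + 1), ∑ p, blockCoeff T M α m p * block T x m p ω := by
  have h := sum_range_mul_add (fun q => (if q ≤ M then α q else 0) * x q ω) (M / T + 1) T
  -- The last block may stick out beyond `M`; there the coefficients are padded with zeros.
  have hM : M + 1 ≤ (M / T + 1) * T := by
    have h2 := Nat.div_add_mod M T
    have h3 := Nat.mod_lt M hT
    nlinarith
  unfold scalarFunctional block blockCoeff
  calc ∑ k ∈ Finset.range (M + 1), α k * x k ω
      = ∑ q ∈ Finset.range ((M / T + 1) * T), (if q ≤ M then α q else 0) * x q ω := by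
        refine Finset.sum_subset_zero_on_sdiff (Finset.range_mono hM) ?_ ?_
        · intro q hq
          rw [Finset.mem_sdiff, Finset.mem_range, Finset.mem_range] at hq
          rw [if_neg (by omega), zero_mul]
        · intro q hq
          rw [Finset.mem_range] at hq
          rw [if_pos (by omega)]
    _ = _ := by
        rw [← h]
        refine Finset.sum_congr rfl fun m _ => Finset.sum_congr rfl fun p _ => ?_
        push_cast
        rfl

/-! ### Trigonometric polynomials -/

theorem trigPoly_stack (L : ℕ) (c : ℕ → Fin T → ℂ) (x : ℝ) (p : Fin T) :
    trigPoly (stack L c) x p = ∑ k ∈ Finset.range (L + 1), c k p * character k x := by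
  unfold trigPoly stack
  rw [Finset.sum_range]

theorem one_sub_character_pow (n : ℕ) (s : ℤ) (x : ℝ) :
    (1 - character s x) ^ n =
      ∑ l ∈ Finset.range (n + 1), (-1 : ℂ) ^ l * (n.choose l : ℂ) * character (l * s) x := by
  rw [sub_eq_neg_add, add_pow]
  refine Finset.sum_congr rfl fun l _ => ?_
  rw [one_pow, mul_one, neg_pow, character_pow]
  ring

/-- The binomial expansion of the factor convolves the coefficients of `A`. The product has degree
at most `N + μn`, which is why all block systems have `K + 1` blocks. -/
theorem trigPoly_aMuCoeff {n μ N : ℕ} (hμ : 0 < μ) (a : ℕ → Fin T → ℂ) (x : ℝ) :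
    trigPoly (stack (N + μ * n) (aMuCoeff n μ N a)) x =
      (1 - character μ x) ^ n • trigPoly (stack N a) x := by
  ext p
  rw [Pi.smul_apply, smul_eq_mul, trigPoly_stack, trigPoly_stack, one_sub_character_pow,
    Finset.sum_mul_sum]
  simp_rw [aMuCoeff_eq hμ, Finset.sum_mul]
  rw [Finset.sum_comm]
  refine Finset.sum_congr rfl fun l hl => ?_
  rw [Finset.sum_comm]
  refine Finset.sum_congr rfl fun k hk => ?_
  rw [Finset.mem_range] at hl hk
  have hln : μ * l ≤ μ * n := Nat.mul_le_mul_left _ (by omega)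
  rw [Finset.sum_eq_single (k + μ * l)]
  · rw [if_pos rfl]
    push_cast
    rw [character_add, mul_comm (μ : ℤ) (l : ℤ)]
    ring
  · intro m _ hm
    rw [if_neg hm, zero_mul]
  · intro h
    rw [Finset.mem_range] at h
    omega

end PerStat

namespace PerStat

/-! ### Rows of square-integrable functions -/

section RowModel

variable {ι : Type*} [Fintype ι]

/-- The row function `w(λ) R(λ)`, with values in the Euclidean space. -/
noncomputable def rowModel (R : ℝ → Matrix ι ι ℂ) (w : ℝ → ι → ℂ) (x : ℝ) : EuclideanSpace ℂ ι :=
  WithLp.toLp 2 (w x ᵥ* R x)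

/-- The factor `R` turns the form of `S` into the Euclidean inner product. The arguments are swapped
because the inner product is conjugate-linear in the first one. -/
theorem inner_rowModel {R S : ℝ → Matrix ι ι ℂ} {x : ℝ} (h : R x * (R x)ᴴ = S x)
    (v w : ℝ → ι → ℂ) :
    inner ℂ (rowModel R v x) (rowModel R w x) = (w x ᵥ* S x) ⬝ᵥ star (v x) := by
  rw [EuclideanSpace.inner_eq_star_dotProduct]
  simp only [rowModel]
  rw [Matrix.star_vecMul, Matrix.dotProduct_mulVec, Matrix.vecMul_vecMul, h]

theorem norm_sq_rowModel {R S : ℝ → Matrix ι ι ℂ} {x : ℝ} (h : R x * (R x)ᴴ = S x)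
    (w : ℝ → ι → ℂ) :
    ((‖rowModel R w x‖ ^ 2 : ℝ) : ℂ) = (w x ᵥ* S x) ⬝ᵥ star (w x) := by
  rw [← inner_rowModel h, inner_self_eq_norm_sq_to_K]
  push_cast
  rfl

theorem rowModel_add (R : ℝ → Matrix ι ι ℂ) (v w : ℝ → ι → ℂ) :
    rowModel R (v + w) = rowModel R v + rowModel R w := by
  ext x : 1
  simp [rowModel, Matrix.add_vecMul]

theorem rowModel_const_smul (R : ℝ → Matrix ι ι ℂ) (z : ℂ) (w : ℝ → ι → ℂ) :
    rowModel R (z • w) = z • rowModel R w := by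
  ext x : 1
  simp [rowModel, Matrix.smul_vecMul]

theorem aestronglyMeasurable_rowModel {R : ℝ → Matrix ι ι ℂ} {w : ℝ → ι → ℂ}
    (hR : ∀ i j, AEMeasurable (fun x => R x i j) freq)
    (hw : ∀ i, AEMeasurable (fun x => w x i) freq) :
    AEStronglyMeasurable (rowModel R w) freq := by
  have h : AEMeasurable (fun x => w x ᵥ* R x) freq := by
    refine aemeasurable_pi_lambda _ fun j => ?_
    simp only [Matrix.vecMul, dotProduct]
    exact Finset.aemeasurable_fun_sum _ fun i _ => (hw i).mul (hR i j)
  exact (PiLp.continuous_toLp 2 (fun _ : ι => ℂ)).comp_aestronglyMeasurable h.aestronglyMeasurable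

theorem memLp_rowModel {R S : ℝ → Matrix ι ι ℂ} {w : ℝ → ι → ℂ}
    (hR : ∀ i j, AEMeasurable (fun x => R x i j) freq)
    (hRS : ∀ᵐ x ∂freq, R x * (R x)ᴴ = S x)
    (hw : ∀ i, AEMeasurable (fun x => w x i) freq)
    (h : Integrable (fun x => (w x ᵥ* S x) ⬝ᵥ star (w x)) freq) :
    MemLp (rowModel R w) 2 freq := by
  rw [memLp_two_iff_integrable_sq_norm (aestronglyMeasurable_rowModel hR hw)]
  refine h.re.congr ?_
  filter_upwards [hRS] with x hx
  rw [← norm_sq_rowModel hx]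
  exact RCLike.ofReal_re (K := ℂ) _

theorem inner_toLp_rowModel {R S : ℝ → Matrix ι ι ℂ} {v w : ℝ → ι → ℂ}
    (hRS : ∀ᵐ x ∂freq, R x * (R x)ᴴ = S x)
    (hv : MemLp (rowModel R v) 2 freq) (hw : MemLp (rowModel R w) 2 freq) :
    inner ℂ (hv.toLp _) (hw.toLp _) = ∫ x, (w x ᵥ* S x) ⬝ᵥ star (v x) ∂freq := by
  rw [L2.inner_def]
  refine integral_congr_ae ?_
  filter_upwards [hRS, hv.coeFn_toLp, hw.coeFn_toLp] with x hx h1 h2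
  rw [h1, h2, inner_rowModel hx]

end RowModel

/-! ### Corresponding random variables and row functions -/

section Corr

variable {Ω : Type*} [MeasurableSpace Ω] {P : Measure Ω} {ι : Type*} [Fintype ι]

/-- The pair of a random variable and of a row function belongs to the graph `G`. -/
def Corr (R : ℝ → Matrix ι ι ℂ)
    (G : Submodule ℂ (Lp ℂ 2 P × Lp (EuclideanSpace ℂ ι) 2 freq)) (u : Ω → ℂ) (w : ℝ → ι → ℂ) :
    Prop :=
  ∃ (hu : MemLp u 2 P) (hw : MemLp (rowModel R w) 2 freq), (hu.toLp u, hw.toLp _) ∈ G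

variable {R : ℝ → Matrix ι ι ℂ} {G : Submodule ℂ (Lp ℂ 2 P × Lp (EuclideanSpace ℂ ι) 2 freq)}

theorem Corr.congr {u u' : Ω → ℂ} {w w' : ℝ → ι → ℂ} (h : Corr R G u w) (hu : u =ᵐ[P] u')
    (hw : w =ᵐ[freq] w') : Corr R G u' w' := by
  obtain ⟨h1, h2, h3⟩ := h
  have hw' : rowModel R w =ᵐ[freq] rowModel R w' := by
    filter_upwards [hw] with x hx
    simp [rowModel, hx]
  refine ⟨h1.ae_eq hu, h2.ae_eq hw', ?_⟩
  convert h3 using 2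
  · exact MemLp.toLp_congr _ _ hu.symm
  · exact MemLp.toLp_congr _ _ hw'.symm

theorem Corr.add {u u' : Ω → ℂ} {w w' : ℝ → ι → ℂ} (h : Corr R G u w) (h' : Corr R G u' w') :
    Corr R G (u + u') (w + w') := by
  obtain ⟨h1, h2, h3⟩ := h
  obtain ⟨h1', h2', h3'⟩ := h'
  have hm : MemLp (rowModel R (w + w')) 2 freq := by
    rw [rowModel_add]; exact h2.add h2'
  refine ⟨h1.add h1', hm, ?_⟩
  convert G.add_mem h3 h3' using 1
  refine Prod.ext (MemLp.toLp_add h1 h1') ?_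
  exact (MemLp.toLp_congr hm (h2.add h2') (by rw [rowModel_add])).trans (MemLp.toLp_add h2 h2')

theorem Corr.const_smul {u : Ω → ℂ} {w : ℝ → ι → ℂ} (h : Corr R G u w) (z : ℂ) :
    Corr R G (z • u) (z • w) := by
  obtain ⟨h1, h2, h3⟩ := h
  have hm : MemLp (rowModel R (z • w)) 2 freq := by
    rw [rowModel_const_smul]; exact h2.const_smul z
  refine ⟨h1.const_smul z, hm, ?_⟩
  convert G.smul_mem z h3 using 1
  refine Prod.ext (MemLp.toLp_const_smul z h1) ?_
  exact (MemLp.toLp_congr hm (h2.const_smul z) (by rw [rowModel_const_smul])).trans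
    (MemLp.toLp_const_smul z h2)

theorem Corr.zero : Corr R G (0 : Ω → ℂ) (0 : ℝ → ι → ℂ) := by
  have h0 : rowModel R (0 : ℝ → ι → ℂ) = 0 := by
    ext x : 1
    simp [rowModel]
  have hm : MemLp (rowModel R (0 : ℝ → ι → ℂ)) 2 freq := by
    rw [h0]; exact MemLp.zero
  have hz : MemLp (0 : Ω → ℂ) 2 P := MemLp.zero
  have e1 : hz.toLp (0 : Ω → ℂ) = 0 := by
    rw [Lp.eq_zero_iff_ae_eq_zero]
    exact hz.coeFn_toLp
  have e2 : hm.toLp (rowModel R (0 : ℝ → ι → ℂ)) = 0 := by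
    rw [Lp.eq_zero_iff_ae_eq_zero]
    exact hm.coeFn_toLp.trans (by rw [h0])
  refine ⟨hz, hm, ?_⟩
  rw [e1, e2]
  exact G.zero_mem

theorem Corr.neg {u : Ω → ℂ} {w : ℝ → ι → ℂ} (h : Corr R G u w) : Corr R G (-u) (-w) := by
  simpa using h.const_smul (-1)

theorem Corr.sub {u u' : Ω → ℂ} {w w' : ℝ → ι → ℂ} (h : Corr R G u w) (h' : Corr R G u' w') :
    Corr R G (u - u') (w - w') := by
  simpa [sub_eq_add_neg] using h.add h'.neg

theorem Corr.sum {κ : Type*} (s : Finset κ) {u : κ → Ω → ℂ} {w : κ → ℝ → ι → ℂ}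
    (h : ∀ k ∈ s, Corr R G (u k) (w k)) : Corr R G (∑ k ∈ s, u k) (∑ k ∈ s, w k) := by
  classical
  induction s using Finset.induction_on with
  | empty => simpa using Corr.zero
  | insert k s hk ih =>
    rw [Finset.sum_insert hk, Finset.sum_insert hk]
    exact (h k (Finset.mem_insert_self k s)).add
      (ih fun j hj => h j (Finset.mem_insert_of_mem hj))

theorem inner_toLp_eq {u v : Ω → ℂ} (hu : MemLp u 2 P) (hv : MemLp v 2 P) :
    inner ℂ (hu.toLp u) (hv.toLp v) = ∫ ω, v ω * star (u ω) ∂P := by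
  rw [L2.inner_def]
  refine integral_congr_ae ?_
  filter_upwards [hu.coeFn_toLp, hv.coeFn_toLp] with ω h1 h2
  rw [h1, h2]
  simp

end Corr

/-! ### The isometry between the spectral domain and the time domain -/

section Isometry

variable {T : ℕ}

/-- The joint spectral density of two uncorrelated sequences. -/
def jointDensity (f g : ℝ → Matrix (Fin T) (Fin T) ℂ) (x : ℝ) :
    Matrix (Fin T ⊕ Fin T) (Fin T ⊕ Fin T) ℂ :=
  Matrix.fromBlocks (f x) 0 0 (g x)

theorem jointDensity_form (f g : ℝ → Matrix (Fin T) (Fin T) ℂ) (x : ℝ) (h k h' k' : Fin T → ℂ) :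
    (Sum.elim h k ᵥ* jointDensity f g x) ⬝ᵥ star (Sum.elim h' k') =
      (h ᵥ* f x) ⬝ᵥ star h' + (k ᵥ* g x) ⬝ᵥ star k' := by
  have : star (Sum.elim h' k') = Sum.elim (star h') (star k') := by
    ext i; cases i <;> rfl
  rw [jointDensity, Matrix.vecMul_fromBlocks, this, sumElim_dotProduct_sumElim]
  simp

theorem posSemidef_jointDensity {f g : ℝ → Matrix (Fin T) (Fin T) ℂ} {x : ℝ}
    (hf : (f x).PosSemidef) (hg : (g x).PosSemidef) : (jointDensity f g x).PosSemidef := by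
  rw [Matrix.posSemidef_iff_dotProduct_mulVec]
  refine ⟨Matrix.IsHermitian.fromBlocks hf.1 (by simp) hg.1, fun v => ?_⟩
  have hv : v = Sum.elim (v ∘ Sum.inl) (v ∘ Sum.inr) := (Sum.elim_comp_inl_inr v).symm
  have hs : star v = Sum.elim (star (v ∘ Sum.inl)) (star (v ∘ Sum.inr)) := by
    ext i; cases i <;> rfl
  rw [hs]
  conv_rhs => rw [hv]
  rw [jointDensity, Matrix.fromBlocks_mulVec, sumElim_dotProduct_sumElim]
  have h1 := (Matrix.posSemidef_iff_dotProduct_mulVec.1 hf).2 (v ∘ Sum.inl)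
  have h2 := (Matrix.posSemidef_iff_dotProduct_mulVec.1 hg).2 (v ∘ Sum.inr)
  simpa using add_nonneg h1 h2

theorem single_vecMul_dotProduct (A : Matrix (Fin T) (Fin T) ℂ) (p q : Fin T) (a b : ℂ) :
    (Pi.single p a ᵥ* A) ⬝ᵥ star (Pi.single q b) = a * A p q * star b := by
  have : star (Pi.single q b : Fin T → ℂ) = Pi.single q (star b) := by
    ext i
    rcases eq_or_ne i q with rfl | h
    · simp
    · simp [h]
  rw [this, dotProduct_single, Matrix.single_vecMul]
  simp

theorem norm_one_sub_character_le (s : ℤ) (x : ℝ) : ‖1 - character s x‖ ≤ |(s : ℝ)| * |x| := by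
  rw [norm_sub_rev, character_eq_exp, mul_comm ((s * x : ℝ) : ℂ) Complex.I, ← abs_mul]
  exact Real.norm_exp_I_mul_ofReal_sub_one_le

/-- The zero of order `n` of the numerator compensates the pole at `λ = 0`. Boundedness puts the
increment rows in `L₂` with `f` merely integrable. -/
theorem norm_incFactor_le (n : ℕ) (s : ℤ) (x : ℝ) : ‖incFactor n s x‖ ≤ |(s : ℝ)| ^ n := by
  unfold incFactor
  rw [← div_pow, norm_pow, norm_div]
  refine pow_le_pow_left₀ (by positivity) ?_ n
  have h := norm_one_sub_character_le (-s) x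
  have hx : ‖Complex.I * (x : ℂ)‖ = |x| := by simp
  rw [hx]
  push_cast at h
  rw [abs_neg] at h
  exact div_le_of_le_mul₀ (abs_nonneg _) (abs_nonneg _) h

theorem measurable_incFactor (n : ℕ) (s : ℤ) : Measurable (incFactor n s) := by
  unfold incFactor
  exact ((continuous_const.sub (continuous_character _)).pow n).measurable.div (by fun_prop)

theorem incFactor_mul_star (n : ℕ) (s₁ s₂ : ℤ) (x : ℝ) :
    incFactor n s₁ x * star (incFactor n s₂ x) =
      (1 - character (-s₁) x) ^ n * (1 - character s₂ x) ^ n / (x : ℂ) ^ (2 * n) := by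
  unfold incFactor
  simp only [star_div₀, star_pow, star_sub, star_one, star_character, neg_neg, star_mul']
  have : star Complex.I * star (x : ℂ) = -(Complex.I * x) := by simp
  rw [this, div_mul_div_comm, ← mul_pow (Complex.I * (x : ℂ))]
  congr 1
  rw [pow_mul]
  congr 1
  linear_combination (-(x : ℂ) ^ 2) * Complex.I_sq

end Isometry

end PerStat

namespace PerStat

section Isometry

variable {T : ℕ}

/-- The row function that corresponds to the stochastic integral of `h` with respect to the
observed increments. -/
noncomputable def obsRow (n : ℕ) (h : ℝ → Fin T → ℂ) (x : ℝ) : Fin T ⊕ Fin T → ℂ :=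
  Sum.elim (h x) ((Complex.I * (x : ℂ)) ^ n • h x)

/-- The row function of the observed increment with step `s`. -/
noncomputable def incRow (n : ℕ) (i : ℤ × ℤ × Fin T) (x : ℝ) : Fin T → ℂ :=
  Pi.single i.2.2 (character i.1 x * incFactor n i.2.1 x)

/-- A closed isometric correspondence between random variables and row functions, which contains
the spectral representations of the increments of `ζ` and of the stationary sequence `η`. -/
structure IsSpectralIsometry {Ω : Type*} [MeasurableSpace Ω] {P : Measure Ω} (n : ℕ)
    (ζ η : ℤ → Fin T → Ω → ℂ) (f g : ℝ → Matrix (Fin T) (Fin T) ℂ)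
    (R : ℝ → Matrix (Fin T ⊕ Fin T) (Fin T ⊕ Fin T) ℂ)
    (G : Submodule ℂ (Lp ℂ 2 P × Lp (EuclideanSpace ℂ (Fin T ⊕ Fin T)) 2 freq)) : Prop where
  aemeasurable : ∀ i j, AEMeasurable (fun x => R x i j) freq
  mul_conjTranspose : ∀ᵐ x ∂freq, R x * (R x)ᴴ = jointDensity f g x
  isClosed : IsClosed (G : Set (Lp ℂ 2 P × Lp (EuclideanSpace ℂ (Fin T ⊕ Fin T)) 2 freq))
  inner_eq : ∀ a ∈ G, ∀ b ∈ G, inner ℂ a.1 b.1 = inner ℂ a.2 b.2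
  corr_increment : ∀ i : ℤ × ℤ × Fin T,
    Corr R G (vecIncrement n i.2.1 ζ i.1 i.2.2) (obsRow n (incRow n i))
  corr_stationary : ∀ m p, Corr R G (η m p) fun x => Sum.elim 0 (Pi.single p (character m x))

variable {Ω : Type*} [MeasurableSpace Ω] {P : Measure Ω}

theorem integrable_inc_mul {n : ℕ} (i j : ℤ × ℤ × Fin T) {F : ℝ → ℂ} (hF : Integrable F freq) :
    Integrable (fun x => character i.1 x * incFactor n i.2.1 x * F x *
      star (character j.1 x * incFactor n j.2.1 x)) freq := by
  have hm : ∀ i : ℤ × ℤ × Fin T, Measurable fun x => character i.1 x * incFactor n i.2.1 x :=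
    fun i => (continuous_character _).measurable.mul (measurable_incFactor _ _)
  have hb : ∀ (i : ℤ × ℤ × Fin T) (x : ℝ),
      ‖character i.1 x * incFactor n i.2.1 x‖ ≤ |(i.2.1 : ℝ)| ^ n := fun i x => by
    rw [norm_mul, norm_character, one_mul]
    exact norm_incFactor_le _ _ _
  have h1 : Integrable (fun x => character i.1 x * incFactor n i.2.1 x * F x) freq :=
    hF.bdd_mul (c := |(i.2.1 : ℝ)| ^ n) (hm i).aestronglyMeasurable
      (Filter.Eventually.of_forall fun x => hb i x)
  refine h1.mul_bdd (c := |(j.2.1 : ℝ)| ^ n) ?_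
      (Filter.Eventually.of_forall fun x => ?_)
  · exact (continuous_star.measurable.comp (hm j)).aestronglyMeasurable
  · rw [norm_star]
    exact hb j x

theorem aemeasurable_single {p : Fin T} {F : ℝ → ℂ} (hF : AEMeasurable F freq) (q : Fin T) :
    AEMeasurable (fun x => (Pi.single p (F x) : Fin T → ℂ) q) freq := by
  rcases eq_or_ne q p with rfl | h
  · simpa using hF
  · simp [h]

theorem aemeasurable_sumElim {h k : ℝ → Fin T → ℂ} (hh : ∀ p, AEMeasurable (fun x => h x p) freq)
    (hk : ∀ p, AEMeasurable (fun x => k x p) freq) (i : Fin T ⊕ Fin T) :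
    AEMeasurable (fun x => Sum.elim (h x) (k x) i) freq := by
  cases i with
  | inl p => exact hh p
  | inr p => exact hk p

/-- The covariance formulas for `ξ` and `η`, with zero cross covariance, say that the random
variables and their rows have the same Gram matrix; `G` is the closed graph of this correspondence.
The increments of `ζ` are then combinations of generators. -/
theorem exists_isSpectralIsometry {n : ℕ} {θ η : ℤ → Ω → ℂ}
    {f g : ℝ → Matrix (Fin T) (Fin T) ℂ}
    (hf : HasIncrementSpectralDensity P n (block T θ) f)
    (hg : HasSpectralDensity P (block T η) g)
    (hunc : Uncorrelated P n (block T θ) (block T η)) :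
    ∃ R, ∃ G : Submodule ℂ (Lp ℂ 2 P × Lp (EuclideanSpace ℂ (Fin T ⊕ Fin T)) 2 freq),
      IsSpectralIsometry n (block T fun m => θ m + η m) (block T η) f g R G := by
  have hSm : ∀ i j, AEMeasurable (fun x => jointDensity f g x i j) freq := by
    rintro (i | i) (j | j)
    · exact (hf.isDensity.integrable i j).aemeasurable
    · exact aemeasurable_const
    · exact aemeasurable_const
    · exact (hg.isDensity.integrable i j).aemeasurable
  obtain ⟨R, hR, hRS⟩ := exists_aemeasurable_mul_conjTranspose hSm (by
    filter_upwards [hf.isDensity.posSemidef, hg.isDensity.posSemidef] with x h1 h2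
    exact posSemidef_jointDensity h1 h2)
  let wξ : ℤ × ℤ × Fin T → ℝ → Fin T ⊕ Fin T → ℂ := fun i x => Sum.elim (incRow n i x) 0
  let wη : ℤ × Fin T → ℝ → Fin T ⊕ Fin T → ℂ := fun i x =>
    Sum.elim 0 (Pi.single i.2 (character i.1 x))
  have hmξ : ∀ i, MemLp (rowModel R (wξ i)) 2 freq := by
    intro i
    refine memLp_rowModel hR hRS (aemeasurable_sumElim
      (aemeasurable_single (((continuous_character _).measurable.mul
        (measurable_incFactor _ _)).aemeasurable)) fun p => aemeasurable_const) ?_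
    simp only [wξ, jointDensity_form, incRow, single_vecMul_dotProduct, Matrix.zero_vecMul,
      zero_dotProduct, add_zero]
    exact integrable_inc_mul i i (hf.isDensity.integrable _ _)
  have hmη : ∀ i, MemLp (rowModel R (wη i)) 2 freq := by
    intro i
    refine memLp_rowModel hR hRS (aemeasurable_sumElim (fun p => aemeasurable_const)
      (aemeasurable_single (continuous_character _).measurable.aemeasurable)) ?_
    simp only [wη, jointDensity_form, single_vecMul_dotProduct, Matrix.zero_vecMul,
      zero_dotProduct, zero_add]
    refine (hg.isDensity.integrable i.2 i.2).congr (Filter.Eventually.of_forall fun x => ?_)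
    simp only
    rw [star_character, mul_comm (character i.1 x), mul_assoc, ← character_add, add_neg_cancel,
      character_zero, mul_one]
  let X : (ℤ × ℤ × Fin T) ⊕ (ℤ × Fin T) → Lp ℂ 2 P :=
    Sum.elim (fun i => (hf.memLp i.2.1 i.1 i.2.2).toLp _) (fun i => (hg.memLp i.1 i.2).toLp _)
  let Y : (ℤ × ℤ × Fin T) ⊕ (ℤ × Fin T) → Lp (EuclideanSpace ℂ (Fin T ⊕ Fin T)) 2 freq :=
    Sum.elim (fun i => (hmξ i).toLp _) (fun i => (hmη i).toLp _)
  have hgram : ∀ i j, inner ℂ (X i) (X j) = inner ℂ (Y i) (Y j) := by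
    rintro (i | i) (j | j)
    · simp only [X, Y, Sum.elim_inl]
      rw [inner_toLp_eq, inner_toLp_rowModel hRS, hf.cov]
      refine integral_congr_ae (Filter.Eventually.of_forall fun x => ?_)
      simp only [wξ, jointDensity_form, incRow, single_vecMul_dotProduct, Matrix.zero_vecMul,
        zero_dotProduct, add_zero]
      have h1 := incFactor_mul_star n j.2.1 i.2.1 x
      rw [star_mul', star_character, sub_eq_add_neg, character_add]
      linear_combination
        (-character j.1 x * character (-i.1) x * f x j.2.2 i.2.2) * h1
    · simp only [X, Y, Sum.elim_inl, Sum.elim_inr]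
      rw [inner_toLp_eq, inner_toLp_rowModel hRS]
      simp only [wξ, wη, jointDensity_form, Matrix.zero_vecMul, zero_dotProduct, zero_add, star_zero,
        dotProduct_zero, integral_zero]
      -- Uncorrelatedness is assumed in one order only; the other order is its conjugate.
      have h := congrArg star (hunc i.2.1 i.1 j.1 i.2.2 j.2)
      rw [Complex.star_def, ← integral_conj] at h
      simpa [mul_comm] using h
    · simp only [X, Y, Sum.elim_inl, Sum.elim_inr]
      rw [inner_toLp_eq, inner_toLp_rowModel hRS]
      simp only [wξ, wη, jointDensity_form, Matrix.zero_vecMul, zero_dotProduct, add_zero, star_zero,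
        dotProduct_zero, integral_zero]
      exact hunc j.2.1 j.1 i.1 j.2.2 i.2
    · simp only [X, Y, Sum.elim_inr]
      rw [inner_toLp_eq, inner_toLp_rowModel hRS, hg.cov]
      refine integral_congr_ae (Filter.Eventually.of_forall fun x => ?_)
      simp only [wη, jointDensity_form, single_vecMul_dotProduct, Matrix.zero_vecMul,
        zero_dotProduct, zero_add]
      rw [star_character, sub_eq_add_neg, character_add]
      ring
  have hcξ : ∀ i, Corr R (corrGraph X Y Set.univ) (vecIncrement n i.2.1 (block T θ) i.1 i.2.2)
      (wξ i) := fun i =>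
    ⟨hf.memLp i.2.1 i.1 i.2.2, hmξ i, mem_corrGraph X Y (Set.mem_univ (Sum.inl i))⟩
  have hcη : ∀ i, Corr R (corrGraph X Y Set.univ) (block T η i.1 i.2) (wη i) := fun i =>
    ⟨hg.memLp i.1 i.2, hmη i, mem_corrGraph X Y (Set.mem_univ (Sum.inr i))⟩
  refine ⟨R, corrGraph X Y Set.univ, hR, hRS, Submodule.isClosed_topologicalClosure _,
    fun a ha b hb => inner_fst_eq_inner_snd hgram ha hb, ?_, fun m p => hcη (m, p)⟩
  rintro ⟨m, s, p⟩
  have hsum := (hcξ (m, s, p)).add (Corr.sum (Finset.range (n + 1))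
    (u := fun l => ((-1 : ℂ) ^ l * (n.choose l : ℂ)) • block T η (m - l * s) p)
    fun l _ => (hcη (m - l * s, p)).const_smul ((-1 : ℂ) ^ l * (n.choose l : ℂ)))
  refine hsum.congr (Filter.Eventually.of_forall fun ω => ?_) ?_
  · simp [vecIncrement, increment, block, mul_add, Finset.sum_add_distrib]
  · filter_upwards [ae_ne_zero] with x hx
    have hIx : (Complex.I * (x : ℂ)) ^ n ≠ 0 :=
      pow_ne_zero _ (mul_ne_zero Complex.I_ne_zero (by exact_mod_cast hx))
    ext i
    cases i with
    | inl q => simp [wξ, wη, obsRow, incRow, Pi.single_apply]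
    | inr q =>
      rcases eq_or_ne q p with rfl | hq
      · simp only [wξ, wη, obsRow, incRow, Pi.add_apply, Sum.elim_inr, Pi.zero_apply,
          Finset.sum_apply, Pi.smul_apply, Pi.single_eq_same, smul_eq_mul, zero_add, incFactor]
        -- The increment of `η` has the row `e^{imλ} (1 - e^{-isλ})^n`, which is `(iλ)^n` times the
        -- row of the increment of `ξ`; this is where the second half of `obsRow` comes from.
        rw [one_sub_character_pow, mul_div_assoc', mul_div_cancel₀ _ hIx, Finset.mul_sum]
        refine Finset.sum_congr rfl fun l _ => ?_
        rw [sub_eq_add_neg, character_add, mul_neg]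
        ring
      · simp [wξ, wη, obsRow, incRow, hq]

end Isometry

end PerStat

/-! ### Observed increments and the stochastic integral -/

namespace PerStat

variable {T : ℕ}

/-- Reflect the summation index, `l ↦ n - l`. -/
theorem vecIncrement_neg_step {Ω : Type*} (n : ℕ) (s : ℤ) (Z : ℤ → Fin T → Ω → ℂ) (m : ℤ) (p : Fin T) :
    vecIncrement n (-s) Z m p = (-1 : ℂ) ^ n • vecIncrement n s Z (m + s * n) p := by
  ext ω
  simp only [vecIncrement, increment, Pi.smul_apply, smul_eq_mul]
  rw [← Finset.sum_range_reflect, Finset.mul_sum]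
  refine Finset.sum_congr rfl fun l hl => ?_
  have hl' : l ≤ n := Nat.lt_succ_iff.1 (Finset.mem_range.1 hl)
  rw [show n + 1 - 1 - l = n - l by omega, Nat.choose_symm hl']
  have h1 : (-1 : ℂ) ^ (n - l) = (-1) ^ n * (-1) ^ l := by
    rw [← pow_add, show n + l = (n - l) + 2 * l by omega, pow_add, pow_mul]
    simp
  have h2 : m - ((n - l : ℕ) : ℤ) * -s = m + s * n - l * s := by
    push_cast [hl']
    ring
  rw [h1, h2]
  ring

variable {Ω : Type*} [MeasurableSpace Ω] {P : Measure Ω}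

/-- The indices, with the step `μ`, of the observed increments. -/
def obsIndex (T n μ N : ℕ) : Set (ℤ × ℤ × Fin T) :=
  {i | i.2.1 = μ ∧ (i.1 < 0 ∨ (N : ℤ) + μ * n < i.1)}

/-- The increments as elements of `L₂`. -/
noncomputable def incLp {n : ℕ} {ζ : ℤ → Fin T → Ω → ℂ}
    (h : ∀ i : ℤ × ℤ × Fin T, MemLp (vecIncrement n i.2.1 ζ i.1 i.2.2) 2 P)
    (i : ℤ × ℤ × Fin T) : Lp ℂ 2 P := (h i).toLp _

/-- Reversing the step shifts the time by `μn`, so the forward increments at `k ≥ N + 1` are, up to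
sign, those of step `μ` at times beyond `N + μn`. All generators thus have one step, and the gap is
`0, …, N + μn`. -/
theorem observedIncrements_eq {n : ℕ} (μ N : ℕ) {ζ : ℤ → Fin T → Ω → ℂ}
    (h : ∀ i : ℤ × ℤ × Fin T, MemLp (vecIncrement n i.2.1 ζ i.1 i.2.2) 2 P) :
    observedIncrements P n μ N ζ =
      (Submodule.span ℂ (incLp h '' obsIndex T n μ N)).topologicalClosure := by
  unfold observedIncrements
  congr 1
  apply le_antisymm
  · rw [Submodule.span_le]
    rintro u (⟨k, hk, p, hu⟩ | ⟨k, hk, p, hu⟩)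
    · refine Submodule.subset_span ⟨(k, μ, p), ⟨rfl, Or.inl (by omega)⟩, ?_⟩
      exact Lp.ext ((MemLp.coeFn_toLp _).trans hu.symm)
    · have hmem : (-1 : ℂ) ^ n • incLp h (k + μ * n, μ, p) ∈
          Submodule.span ℂ (incLp h '' obsIndex T n μ N) :=
        Submodule.smul_mem _ _ (Submodule.subset_span
          ⟨(k + μ * n, μ, p), ⟨rfl, Or.inr (by simp only; omega)⟩, rfl⟩)
      have heq : u = (-1 : ℂ) ^ n • incLp h (k + μ * n, μ, p) := by
        refine Lp.ext (hu.trans ?_)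
        rw [vecIncrement_neg_step]
        refine Filter.EventuallyEq.trans ?_ (Lp.coeFn_smul _ _).symm
        exact ((h (k + μ * n, μ, p)).coeFn_toLp).symm.const_smul _
      rw [SetLike.mem_coe, heq]
      exact hmem
  · rw [Submodule.span_le]
    rintro _ ⟨⟨k, s, p⟩, ⟨hs, hk⟩, rfl⟩
    simp only at hs hk
    subst hs
    rcases hk with hk | hk
    · exact Submodule.subset_span (Or.inl ⟨k, by omega, p, MemLp.coeFn_toLp _⟩)
    · have hone : (-1 : ℂ) ^ n * (-1) ^ n = 1 := by
        rw [← mul_pow]; simp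
      have heq : incLp h (k, μ, p) = (-1 : ℂ) ^ n • incLp h (k - μ * n, -μ, p) := by
        refine Lp.ext ((MemLp.coeFn_toLp _).trans ?_)
        refine Filter.EventuallyEq.trans ?_ (Lp.coeFn_smul _ _).symm
        refine Filter.EventuallyEq.trans ?_
          (((h (k - μ * n, -μ, p)).coeFn_toLp).symm.const_smul _)
        rw [vecIncrement_neg_step, smul_smul, hone, one_smul]
        simp
      rw [heq]
      exact Submodule.smul_mem _ _ (Submodule.subset_span
        (Or.inr ⟨k - μ * n, by omega, p, MemLp.coeFn_toLp _⟩))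

namespace IsSpectralIsometry

variable {n : ℕ} {ζ η : ℤ → Fin T → Ω → ℂ} {f g : ℝ → Matrix (Fin T) (Fin T) ℂ}
  {R : ℝ → Matrix (Fin T ⊕ Fin T) (Fin T ⊕ Fin T) ℂ}
  {G : Submodule ℂ (Lp ℂ 2 P × Lp (EuclideanSpace ℂ (Fin T ⊕ Fin T)) 2 freq)}

theorem memLp_increment (hI : IsSpectralIsometry n ζ η f g R G) (i : ℤ × ℤ × Fin T) :
    MemLp (vecIncrement n i.2.1 ζ i.1 i.2.2) 2 P := (hI.corr_increment i).1

theorem memLp_rowModel_inc (hI : IsSpectralIsometry n ζ η f g R G) (i : ℤ × ℤ × Fin T) :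
    MemLp (rowModel R (obsRow n (incRow n i))) 2 freq := (hI.corr_increment i).2.1

/-- The rows of the increments as elements of `L₂`. -/
noncomputable def rowLp (hI : IsSpectralIsometry n ζ η f g R G) (i : ℤ × ℤ × Fin T) :
    Lp (EuclideanSpace ℂ (Fin T ⊕ Fin T)) 2 freq := (hI.memLp_rowModel_inc i).toLp _

theorem mem_graph (hI : IsSpectralIsometry n ζ η f g R G) (i : ℤ × ℤ × Fin T) :
    (incLp hI.memLp_increment i, hI.rowLp i) ∈ G := (hI.corr_increment i).2.2

/-- The stochastic isometry preserves inner products. -/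
theorem integral_mul_star (hI : IsSpectralIsometry n ζ η f g R G) {u v : Ω → ℂ}
    {w w' : ℝ → Fin T ⊕ Fin T → ℂ} (h : Corr R G u w) (h' : Corr R G v w') :
    ∫ ω, u ω * star (v ω) ∂P = ∫ x, (w x ᵥ* jointDensity f g x) ⬝ᵥ star (w' x) ∂freq := by
  obtain ⟨h1, h2, h3⟩ := h
  obtain ⟨h1', h2', h3'⟩ := h'
  rw [← inner_toLp_eq h1' h1, ← inner_toLp_rowModel hI.mul_conjTranspose h2' h2]
  exact hI.inner_eq _ h3' _ h3

theorem eLpNorm_eq (hI : IsSpectralIsometry n ζ η f g R G) {u : Ω → ℂ}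
    {w : ℝ → Fin T ⊕ Fin T → ℂ} (h : Corr R G u w) :
    eLpNorm u 2 P = eLpNorm (rowModel R w) 2 freq := by
  obtain ⟨h1, h2, h3⟩ := h
  have h4 := hI.inner_eq _ h3 _ h3
  have h5 : ‖h1.toLp u‖ = ‖h2.toLp _‖ := by
    rw [@norm_eq_sqrt_re_inner ℂ, @norm_eq_sqrt_re_inner ℂ (Lp (EuclideanSpace ℂ _) 2 freq), h4]
  rw [Lp.norm_toLp, Lp.norm_toLp] at h5
  exact (ENNReal.toReal_eq_toReal_iff' h1.eLpNorm_ne_top h2.eLpNorm_ne_top).1 h5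

/-- Since `|(iλ)^n|² = λ^{2n}`, the noise half contributes `λ^{2n} g`, which together with `f` is
the density `p`. -/
theorem obsRow_form (n : ℕ) (f g : ℝ → Matrix (Fin T) (Fin T) ℂ) (h : ℝ → Fin T → ℂ) (x : ℝ) :
    (obsRow n h x ᵥ* jointDensity f g x) ⬝ᵥ star (obsRow n h x) =
      (h x ᵥ* obsDensity n f g x) ⬝ᵥ star (h x) := by
  unfold obsRow obsDensity
  rw [jointDensity_form, Matrix.vecMul_add, add_dotProduct, Matrix.vecMul_smul,
    Matrix.smul_vecMul, star_smul, dotProduct_smul, smul_dotProduct, smul_dotProduct, smul_smul]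
  congr 2
  have h1 : star ((Complex.I * (x : ℂ)) ^ n) = (-(Complex.I * (x : ℂ))) ^ n := by
    rw [star_pow]; simp
  rw [h1, ← mul_pow, pow_mul]
  congr 1
  linear_combination (-(x : ℂ) ^ 2) * Complex.I_sq

theorem sqNorm_eq (hI : IsSpectralIsometry n ζ η f g R G) (h : ℝ → Fin T → ℂ) :
    sqNorm (obsDensity n f g) h = eLpNorm (rowModel R (obsRow n h)) 2 freq ^ 2 := by
  have h2 := eLpNorm_nnreal_pow_eq_lintegral (f := rowModel R (obsRow n h)) (μ := freq)
    (p := 2) two_ne_zero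
  have h3 : eLpNorm (rowModel R (obsRow n h)) 2 freq ^ 2 =
      ∫⁻ x, ‖rowModel R (obsRow n h) x‖ₑ ^ 2 ∂freq := by
    simpa using h2
  rw [h3]
  unfold sqNorm
  refine lintegral_congr_ae ?_
  filter_upwards [hI.mul_conjTranspose] with x hx
  rw [← obsRow_form, ← norm_sq_rowModel hx, Complex.ofReal_re, ENNReal.ofReal_pow (norm_nonneg _),
    ofReal_norm]

theorem obsRow_sub_sum (n : ℕ) (h : ℝ → Fin T → ℂ) (c : (ℤ × ℤ × Fin T) →₀ ℂ) :
    obsRow n (fun x => h x - c.sum fun i z =>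
        Pi.single i.2.2 (z * (character i.1 x * incFactor n i.2.1 x))) =
      obsRow n h - ∑ i ∈ c.support, c i • obsRow n (incRow n i) := by
  have hs : ∀ (i : ℤ × ℤ × Fin T) (x : ℝ) (p : Fin T),
      (Pi.single i.2.2 (c i * (character i.1 x * incFactor n i.2.1 x)) : Fin T → ℂ) p =
        c i * incRow n i x p := by
    intro i x p
    rcases eq_or_ne p i.2.2 with rfl | hp
    · simp [incRow]
    · simp [incRow, hp]
  ext x j
  cases j with
  | inl p =>
    simp only [obsRow, Finsupp.sum, Sum.elim_inl, Pi.sub_apply, Finset.sum_apply, Pi.smul_apply,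
      smul_eq_mul, hs]
  | inr p =>
    simp only [obsRow, Finsupp.sum, Sum.elim_inr, Pi.sub_apply, Finset.sum_apply, Pi.smul_apply,
      smul_eq_mul, hs, mul_sub, Finset.mul_sum]
    congr 1
    exact Finset.sum_congr rfl fun i _ => by ring

theorem corr_sub_finsupp (hI : IsSpectralIsometry n ζ η f g R G) {u : Ω → ℂ} {h : ℝ → Fin T → ℂ}
    (hu : Corr R G u (obsRow n h)) (c : (ℤ × ℤ × Fin T) →₀ ℂ) :
    Corr R G (fun ω => u ω - c.sum fun i z => z * vecIncrement n i.2.1 ζ i.1 i.2.2 ω)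
      (obsRow n (fun x => h x - c.sum fun i z =>
        Pi.single i.2.2 (z * (character i.1 x * incFactor n i.2.1 x)))) := by
  rw [obsRow_sub_sum]
  have := hu.sub (Corr.sum c.support fun i _ => (hI.corr_increment i).const_smul (c i))
  refine this.congr (Filter.Eventually.of_forall fun ω => ?_) Filter.EventuallyEq.rfl
  simp [Finsupp.sum]

/-- A combination of increments close to `u` in `L₂(P)` is, by the isometry, equally close to `h` in
`L₂(p)`, so one approximation serves both limits. -/
theorem isSpectralIntegral (hI : IsSpectralIsometry n ζ η f g R G) {u : Ω → ℂ}
    {h : ℝ → Fin T → ℂ} (hh : AEMeasurable h freq) (hu : Corr R G u (obsRow n h))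
    {s : Set (ℤ × ℤ × Fin T)}
    (hs : hu.1.toLp u ∈ (Submodule.span ℂ (incLp hI.memLp_increment '' s)).topologicalClosure) :
    IsSpectralIntegral P n ζ (obsDensity n f g) h u := by
  refine ⟨hh, hu.1, fun ε hε => ?_⟩
  -- `sqNorm` is a squared norm; a distance below `min ε 1` has its square below `ε` as well.
  have hm1 : min ε 1 ≠ 0 := (lt_min hε one_pos).ne'
  have hm2 : min ε 1 ≠ ∞ := ne_top_of_le_ne_top ENNReal.one_ne_top (min_le_right _ _)
  obtain ⟨b, hb, hab⟩ := Metric.mem_closure_iff.1 hs (min ε 1).toReal (ENNReal.toReal_pos hm1 hm2)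
  obtain ⟨c, -, rfl⟩ := (Finsupp.mem_span_image_iff_linearCombination ℂ).1 hb
  have hc := hI.corr_sub_finsupp hu c
  have hnorm : eLpNorm (fun ω => u ω - c.sum fun i z => z * vecIncrement n i.2.1 ζ i.1 i.2.2 ω) 2 P
      < min ε 1 := by
    rw [dist_eq_norm] at hab
    have heq : hu.1.toLp u - Finsupp.linearCombination ℂ (incLp hI.memLp_increment) c =
        hc.1.toLp _ := by
      have hsum : Finsupp.linearCombination ℂ (incLp hI.memLp_increment) c =ᵐ[P]
          fun ω => c.sum fun i z => z * vecIncrement n i.2.1 ζ i.1 i.2.2 ω := by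
        rw [Finsupp.linearCombination_apply, Finsupp.sum]
        refine (Lp.coeFn_finsetSum _ _).trans ?_
        have hall : ∀ᵐ ω ∂P, ∀ i ∈ c.support,
            (c i • incLp hI.memLp_increment i : Lp ℂ 2 P) ω =
              c i * vecIncrement n i.2.1 ζ i.1 i.2.2 ω := by
          rw [Filter.eventually_all_finset]
          intro i _
          filter_upwards [Lp.coeFn_smul (c i) (incLp hI.memLp_increment i),
            (hI.memLp_increment i).coeFn_toLp] with ω h1 h2
          rw [h1, Pi.smul_apply, smul_eq_mul]
          congr 1
        filter_upwards [hall] with ω hω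
        rw [Finset.sum_apply]
        exact Finset.sum_congr rfl hω
      refine Lp.ext ?_
      filter_upwards [Lp.coeFn_sub (hu.1.toLp u)
        (Finsupp.linearCombination ℂ (incLp hI.memLp_increment) c), hu.1.coeFn_toLp,
        hc.1.coeFn_toLp, hsum] with ω h1 h2 h3 h4
      rw [h1, h3, Pi.sub_apply, h2, h4]
    rw [heq, Lp.norm_toLp] at hab
    exact (ENNReal.toReal_lt_toReal hc.1.eLpNorm_ne_top hm2).1 hab
  refine ⟨c, ?_, hnorm.trans_le (min_le_left _ _)⟩
  rw [hI.sqNorm_eq, ← hI.eLpNorm_eq hc, sq]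
  calc _ ≤ 1 * eLpNorm (fun ω => u ω - c.sum fun i z =>
          z * vecIncrement n i.2.1 ζ i.1 i.2.2 ω) 2 P := by
        gcongr
        exact hnorm.le.trans (min_le_right _ _)
    _ < ε := by
        rw [one_mul]
        exact hnorm.trans_le (min_le_left _ _)

/-- Uniqueness of the integral: combinations approximating `h` converge to `v` by definition and to
`u` by the isometry. -/
theorem ae_eq_of_isSpectralIntegral (hI : IsSpectralIsometry n ζ η f g R G) {u v : Ω → ℂ}
    {h : ℝ → Fin T → ℂ} (hu : Corr R G u (obsRow n h))
    (hv : IsSpectralIntegral P n ζ (obsDensity n f g) h v) : v =ᵐ[P] u := by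
  obtain ⟨-, hv2, hv3⟩ := hv
  have hsub : MemLp (v - u) 2 P := hv2.sub hu.1
  have hle : ∀ δ : ℝ≥0∞, 0 < δ → eLpNorm (v - u) 2 P ≤ δ + δ := by
    intro δ hδ
    -- The bound `δ ^ 2` is for the squared spectral norm, the bound `δ` for the norm in `L₂(P)`.
    obtain ⟨c, h1, h2⟩ := hv3 (min δ (δ ^ 2)) (lt_min hδ (ENNReal.pow_pos hδ 2))
    have hc := hI.corr_sub_finsupp hu c
    rw [hI.sqNorm_eq, ← hI.eLpNorm_eq hc] at h1
    have h3 : eLpNorm (fun ω => u ω - c.sum fun i z => z * vecIncrement n i.2.1 ζ i.1 i.2.2 ω) 2 P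
        < δ := lt_of_not_ge fun hge =>
      absurd (h1.trans_le (min_le_right _ _)) (not_lt.2 (pow_le_pow_left' hge 2))
    have h4 := h2.trans_le (min_le_left _ _)
    set S : Ω → ℂ := fun ω => c.sum fun i z => z * vecIncrement n i.2.1 ζ i.1 i.2.2 ω
    have hS : MemLp (fun ω => v ω - S ω) 2 P := by
      have := hsub.add hc.1
      refine this.ae_eq (Filter.Eventually.of_forall fun ω => ?_)
      simp [S]
    have heq : v - u = (fun ω => v ω - S ω) - (fun ω => u ω - S ω) := by
      ext ω
      simp
    rw [heq]
    exact (eLpNorm_sub_le hS.1 hc.1.1 (by norm_num)).trans (add_le_add h4.le h3.le)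
  have hzero : eLpNorm (v - u) 2 P = 0 := by
    by_contra hne
    have hpos : 0 < eLpNorm (v - u) 2 P / 4 := by
      refine ENNReal.div_pos hne (by norm_num)
    have h5 := hle _ hpos
    have hfin := hsub.eLpNorm_ne_top
    lift eLpNorm (v - u) 2 P to NNReal using hfin with e
    have he : (0 : ℝ) < e := by
      have : e ≠ 0 := by exact_mod_cast hne
      exact_mod_cast pos_iff_ne_zero.2 this
    have h6 : (e : ℝ) ≤ e / 4 + e / 4 := by
      have h4 : ((e : ℝ≥0∞) / 4) = ((e / 4 : NNReal) : ℝ≥0∞) := by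
        rw [ENNReal.coe_div (by norm_num)]; rfl
      rw [h4] at h5
      exact_mod_cast h5
    linarith
  have := (eLpNorm_eq_zero_iff hsub.1 (by norm_num)).1 hzero
  filter_upwards [this] with ω hω
  exact sub_eq_zero.1 hω

end IsSpectralIsometry

end PerStat

/-! ### Membership in, and orthogonality to, the closed span of the observations -/

namespace PerStat

variable {T : ℕ} {Ω : Type*} [MeasurableSpace Ω] {P : Measure Ω}

namespace IsSpectralIsometry

variable {n : ℕ} {ζ η : ℤ → Fin T → Ω → ℂ} {f g : ℝ → Matrix (Fin T) (Fin T) ℂ}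
  {R : ℝ → Matrix (Fin T ⊕ Fin T) (Fin T ⊕ Fin T) ℂ}
  {G : Submodule ℂ (Lp ℂ 2 P × Lp (EuclideanSpace ℂ (Fin T ⊕ Fin T)) 2 freq)}

/-- A row `h` of finite norm whose quotient by the increment factor has vanishing Fourier
coefficients at the unobserved indices belongs to the closed span of the observed rows. -/
theorem mem_closure_span_rowLp (hI : IsSpectralIsometry n ζ η f g R G) {μ N : ℕ}
    {h r : ℝ → Fin T → ℂ} (hh : MemLp (rowModel R (obsRow n h)) 2 freq)
    (hr : ∀ p, Integrable (fun x => r x p) freq)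
    (hhr : ∀ᵐ x ∂freq, h x = incFactor n μ x • r x)
    (hcoef : ∀ k ∈ Finset.Icc (0 : ℤ) (N + μ * n), ∀ p,
      ∫ x, character (-k) x * r x p ∂freq = 0) :
    hh.toLp _ ∈ (Submodule.span ℂ (hI.rowLp '' obsIndex T n μ N)).topologicalClosure := by
  -- Membership is shown by duality: `h` must be orthogonal to every `ψ` that is orthogonal to the
  -- observed rows.
  rw [← Submodule.orthogonal_orthogonal_eq_closure]
  rw [Submodule.mem_orthogonal]
  intro ψ hψ
  rw [Submodule.mem_orthogonal'] at hψ
  let κ : ℝ → Fin T ⊕ Fin T → ℂ := fun x => R x *ᵥ star (WithLp.ofLp (ψ x))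
  -- Against rows of the form `(v, (iλ)^n v)`, only this combination of the two halves of `R ψ̄` is
  -- seen by the inner product with `ψ`.
  let κ' : ℝ → Fin T → ℂ := fun x p =>
    κ x (Sum.inl p) + (Complex.I * (x : ℂ)) ^ n * κ x (Sum.inr p)
  have hinner : ∀ (v : ℝ → Fin T → ℂ) (x : ℝ),
      inner ℂ (ψ x) (rowModel R (obsRow n v) x) = ∑ p, v x p * κ' x p := by
    intro v x
    rw [EuclideanSpace.inner_eq_star_dotProduct]
    simp only [rowModel]
    rw [← Matrix.dotProduct_mulVec]
    change obsRow n v x ⬝ᵥ κ x = _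
    simp only [dotProduct, Fintype.sum_sum_type, obsRow, Sum.elim_inl, Sum.elim_inr,
      ← Finset.sum_add_distrib, Pi.smul_apply, smul_eq_mul, κ']
    exact Finset.sum_congr rfl fun p _ => by ring
  have hI2 : ∀ (v : ℝ → Fin T → ℂ) (hv : MemLp (rowModel R (obsRow n v)) 2 freq),
      Integrable (fun x => ∑ p, v x p * κ' x p) freq ∧
        inner ℂ ψ (hv.toLp _) = ∫ x, ∑ p, v x p * κ' x p ∂freq := by
    intro v hv
    have hae : (fun x => inner ℂ (ψ x) (hv.toLp _ x)) =ᵐ[freq]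
        fun x => ∑ p, v x p * κ' x p := by
      filter_upwards [hv.coeFn_toLp] with x hx
      rw [hx, hinner]
    exact ⟨(L2.integrable_inner (𝕜 := ℂ) ψ (hv.toLp _)).congr hae,
      (L2.inner_def _ _).trans (integral_congr_ae hae)⟩
  have hinc : ∀ (k : ℤ) (p : Fin T) (x : ℝ), ∑ q, incRow n (k, (μ : ℤ), p) x q * κ' x q =
      character k x * (incFactor n μ x * κ' x p) := by
    intro k p x
    rw [Finset.sum_eq_single p]
    · simp [incRow, mul_assoc]
    · intro q _ hq
      simp [incRow, hq]
    · simp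
  -- The row of the increment at time `0` lies in `L₂`, although it is not observed, so its product
  -- with `ψ` is integrable.
  have hF : ∀ p, Integrable (fun x => incFactor n μ x * κ' x p) freq := by
    intro p
    have := (hI2 _ (hI.memLp_rowModel_inc (0, (μ : ℤ), p))).1
    simpa only [hinc, character_zero, one_mul] using this
  have hF0 : ∀ p, ∀ k : ℤ, k ∉ Finset.Icc (0 : ℤ) (N + μ * n) →
      ∫ x, character k x * (incFactor n μ x * κ' x p) ∂freq = 0 := by
    intro p k hk
    rw [Finset.mem_Icc] at hk
    have h1 := (hI2 _ (hI.memLp_rowModel_inc (k, (μ : ℤ), p))).2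
    simp only [hinc] at h1
    rw [← h1]
    exact hψ _ (Submodule.subset_span ⟨(k, μ, p), ⟨rfl, by simp only; omega⟩, rfl⟩)
  -- Only the frequencies of the finite gap survive, so `χ κ'` is a trigonometric polynomial.
  -- Multiplied by `r` it stays integrable, and its integral sees only the vanishing coefficients of
  -- `r`.
  choose c hc using fun p => ae_eq_sum_character (hF p) _ (hF0 p)
  rw [(hI2 h hh).2]
  have hall : ∀ᵐ x ∂freq, ∑ p, h x p * κ' x p =
      ∑ p, ∑ k ∈ Finset.Icc (0 : ℤ) (N + μ * n), c p k * (character (-k) x * r x p) := by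
    filter_upwards [hhr, ae_all_iff.2 hc] with x h1 h2
    refine Finset.sum_congr rfl fun p _ => ?_
    rw [h1, Pi.smul_apply, smul_eq_mul,
      show incFactor n μ x * r x p * κ' x p = r x p * (incFactor n μ x * κ' x p) by ring, h2,
      Finset.mul_sum]
    exact Finset.sum_congr rfl fun k _ => by ring
  rw [integral_congr_ae hall, integral_finsetSum _ fun p _ => integrable_finsetSum _ fun k _ =>
    (integrable_character_mul (hr p)).const_mul _]
  refine Finset.sum_eq_zero fun p _ => ?_
  rw [integral_finsetSum _ fun k _ => (integrable_character_mul (hr p)).const_mul _]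
  refine Finset.sum_eq_zero fun k hk => ?_
  rw [integral_const_mul, hcoef k hk p, mul_zero]

/-- Such a row corresponds to an element of the closed span of the observed increments. -/
theorem exists_corr_mem_observedIncrements (hI : IsSpectralIsometry n ζ η f g R G) {μ N : ℕ}
    {h r : ℝ → Fin T → ℂ} (hh : MemLp (rowModel R (obsRow n h)) 2 freq)
    (hr : ∀ p, Integrable (fun x => r x p) freq)
    (hhr : ∀ᵐ x ∂freq, h x = incFactor n μ x • r x)
    (hcoef : ∀ k ∈ Finset.Icc (0 : ℤ) (N + μ * n), ∀ p,
      ∫ x, character (-k) x * r x p ∂freq = 0) :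
    ∃ u ∈ observedIncrements P n μ N ζ, Corr R G u (obsRow n h) := by
  have hmem := hI.mem_closure_span_rowLp hh hr hhr hcoef
  obtain ⟨u, hu⟩ := exists_mem_corrGraph
    (fun i j => hI.inner_eq _ (hI.mem_graph i) _ (hI.mem_graph j)) hmem
  refine ⟨u, ?_, Lp.memLp u, hh, ?_⟩
  · rw [observedIncrements_eq μ N hI.memLp_increment]
    exact fst_mem_closure_span hu
  · rw [Lp.toLp_coeFn]
    have hle : corrGraph (incLp hI.memLp_increment) hI.rowLp (obsIndex T n μ N) ≤ G := by
      refine Submodule.topologicalClosure_minimal _ ?_ hI.isClosed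
      rw [Submodule.span_le]
      rintro _ ⟨i, -, rfl⟩
      exact hI.mem_graph i
    exact hle hu

/-- Orthogonality to the observed increments, in terms of row functions. -/
theorem inner_eq_zero_of_mem_observedIncrements (hI : IsSpectralIsometry n ζ η f g R G) {μ N : ℕ}
    {e : Ω → ℂ} {w : ℝ → Fin T ⊕ Fin T → ℂ} (he : Corr R G e w)
    (horth : ∀ k : ℤ, (k < 0 ∨ (N : ℤ) + μ * n < k) → ∀ p,
      ∫ x, (w x ᵥ* jointDensity f g x) ⬝ᵥ star (obsRow n (incRow n (k, μ, p)) x) ∂freq = 0) :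
    ∀ u ∈ observedIncrements P n μ N ζ, inner ℂ u (he.1.toLp e) = 0 := by
  intro u hu
  rw [observedIncrements_eq μ N hI.memLp_increment] at hu
  have hcl : IsClosed {u : Lp ℂ 2 P | inner ℂ u (he.1.toLp e) = 0} :=
    isClosed_eq (by fun_prop) continuous_const
  refine hcl.closure_subset_iff.2 (fun v hv => ?_) hu
  have hv' : v ∈ Submodule.span ℂ (incLp hI.memLp_increment '' obsIndex T n μ N) := hv
  change inner ℂ v (he.1.toLp e) = 0
  clear hv
  induction hv' using Submodule.span_induction with
  | mem v hv =>
    obtain ⟨⟨k, s, p⟩, ⟨hs, hk⟩, rfl⟩ := hv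
    simp only at hs hk
    subst hs
    rw [← horth k hk p, ← hI.integral_mul_star he (hI.corr_increment (k, μ, p))]
    exact inner_toLp_eq _ _
  | zero => simp
  | add v w _ _ h1 h2 => rw [inner_add_left, h1, h2, add_zero]
  | smul z v _ h1 => rw [inner_smul_left, h1, mul_zero]

end IsSpectralIsometry

end PerStat

namespace PerStat

/-! ### Sesquilinear forms of positive semidefinite matrices -/

section MatrixForm

variable {ι : Type*} [Fintype ι]

theorem vecMul_dotProduct_star_vecMul {N : Matrix ι ι ℂ} (hN : N.IsHermitian) (M : Matrix ι ι ℂ)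
    (u v : ι → ℂ) :
    (u ᵥ* M) ⬝ᵥ star (v ᵥ* N) = (u ᵥ* (M * N)) ⬝ᵥ star v := by
  rw [Matrix.star_vecMul, Matrix.dotProduct_mulVec, Matrix.vecMul_vecMul, hN.eq]

theorem vecMul_dotProduct_star_nonneg {M : Matrix ι ι ℂ} (hM : M.PosSemidef) (u : ι → ℂ) :
    0 ≤ (u ᵥ* M) ⬝ᵥ star u := by
  have h := hM.dotProduct_mulVec_nonneg (star u)
  rwa [star_star, Matrix.dotProduct_mulVec] at h

theorem vecMul_dotProduct_star_pos {M : Matrix ι ι ℂ} (hM : M.PosDef) {u : ι → ℂ} (hu : u ≠ 0) :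
    0 < (u ᵥ* M) ⬝ᵥ star u := by
  have h := hM.dotProduct_mulVec_pos (x := star u) (by simpa using hu)
  rwa [star_star, Matrix.dotProduct_mulVec] at h

theorem vecMul_dotProduct_star_add_mul (M N : Matrix ι ι ℂ) (u v : ι → ℂ) (z : ℂ) :
    (u ᵥ* M) ⬝ᵥ star v + z * ((u ᵥ* N) ⬝ᵥ star v) = (u ᵥ* (M + z • N)) ⬝ᵥ star v := by
  rw [Matrix.vecMul_add, Matrix.vecMul_smul, add_dotProduct, smul_dotProduct, smul_eq_mul]

theorem vecMul_dotProduct_star_expand {G : Matrix ι ι ℂ} (hG : G.IsHermitian) (M : Matrix ι ι ℂ)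
    (u v : ι → ℂ) (s z : ℂ) :
    ((s • (u ᵥ* G) + z • v) ᵥ* M) ⬝ᵥ star (s • (u ᵥ* G) + z • v) =
      s * star s * ((u ᵥ* (G * M * G)) ⬝ᵥ star u) + s * star z * ((u ᵥ* (G * M)) ⬝ᵥ star v) +
        z * star s * ((v ᵥ* (M * G)) ⬝ᵥ star u) + z * star z * ((v ᵥ* M) ⬝ᵥ star v) := by
  simp only [Matrix.add_vecMul, Matrix.smul_vecMul, star_add, star_smul, dotProduct_add,
    add_dotProduct, dotProduct_smul, smul_dotProduct, vecMul_dotProduct_star_vecMul hG,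
    Matrix.vecMul_vecMul]
  simp only [smul_eq_mul]
  ring

/-- Nonnegativity of the `2 × 2` principal minor gives `|M i j|² ≤ M i i · M j j`. This reduces
integrability of all entries to that of the trace. -/
theorem norm_apply_le_trace [DecidableEq ι] {M : Matrix ι ι ℂ} (hM : M.PosSemidef) (i j : ι) :
    ‖M i j‖ ≤ M.trace.re := by
  have hd : ∀ k, 0 ≤ (M k k).re := fun k => (Complex.le_def.1 hM.diag_nonneg).1
  have hdi : ∀ k, (M k k).im = 0 := fun k => (Complex.le_def.1 hM.diag_nonneg).2.symm
  have htr : ∀ k, (M k k).re ≤ M.trace.re := fun k => by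
    rw [Matrix.trace, Complex.re_sum]
    exact Finset.single_le_sum (f := fun k => (M.diag k).re) (fun k _ => hd k) (Finset.mem_univ k)
  have hdet := (hM.submatrix ![i, j]).det_nonneg
  rw [Matrix.det_fin_two] at hdet
  simp only [Matrix.submatrix_apply, Matrix.cons_val_zero, Matrix.cons_val_one] at hdet
  have hji : M j i = star (M i j) := (hM.1.apply j i).symm
  have h2 := (Complex.le_def.1 hdet).1
  rw [hji, Complex.star_def, Complex.mul_conj] at h2
  simp only [Complex.zero_re, Complex.sub_re, Complex.mul_re, Complex.ofReal_re, hdi, mul_zero,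
    sub_zero] at h2
  rw [Complex.normSq_eq_norm_sq] at h2
  have h3 : ‖M i j‖ ^ 2 ≤ M.trace.re ^ 2 := by
    nlinarith [mul_le_mul (htr i) (htr j) (hd j) ((hd i).trans (htr i))]
  exact (abs_le_of_sq_le_sq' h3 ((hd i).trans (htr i))).2

variable [DecidableEq ι] {F G p : Matrix ι ι ℂ} {t : ℝ}

theorem posDef_add_smul (hF : F.PosSemidef) (hG : G.PosSemidef) (ht : 0 ≤ t)
    (hp : p = F + (t : ℂ) • G) (hu : IsUnit p) : p.PosDef := by
  have hps : p.PosSemidef := by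
    rw [hp]
    exact hF.add (hG.smul (by exact_mod_cast ht))
  exact hps.posDef_iff_isUnit.2 hu

/-- Substitute `F = p - t G`. The subtracted term is semidefinite for `t ≥ 0`, so this is the bound
of `F p⁻¹ G` by `G`. -/
theorem mul_inv_mul_eq_sub (hp : p = F + (t : ℂ) • G) (hu : IsUnit p) :
    F * p⁻¹ * G = G - (t : ℂ) • (G * p⁻¹ * G) := by
  have h1 : p * p⁻¹ = 1 := Matrix.mul_nonsing_inv p ((Matrix.isUnit_iff_isUnit_det p).1 hu)
  have h2 : F = p - (t : ℂ) • G := by rw [hp]; simp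
  rw [h2, sub_mul, sub_mul, h1, one_mul, Matrix.smul_mul, Matrix.smul_mul]

/-- Substituting `F = p - t G` on either side yields the same expression. The argument does not
divide by `t`. -/
theorem mul_inv_mul_comm (hp : p = F + (t : ℂ) • G) (hu : IsUnit p) :
    G * p⁻¹ * F = F * p⁻¹ * G := by
  have h1 : p⁻¹ * p = 1 := Matrix.nonsing_inv_mul p ((Matrix.isUnit_iff_isUnit_det p).1 hu)
  have h2 : F = p - (t : ℂ) • G := by rw [hp]; simp
  rw [mul_inv_mul_eq_sub hp hu]
  nth_rewrite 1 [h2]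
  rw [mul_sub, mul_assoc, h1, mul_one, Matrix.mul_smul]

theorem posSemidef_smul_mul_inv_mul (hF : F.PosSemidef) (hG : G.PosSemidef) (ht : 0 ≤ t)
    (hp : p = F + (t : ℂ) • G) (hu : IsUnit p) : ((t : ℂ) • (G * p⁻¹ * G)).PosSemidef := by
  have h := (posDef_add_smul hF hG ht hp hu).inv.posSemidef.mul_mul_conjTranspose_same G
  rw [hG.1.eq] at h
  exact h.smul (by exact_mod_cast ht)

/-- By commutation, `F p⁻¹ G = (F p⁻¹) G (F p⁻¹)^* + t (G p⁻¹) F (G p⁻¹)^*`, a sum of congruences of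
semidefinite matrices. -/
theorem posSemidef_mul_inv_mul (hF : F.PosSemidef) (hG : G.PosSemidef) (ht : 0 ≤ t)
    (hp : p = F + (t : ℂ) • G) (hu : IsUnit p) : (F * p⁻¹ * G).PosSemidef := by
  have hpi : p⁻¹.IsHermitian := (posDef_add_smul hF hG ht hp hu).inv.1
  have h1 : p * p⁻¹ = 1 := Matrix.mul_nonsing_inv p ((Matrix.isUnit_iff_isUnit_det p).1 hu)
  have hc := mul_inv_mul_comm hp hu
  have hA := hG.mul_mul_conjTranspose_same (F * p⁻¹)
  have hB := (hF.mul_mul_conjTranspose_same (G * p⁻¹)).smul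
    (α := ℂ) (a := (t : ℂ)) (by exact_mod_cast ht)
  rw [Matrix.conjTranspose_mul, hpi.eq, hF.1.eq] at hA
  rw [Matrix.conjTranspose_mul, hpi.eq, hG.1.eq] at hB
  convert hA.add hB using 1
  have e1 : F * p⁻¹ * G * (p⁻¹ * F) = F * p⁻¹ * G * p⁻¹ * F := by simp only [mul_assoc]
  have e2 : G * p⁻¹ * F * (p⁻¹ * G) = F * p⁻¹ * G * p⁻¹ * G := by
    rw [← hc]; simp only [mul_assoc]
  rw [e1, e2, ← Matrix.mul_smul, ← mul_add, ← hp, mul_assoc (F * p⁻¹ * G), Matrix.nonsing_inv_mul p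
    ((Matrix.isUnit_iff_isUnit_det p).1 hu), mul_one]

/-- The two parts of the error add up to the form of `F p⁻¹ G` plus the form of `p⁻¹`. -/
theorem error_form_eq (hF : F.PosSemidef) (hG : G.PosSemidef)
    (hp : p = F + (t : ℂ) • G) (hu : IsUnit p) (A C : ι → ℂ) (s : ℂ) :
    (t : ℂ) * (((s • (A ᵥ* G) + C) ᵥ* (p⁻¹ * F * p⁻¹)) ⬝ᵥ star (s • (A ᵥ* G) + C)) +
        (((s • (A ᵥ* F) - (t : ℂ) • C) ᵥ* (p⁻¹ * G * p⁻¹)) ⬝ᵥ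
          star (s • (A ᵥ* F) - (t : ℂ) • C)) =
      s * star s * ((A ᵥ* (F * p⁻¹ * G)) ⬝ᵥ star A) + (t : ℂ) * ((C ᵥ* p⁻¹) ⬝ᵥ star C) := by
  have hi : p⁻¹ * p = 1 := Matrix.nonsing_inv_mul p ((Matrix.isUnit_iff_isUnit_det p).1 hu)
  have hc := mul_inv_mul_comm hp hu
  have hts : star (t : ℂ) = t := by simp
  have hAA : G * (p⁻¹ * F * p⁻¹) * G = F * p⁻¹ * G * p⁻¹ * G := by
    rw [← hc]; simp only [mul_assoc]
  have hAA' : F * (p⁻¹ * G * p⁻¹) * F = F * p⁻¹ * G * p⁻¹ * F := by simp only [mul_assoc]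
  -- This identity and the next make the cross terms of the two parts equal up to sign, since the
  -- second row carries `-t C`.
  have hAC : G * (p⁻¹ * F * p⁻¹) = F * (p⁻¹ * G * p⁻¹) := by
    rw [← mul_assoc, ← mul_assoc, hc]; simp only [mul_assoc]
  have hCA : p⁻¹ * F * p⁻¹ * G = p⁻¹ * G * p⁻¹ * F := by
    rw [mul_assoc p⁻¹ F, mul_assoc p⁻¹, ← hc]; simp only [mul_assoc]
  have eAA : (A ᵥ* (F * p⁻¹ * G * p⁻¹ * F)) ⬝ᵥ star A +
      (t : ℂ) * ((A ᵥ* (F * p⁻¹ * G * p⁻¹ * G)) ⬝ᵥ star A) =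
      (A ᵥ* (F * p⁻¹ * G)) ⬝ᵥ star A := by
    rw [vecMul_dotProduct_star_add_mul, ← Matrix.mul_smul, ← mul_add, ← hp, mul_assoc (F * p⁻¹ * G), hi, mul_one]
  have eCC : (C ᵥ* (p⁻¹ * F * p⁻¹)) ⬝ᵥ star C +
      (t : ℂ) * ((C ᵥ* (p⁻¹ * G * p⁻¹)) ⬝ᵥ star C) = (C ᵥ* p⁻¹) ⬝ᵥ star C := by
    rw [vecMul_dotProduct_star_add_mul, mul_assoc p⁻¹ F, mul_assoc p⁻¹ G, ← Matrix.mul_smul, ← Matrix.smul_mul,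
      ← mul_add, ← add_mul, ← hp, ← mul_assoc, hi, one_mul]
  have h1 := vecMul_dotProduct_star_expand hG.1 (p⁻¹ * F * p⁻¹) A C s 1
  have h2 := vecMul_dotProduct_star_expand hF.1 (p⁻¹ * G * p⁻¹) A C s (-t)
  rw [one_smul, hAA, hAC, hCA, star_one] at h1
  rw [neg_smul, ← sub_eq_add_neg, hAA', star_neg, hts] at h2
  rw [h1, h2]
  linear_combination s * star s * eAA + (t : ℂ) * eCC

end MatrixForm

end PerStat

namespace PerStat

variable {T : ℕ}

/-! ### Measurability and integrability of matrix functions -/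

theorem aemeasurable_inv_apply {X : Type*} [MeasurableSpace X] {ν : Measure X} {ι : Type*}
    [Fintype ι] [DecidableEq ι] {S : X → Matrix ι ι ℂ}
    (hS : ∀ i j, AEMeasurable (fun x => S x i j) ν) (i j : ι) :
    AEMeasurable (fun x => (S x)⁻¹ i j) ν := by
  have hSm : AEMeasurable (fun x (i j : ι) => S x i j) ν :=
    aemeasurable_pi_lambda _ fun i => aemeasurable_pi_lambda _ fun j => hS i j
  have h1 : Continuous fun A : ι → ι → ℂ => (Matrix.of A).det := by
    exact Continuous.matrix_det (A := fun A : ι → ι → ℂ => Matrix.of A) continuous_id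
  have h2 : Continuous fun A : ι → ι → ℂ => (Matrix.of A).adjugate i j := by
    exact (Continuous.matrix_adjugate (A := fun A : ι → ι → ℂ => Matrix.of A)
      continuous_id).matrix_elem i j
  have h3 : (fun x => (S x)⁻¹ i j) = fun x => ((S x).det)⁻¹ * (S x).adjugate i j := by
    ext x
    rw [Matrix.inv_def, Ring.inverse_eq_inv']
    rfl
  rw [h3]
  exact (h1.measurable.comp_aemeasurable hSm).inv.mul (h2.measurable.comp_aemeasurable hSm)

theorem aemeasurable_mul_apply {X : Type*} [MeasurableSpace X] {ν : Measure X} {ι : Type*}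
    [Fintype ι] {A B : X → Matrix ι ι ℂ}
    (hA : ∀ i j, AEMeasurable (fun x => A x i j) ν)
    (hB : ∀ i j, AEMeasurable (fun x => B x i j) ν) (i j : ι) :
    AEMeasurable (fun x => (A x * B x) i j) ν := by
  simp only [Matrix.mul_apply]
  exact Finset.aemeasurable_fun_sum _ fun k _ => (hA i k).mul (hB k j)

theorem aemeasurable_vecMul_apply {X : Type*} [MeasurableSpace X] {ν : Measure X} {ι : Type*}
    [Fintype ι] {v : X → ι → ℂ} {A : X → Matrix ι ι ℂ}
    (hv : ∀ i, AEMeasurable (fun x => v x i) ν)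
    (hA : ∀ i j, AEMeasurable (fun x => A x i j) ν) (j : ι) :
    AEMeasurable (fun x => (v x ᵥ* A x) j) ν := by
  simp only [Matrix.vecMul, dotProduct]
  exact Finset.aemeasurable_fun_sum _ fun k _ => (hv k).mul (hA k j)

theorem aemeasurable_dotProduct_star {X : Type*} [MeasurableSpace X] {ν : Measure X} {ι : Type*}
    [Fintype ι] {v w : X → ι → ℂ} (hv : ∀ i, AEMeasurable (fun x => v x i) ν)
    (hw : ∀ i, AEMeasurable (fun x => w x i) ν) :
    AEMeasurable (fun x => v x ⬝ᵥ star (w x)) ν := by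
  simp only [dotProduct, Pi.star_apply]
  exact Finset.aemeasurable_fun_sum _ fun k _ =>
    (hv k).mul (continuous_star.measurable.comp_aemeasurable (hw k))

/-! ### Toeplitz matrices -/

variable {L : ℕ}

theorem continuous_trigPoly (c : Fin (L + 1) × Fin T → ℂ) (p : Fin T) :
    Continuous fun x => trigPoly c x p := by
  unfold trigPoly
  fun_prop

theorem integrable_character (k : ℤ) : Integrable (character k) freq := by
  simpa using integrable_character_mul (k := k) (integrable_const (1 : ℂ) (μ := freq))

theorem integrable_trigPoly (c : Fin (L + 1) × Fin T → ℂ) (p : Fin T) :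
    Integrable (fun x => trigPoly c x p) freq := by
  unfold trigPoly
  exact integrable_finsetSum _ fun k _ => (integrable_character _).const_mul _

theorem integral_character_mul_trigPoly (c : Fin (L + 1) × Fin T → ℂ) (j : Fin (L + 1))
    (p : Fin T) :
    ∫ x, character (-(j : ℕ)) x * trigPoly c x p ∂freq = c (j, p) := by
  unfold trigPoly
  simp only [Finset.mul_sum]
  rw [integral_finsetSum _ fun k _ =>
    integrable_character_mul ((integrable_character _).const_mul _)]
  have h : ∀ k ∈ (Finset.univ : Finset (Fin (L + 1))),
      ∫ x, character (-(j : ℕ)) x * (c (k, p) * character (k : ℕ) x) ∂freq =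
        if k = j then c (k, p) else 0 := by
    intro k _
    have hx : ∀ x, character (-(j : ℕ)) x * (c (k, p) * character (k : ℕ) x) =
        c (k, p) * character (-(j : ℕ) + (k : ℕ)) x := fun x => by
      rw [character_add]; ring
    simp only [hx]
    rw [integral_const_mul, integral_character]
    have hiff : (-((j : ℕ) : ℤ) + ((k : ℕ) : ℤ) = 0) ↔ k = j := by
      rw [Fin.ext_iff]; omega
    simp [hiff]
  rw [Finset.sum_congr rfl h]
  simp

theorem integrable_trigPoly_vecMul {F : ℝ → Matrix (Fin T) (Fin T) ℂ}
    (hF : ∀ p q, Integrable (fun x => F x p q) freq) (c : Fin (L + 1) × Fin T → ℂ) (p : Fin T) :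
    Integrable (fun x => (trigPoly c x ᵥ* F x) p) freq := by
  simp only [Matrix.vecMul, dotProduct, trigPoly, Finset.sum_mul, mul_assoc]
  exact integrable_finsetSum _ fun q _ => integrable_finsetSum _ fun k _ =>
    (integrable_character_mul (hF q p)).const_mul _

theorem integral_character_mul_vecMul {F : ℝ → Matrix (Fin T) (Fin T) ℂ}
    (hF : ∀ p q, Integrable (fun x => F x p q) freq) (c : Fin (L + 1) × Fin T → ℂ)
    (j : Fin (L + 1)) (p : Fin T) :
    ∫ x, character (-(j : ℕ)) x * (trigPoly c x ᵥ* F x) p ∂freq =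
      (blockToeplitz L F *ᵥ c) (j, p) := by
  have hx : ∀ x, character (-(j : ℕ)) x * (trigPoly c x ᵥ* F x) p =
      ∑ q, ∑ k : Fin (L + 1),
        (character ((k : ℕ) - (j : ℕ)) x * F x q p) * c (k, q) := by
    intro x
    simp only [Matrix.vecMul, dotProduct, trigPoly, Finset.sum_mul, Finset.mul_sum]
    refine Finset.sum_congr rfl fun q _ => Finset.sum_congr rfl fun k _ => ?_
    rw [sub_eq_add_neg, character_add]
    ring
  simp only [hx]
  rw [integral_finsetSum _ fun q _ => integrable_finsetSum _ fun k _ =>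
    (integrable_character_mul (hF q p)).mul_const _]
  rw [Matrix.mulVec, dotProduct, Fintype.sum_prod_type_right]
  refine Finset.sum_congr rfl fun q _ => ?_
  rw [integral_finsetSum _ fun k _ => (integrable_character_mul (hF q p)).mul_const _]
  refine Finset.sum_congr rfl fun k _ => ?_
  rw [integral_mul_const]
  rfl

theorem dotProduct_star_trigPoly (u : Fin T → ℂ) (c : Fin (L + 1) × Fin T → ℂ) (x : ℝ) :
    u ⬝ᵥ star (trigPoly c x) =
      ∑ j : Fin (L + 1), ∑ p, (character (-(j : ℕ)) x * u p) * star (c (j, p)) := by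
  rw [Finset.sum_comm]
  simp only [dotProduct, Pi.star_apply, trigPoly, star_sum, star_mul', star_character,
    Finset.mul_sum]
  exact Finset.sum_congr rfl fun p _ => Finset.sum_congr rfl fun j _ => by ring

theorem integrable_trigPoly_form {F : ℝ → Matrix (Fin T) (Fin T) ℂ}
    (hF : ∀ p q, Integrable (fun x => F x p q) freq) (c : Fin (L + 1) × Fin T → ℂ) :
    Integrable (fun x => (trigPoly c x ᵥ* F x) ⬝ᵥ star (trigPoly c x)) freq := by
  simp only [dotProduct_star_trigPoly]
  exact integrable_finsetSum _ fun j _ => integrable_finsetSum _ fun p _ =>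
    (integrable_character_mul (integrable_trigPoly_vecMul hF c p)).mul_const _

/-- The quadratic form of a block Toeplitz matrix. -/
theorem integral_trigPoly_form {F : ℝ → Matrix (Fin T) (Fin T) ℂ}
    (hF : ∀ p q, Integrable (fun x => F x p q) freq) (c : Fin (L + 1) × Fin T → ℂ) :
    ∫ x, (trigPoly c x ᵥ* F x) ⬝ᵥ star (trigPoly c x) ∂freq =
      (blockToeplitz L F *ᵥ c) ⬝ᵥ star c := by
  simp only [dotProduct_star_trigPoly]
  rw [integral_finsetSum _ fun j _ => integrable_finsetSum _ fun p _ =>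
    (integrable_character_mul (integrable_trigPoly_vecMul hF c p)).mul_const _]
  rw [dotProduct, Fintype.sum_prod_type]
  refine Finset.sum_congr rfl fun j _ => ?_
  rw [integral_finsetSum _ fun p _ =>
    (integrable_character_mul (integrable_trigPoly_vecMul hF c p)).mul_const _]
  refine Finset.sum_congr rfl fun p _ => ?_
  rw [integral_mul_const, integral_character_mul_vecMul hF]
  rfl

/-- A block Toeplitz matrix with an almost everywhere positive definite symbol is invertible. -/
theorem isUnit_blockToeplitz {F : ℝ → Matrix (Fin T) (Fin T) ℂ}
    (hF : ∀ p q, Integrable (fun x => F x p q) freq) (hpos : ∀ᵐ x ∂freq, (F x).PosDef) :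
    IsUnit (blockToeplitz L F) := by
  refine Matrix.mulVec_injective_iff_isUnit.1 ?_
  rw [← Matrix.coe_mulVecLin, ← LinearMap.ker_eq_bot]
  refine Matrix.ker_mulVecLin_eq_bot_iff.2 fun c hc => ?_
  have h0 := integral_trigPoly_form hF c
  rw [hc, zero_dotProduct] at h0
  have hint := integrable_trigPoly_form hF c
  have hre : ∫ x, ((trigPoly c x ᵥ* F x) ⬝ᵥ star (trigPoly c x)).re ∂freq = 0 := by
    have h1 : ∫ x, ((trigPoly c x ᵥ* F x) ⬝ᵥ star (trigPoly c x)).re ∂freq =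
        (∫ x, (trigPoly c x ᵥ* F x) ⬝ᵥ star (trigPoly c x) ∂freq).re := integral_re hint
    rw [h1, h0, Complex.zero_re]
  have hnn : 0 ≤ᵐ[freq] fun x => ((trigPoly c x ᵥ* F x) ⬝ᵥ star (trigPoly c x)).re := by
    filter_upwards [hpos] with x hx
    exact (Complex.le_def.1 (vecMul_dotProduct_star_nonneg hx.posSemidef _)).1
  -- A kernel vector makes the integral of a nonnegative form vanish; definiteness then kills the
  -- polynomial almost everywhere, and with it all coefficients.
  have hz : ∀ᵐ x ∂freq, trigPoly c x = 0 := by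
    filter_upwards [(integral_eq_zero_iff_of_nonneg_ae hnn hint.re).1 hre, hpos] with x h1 h2
    by_contra hne
    exact (Complex.lt_def.1 (vecMul_dotProduct_star_pos h2 hne)).1.ne' h1
  ext ⟨j, p⟩
  rw [← integral_character_mul_trigPoly c j p, Pi.zero_apply]
  refine integral_eq_zero_of_ae ?_
  filter_upwards [hz] with x hx
  simp [hx]

/-! ### The weight -/

theorem norm_one_sub_character_pow (n : ℕ) (k : ℤ) (x : ℝ) :
    ((‖1 - character k x‖ : ℝ) : ℂ) ^ (2 * n) =
      (1 - character k x) ^ n * star ((1 - character k x) ^ n) := by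
  rw [pow_mul, star_pow, ← mul_pow, Complex.star_def, Complex.mul_conj, Complex.normSq_eq_norm_sq]
  push_cast
  rfl

theorem weight_eq_ofReal (n μ : ℕ) (x : ℝ) :
    weight n μ x = ((x ^ (2 * n) / ‖1 - character μ x‖ ^ (2 * n) : ℝ) : ℂ) := by
  unfold weight
  push_cast
  rfl

theorem weight_pos (n : ℕ) {μ : ℕ} {x : ℝ} (hx : x ≠ 0) (h : character μ x ≠ 1) :
    0 < weight n μ x := by
  rw [weight_eq_ofReal]
  have h1 : 0 < ‖1 - character μ x‖ := norm_pos_iff.2 (sub_ne_zero.2 (Ne.symm h))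
  have h2 : 0 < x ^ (2 * n) := by
    rw [pow_mul]; positivity
  exact_mod_cast div_pos h2 (pow_pos h1 _)

/-! ### The symbols of the block matrices -/

variable {n μ : ℕ} {f g : ℝ → Matrix (Fin T) (Fin T) ℂ}

theorem obsDensity_eq (n : ℕ) (f g : ℝ → Matrix (Fin T) (Fin T) ℂ) (x : ℝ) :
    obsDensity n f g x = f x + ((x ^ (2 * n) : ℝ) : ℂ) • g x := by
  unfold obsDensity
  push_cast
  rfl

theorem pow_two_mul_nonneg (n : ℕ) (x : ℝ) : 0 ≤ x ^ (2 * n) := by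
  rw [pow_mul]; positivity

theorem aemeasurable_obsDensity_inv (hf : IsDensity f) (hg : IsDensity g) (i j : Fin T) :
    AEMeasurable (fun x => (obsDensity n f g x)⁻¹ i j) freq := by
  refine aemeasurable_inv_apply (fun i j => ?_) i j
  simp only [obsDensity, Matrix.add_apply, Matrix.smul_apply, smul_eq_mul]
  exact (hf.integrable i j).aemeasurable.add
    ((by fun_prop : Measurable fun x : ℝ => (x : ℂ) ^ (2 * n)).aemeasurable.mul
      (hg.integrable i j).aemeasurable)

theorem measurable_weight (n μ : ℕ) : Measurable (weight n μ) := by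
  unfold weight
  have h : Measurable fun x : ℝ => ((‖1 - character μ x‖ : ℝ) : ℂ) :=
    (Complex.continuous_ofReal.comp
      (continuous_const.sub (continuous_character μ)).norm).measurable
  exact (by fun_prop : Measurable fun x : ℝ => (x : ℂ) ^ (2 * n)).div (h.pow_const _)

theorem ae_posDef_pSymbol (hμ : 0 < μ) (hf : IsDensity f) (hg : IsDensity g)
    (hmin : MinimalityCondition n μ f g) : ∀ᵐ x ∂freq, (pSymbol n μ f g x).PosDef := by
  filter_upwards [ae_ne_zero, ae_character_ne_one (k := (μ : ℤ)) (by exact_mod_cast hμ.ne'),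
    hf.posSemidef, hg.posSemidef, hmin.1] with x h1 h2 h3 h4 h5
  exact (posDef_add_smul h3 h4 (pow_two_mul_nonneg n x) (obsDensity_eq n f g x) h5).inv.smul
    (weight_pos n h1 h2)

/-- The minimality condition controls the trace, which dominates every entry of a positive
semidefinite matrix. -/
theorem integrable_pSymbol (hμ : 0 < μ) (hf : IsDensity f) (hg : IsDensity g)
    (hmin : MinimalityCondition n μ f g) (p q : Fin T) :
    Integrable (fun x => pSymbol n μ f g x p q) freq := by
  refine hmin.2.re.mono' ?_ ?_
  · exact ((measurable_weight n μ).aemeasurable.mul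
      (aemeasurable_obsDensity_inv hf hg p q)).aestronglyMeasurable
  · filter_upwards [ae_posDef_pSymbol hμ hf hg hmin] with x hx
    refine (norm_apply_le_trace hx.posSemidef p q).trans (le_of_eq ?_)
    rw [pSymbol, Matrix.trace_smul, smul_eq_mul]
    rfl

/-- Almost everywhere `0 ≤ f p⁻¹ g ≤ g`, so the entries are dominated by the integrable trace of
`g`. -/
theorem integrable_qSymbol (hf : IsDensity f) (hg : IsDensity g)
    (hmin : MinimalityCondition n μ f g) (p q : Fin T) :
    Integrable (fun x => qSymbol n f g x p q) freq := by
  have htr : Integrable (fun x => (g x).trace.re) freq := by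
    simp only [Matrix.trace]
    exact (integrable_finsetSum _ fun i _ => hg.integrable i i).re
  refine htr.mono' ?_ ?_
  · exact (aemeasurable_mul_apply (aemeasurable_mul_apply
      (fun i j => (hf.integrable i j).aemeasurable) (aemeasurable_obsDensity_inv hf hg))
      (fun i j => (hg.integrable i j).aemeasurable) p q).aestronglyMeasurable
  · filter_upwards [hf.posSemidef, hg.posSemidef, hmin.1] with x h3 h4 h5
    have ht := pow_two_mul_nonneg n x
    have hp := obsDensity_eq n f g x
    refine (norm_apply_le_trace (posSemidef_mul_inv_mul h3 h4 ht hp h5) p q).trans ?_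
    have h6 := (Complex.le_def.1 (posSemidef_smul_mul_inv_mul h3 h4 ht hp h5).trace_nonneg).1
    rw [mul_inv_mul_eq_sub hp h5, Matrix.trace_sub, Complex.sub_re]
    rw [Complex.zero_re] at h6
    linarith

end PerStat

namespace PerStat

variable {T : ℕ}

/-! ### Linear estimates as orthogonal projections -/

section Projection

variable {Ω : Type*} [MeasurableSpace Ω] {P : Measure Ω}

theorem integral_norm_sq_eq {F : Ω → ℂ} (u : Lp ℂ 2 P) (h : F =ᵐ[P] u) :
    ∫ ω, ‖F ω‖ ^ 2 ∂P = ‖u‖ ^ 2 := by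
  have h1 : ((‖u‖ ^ 2 : ℝ) : ℂ) = ((∫ ω, ‖F ω‖ ^ 2 ∂P : ℝ) : ℂ) := by
    have h2 : ((‖u‖ ^ 2 : ℝ) : ℂ) = inner ℂ u u := by
      rw [inner_self_eq_norm_sq_to_K]; push_cast; rfl
    rw [h2, L2.inner_def, ← integral_complex_ofReal]
    refine integral_congr_ae ?_
    filter_upwards [h] with ω hω
    rw [hω, inner_self_eq_norm_sq_to_K]
    push_cast
    rfl
  exact_mod_cast h1.symm

variable {n μ N : ℕ} {Z : ℤ → Fin T → Ω → ℂ} {V A Y : Ω → ℂ}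

theorem mse_eq_norm_sq (hAV : ∀ ω, A ω + V ω = Y ω) (hY : MemLp Y 2 P) {E : Ω → ℂ} {u : Lp ℂ 2 P}
    (hE : E =ᵐ[P] fun ω => u ω - V ω) : mse P A E = ‖hY.toLp Y - u‖ ^ 2 := by
  refine integral_norm_sq_eq _ ?_
  filter_upwards [hE, Lp.coeFn_sub (hY.toLp Y) u, hY.coeFn_toLp] with ω h1 h2 h3
  rw [h1, h2, Pi.sub_apply, h3, ← hAV]
  ring

/-- The estimates of the least mean square error are given by the orthogonal projection. -/
theorem isOptimalEstimate_iff (hAV : ∀ ω, A ω + V ω = Y ω) (hY : MemLp Y 2 P) {u : Lp ℂ 2 P}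
    (hu : u ∈ observedIncrements P n μ N Z)
    (horth : ∀ v ∈ observedIncrements P n μ N Z, inner ℂ v (hY.toLp Y - u) = 0) (E : Ω → ℂ) :
    IsOptimalEstimate P n μ N Z V A E ↔ (fun ω => E ω + V ω) =ᵐ[P] u := by
  -- Pythagoras: the excess of the error of `v` over that of `u` is exactly `‖u - v‖²`, which gives
  -- optimality and uniqueness together.
  have hpyth : ∀ v ∈ observedIncrements P n μ N Z,
      ‖hY.toLp Y - v‖ ^ 2 = ‖hY.toLp Y - u‖ ^ 2 + ‖u - v‖ ^ 2 := by
    intro v hv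
    have h0 := horth _ (Submodule.sub_mem _ hu hv)
    have h1 := norm_add_sq_eq_norm_sq_add_norm_sq_of_inner_eq_zero (𝕜 := ℂ) _ _ h0
    rw [sq, sq, sq, add_comm (‖hY.toLp Y - u‖ * _), ← h1]
    congr 2 <;> abel
  have huest : IsLinearEstimate P n μ N Z V fun ω => u ω - V ω := ⟨u, hu, Filter.EventuallyEq.rfl⟩
  constructor
  · rintro ⟨⟨v, hv, hE⟩, hmin⟩
    have h1 := hmin _ huest
    rw [mse_eq_norm_sq hAV hY hE, mse_eq_norm_sq (u := u) hAV hY Filter.EventuallyEq.rfl,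
      hpyth v hv] at h1
    have h2 : ‖u - v‖ = 0 := by nlinarith [norm_nonneg (u - v)]
    rw [sub_eq_zero.1 (norm_eq_zero.1 h2)]
    filter_upwards [hE] with ω hω
    rw [hω, sub_add_cancel]
  · intro hE
    have hE' : E =ᵐ[P] fun ω => u ω - V ω := by
      filter_upwards [hE] with ω hω
      rw [← hω, add_sub_cancel_right]
    refine ⟨⟨u, hu, hE'⟩, ?_⟩
    rintro E' ⟨v, hv, hv'⟩
    rw [mse_eq_norm_sq hAV hY hE', mse_eq_norm_sq hAV hY hv', hpyth v hv]
    nlinarith [sq_nonneg ‖u - v‖]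

end Projection

/-! ### The spectral characteristic and the error -/

section Error

variable {n μ N : ℕ} {f g : ℝ → Matrix (Fin T) (Fin T) ℂ} {a : ℕ → Fin T → ℂ}

theorem I_mul_pow_mul_neg_pow (n : ℕ) (x : ℝ) :
    (Complex.I * (x : ℂ)) ^ n * (-(Complex.I * (x : ℂ))) ^ n = (x : ℂ) ^ (2 * n) := by
  rw [← mul_pow, pow_mul]
  congr 1
  linear_combination (-(x : ℂ) ^ 2) * Complex.I_sq

theorem star_I_mul_pow (n : ℕ) (x : ℝ) :
    star ((Complex.I * (x : ℂ)) ^ n) = (-(Complex.I * (x : ℂ))) ^ n := by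
  rw [star_pow]; simp

theorem star_incFactor (n : ℕ) (s : ℤ) (x : ℝ) :
    star (incFactor n s x) = (1 - character s x) ^ n / (-(Complex.I * (x : ℂ))) ^ n := by
  unfold incFactor
  rw [star_div₀, star_I_mul_pow, star_pow, star_sub, star_one, star_character, neg_neg]

theorem incFactor_mul_weight {x : ℝ} (hx : x ≠ 0) (hs : character μ x ≠ 1) :
    incFactor n μ x * weight n μ x = (-(Complex.I * (x : ℂ))) ^ n / (1 - character μ x) ^ n := by
  have hs0 : (1 - character μ x) ^ n ≠ 0 := pow_ne_zero _ (sub_ne_zero.2 (Ne.symm hs))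
  have hIx : (Complex.I * (x : ℂ)) ^ n ≠ 0 :=
    pow_ne_zero _ (mul_ne_zero Complex.I_ne_zero (by exact_mod_cast hx))
  have hs1 : star ((1 - character μ x) ^ n) ≠ 0 := star_ne_zero.2 hs0
  have hs2 : (1 - character (-μ) x) ^ n = star ((1 - character μ x) ^ n) := by simp
  unfold incFactor weight
  rw [norm_one_sub_character_pow, hs2, ← I_mul_pow_mul_neg_pow]
  field_simp

/-- The row `(-iλ)^n (1 - e^{iλμ})^{-n} r₁ p⁻¹`. -/
noncomputable def errorPart₁ (n μ N : ℕ) (f g : ℝ → Matrix (Fin T) (Fin T) ℂ)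
    (a : ℕ → Fin T → ℂ) (x : ℝ) : Fin T → ℂ :=
  ((-(Complex.I * (x : ℂ))) ^ n / (1 - character μ x) ^ n) •
    (errorRow₁ n μ N f g a x ᵥ* (obsDensity n f g x)⁻¹)

/-- The row `λ^{2n} (1 - e^{iλμ})^{-n} r₁ p⁻¹ - A`. -/
noncomputable def errorPart₂ (n μ N : ℕ) (f g : ℝ → Matrix (Fin T) (Fin T) ℂ)
    (a : ℕ → Fin T → ℂ) (x : ℝ) : Fin T → ℂ :=
  (Complex.I * (x : ℂ)) ^ n • errorPart₁ n μ N f g a x - trigPoly (stack N a) x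

/-- The first summand is the row of the observed part of the target, so what is subtracted is the
first half of the error row. -/
theorem spectralChar_eq {x : ℝ} (hs : character μ x ≠ 1) :
    spectralChar n μ N f g a x =
      incFactor n μ x • trigPoly (stack N (bCoeff n μ N a)) x - errorPart₁ n μ N f g a x := by
  have hs0 : (1 - character μ x) ^ n ≠ 0 := pow_ne_zero _ (sub_ne_zero.2 (Ne.symm hs))
  unfold spectralChar errorPart₁ errorRow₁
  rw [Matrix.add_vecMul, Matrix.smul_vecMul, smul_add, smul_smul, div_mul_cancel₀ _ hs0,
    Matrix.vecMul_vecMul, sub_sub]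

/-- Write `A = A p p⁻¹` and `p = f + λ^{2n} g`: the `g` terms cancel against `λ^{2n} r₁`, leaving
`-r₂`. -/
theorem errorPart₂_eq {x : ℝ} (hs : character μ x ≠ 1)
    (hu : IsUnit (obsDensity n f g x)) :
    errorPart₂ n μ N f g a x =
      (-(1 / (1 - character μ x) ^ n)) •
        (errorRow₂ n μ N f g a x ᵥ* (obsDensity n f g x)⁻¹) := by
  have hs0 : (1 - character μ x) ^ n ≠ 0 := pow_ne_zero _ (sub_ne_zero.2 (Ne.symm hs))
  have h1 : obsDensity n f g x * (obsDensity n f g x)⁻¹ = 1 :=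
    Matrix.mul_nonsing_inv _ ((Matrix.isUnit_iff_isUnit_det _).1 hu)
  have hA : trigPoly (stack N a) x =
      (1 / (1 - character μ x) ^ n) • (((1 - character μ x) ^ n •
        (trigPoly (stack N a) x ᵥ* obsDensity n f g x)) ᵥ* (obsDensity n f g x)⁻¹) := by
    rw [Matrix.smul_vecMul, Matrix.vecMul_vecMul, h1, Matrix.vecMul_one, smul_smul,
      one_div_mul_cancel hs0, one_smul]
  unfold errorPart₂ errorPart₁
  rw [smul_smul, mul_div_assoc', I_mul_pow_mul_neg_pow, div_eq_mul_one_div, mul_comm, ← smul_smul,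
    ← Matrix.smul_vecMul]
  conv_lhs => rw [hA]
  rw [neg_smul, ← smul_neg, ← smul_sub, ← Matrix.sub_vecMul, ← Matrix.neg_vecMul]
  congr 2
  unfold errorRow₁ errorRow₂ obsDensity
  rw [Matrix.vecMul_add, Matrix.vecMul_smul, smul_add, smul_add, smul_smul, smul_smul, mul_comm]
  abel

/-- The weight is the squared modulus of the scalar factor of `errorPart₁`. The density is thus the
contribution of the signal to the error; the next lemma treats that of the noise. -/
theorem errorDensity₁_eq {x : ℝ} (hp : (obsDensity n f g x).PosDef) :
    errorDensity₁ n μ N f g a x =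
      (errorPart₁ n μ N f g a x ᵥ* f x) ⬝ᵥ star (errorPart₁ n μ N f g a x) := by
  unfold errorPart₁ errorDensity₁ weight
  rw [Matrix.smul_vecMul, star_smul, dotProduct_smul, smul_dotProduct, smul_smul,
    Matrix.vecMul_vecMul, vecMul_dotProduct_star_vecMul hp.inv.1, smul_eq_mul,
    norm_one_sub_character_pow, ← I_mul_pow_mul_neg_pow, star_div₀, ← star_I_mul_pow, star_star,
    mul_assoc]
  congr 1
  rw [div_mul_div_comm, mul_comm (star ((1 - character μ x) ^ n))]

theorem errorDensity₂_eq {x : ℝ} (hs : character μ x ≠ 1)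
    (hp : (obsDensity n f g x).PosDef) :
    errorDensity₂ n μ N f g a x =
      (errorPart₂ n μ N f g a x ᵥ* g x) ⬝ᵥ star (errorPart₂ n μ N f g a x) := by
  rw [errorPart₂_eq hs hp.isUnit]
  unfold errorDensity₂
  rw [Matrix.smul_vecMul, star_smul, dotProduct_smul, smul_dotProduct, smul_smul,
    Matrix.vecMul_vecMul, vecMul_dotProduct_star_vecMul hp.inv.1, smul_eq_mul,
    norm_one_sub_character_pow, mul_assoc]
  congr 1
  rw [star_neg, star_div₀, star_one]
  field_simp

theorem errorDensity_add_eq {x : ℝ} (hs : character μ x ≠ 1) (hf : (f x).PosSemidef)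
    (hg : (g x).PosSemidef) (hu : IsUnit (obsDensity n f g x)) :
    errorDensity₁ n μ N f g a x + errorDensity₂ n μ N f g a x =
      (trigPoly (stack N a) x ᵥ* qSymbol n f g x) ⬝ᵥ star (trigPoly (stack N a) x) +
      (trigPoly (cVector n μ N f g a) x ᵥ* pSymbol n μ f g x) ⬝ᵥ
        star (trigPoly (cVector n μ N f g a) x) := by
  have hs0 : (1 - character μ x) ^ n ≠ 0 := pow_ne_zero _ (sub_ne_zero.2 (Ne.symm hs))
  have hs1 : star ((1 - character μ x) ^ n) ≠ 0 := star_ne_zero.2 hs0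
  have h := error_form_eq hf hg (obsDensity_eq n f g x) hu (trigPoly (stack N a) x)
    (trigPoly (cVector n μ N f g a) x) ((1 - character μ x) ^ n)
  have hx : ((x ^ (2 * n) : ℝ) : ℂ) = (x : ℂ) ^ (2 * n) := by push_cast; rfl
  rw [hx] at h
  change (x : ℂ) ^ (2 * n) * ((errorRow₁ n μ N f g a x ᵥ* _) ⬝ᵥ star (errorRow₁ n μ N f g a x)) +
    (errorRow₂ n μ N f g a x ᵥ* _) ⬝ᵥ star (errorRow₂ n μ N f g a x) = _ at h
  unfold errorDensity₁ errorDensity₂ pSymbol qSymbol weight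
  rw [Matrix.vecMul_smul, smul_dotProduct, smul_eq_mul, norm_one_sub_character_pow]
  field_simp
  linear_combination h

end Error

end PerStat

namespace PerStat

variable {T n μ N : ℕ} {f g : ℝ → Matrix (Fin T) (Fin T) ℂ} {a : ℕ → Fin T → ℂ}

/-! ### Integrability of the error densities -/

/-- Off this null set, all pointwise identities may divide by `λ`, by `1 - e^{iλμ}` and by `p`. -/
theorem ae_regular (hμ : 0 < μ) (hf : IsDensity f) (hg : IsDensity g)
    (hmin : MinimalityCondition n μ f g) :
    ∀ᵐ x ∂freq, x ≠ 0 ∧ character μ x ≠ 1 ∧ (f x).PosSemidef ∧ (g x).PosSemidef ∧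
      (obsDensity n f g x).PosDef := by
  filter_upwards [ae_ne_zero, ae_character_ne_one (k := (μ : ℤ)) (by exact_mod_cast hμ.ne'),
    hf.posSemidef, hg.posSemidef, hmin.1] with x h1 h2 h3 h4 h5
  exact ⟨h1, h2, h3, h4,
    posDef_add_smul h3 h4 (pow_two_mul_nonneg n x) (obsDensity_eq n f g x) h5⟩

theorem aemeasurable_errorPart₁ (hf : IsDensity f) (hg : IsDensity g) (p : Fin T) :
    AEMeasurable (fun x => errorPart₁ n μ N f g a x p) freq := by
  have hrow : ∀ q, AEMeasurable (fun x => errorRow₁ n μ N f g a x q) freq := by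
    intro q
    have h1 : Measurable fun x => (1 - character μ x) ^ n :=
      ((continuous_const.sub (continuous_character _)).pow n).measurable
    exact (h1.aemeasurable.mul (aemeasurable_vecMul_apply
      (fun i => (continuous_trigPoly _ i).measurable.aemeasurable)
      (fun i j => (hg.integrable i j).aemeasurable) q)).add
      (continuous_trigPoly _ q).measurable.aemeasurable
  have h2 : Measurable fun x : ℝ => (-(Complex.I * (x : ℂ))) ^ n / (1 - character μ x) ^ n :=
    (by fun_prop : Measurable fun x : ℝ => (-(Complex.I * (x : ℂ))) ^ n).div
      ((continuous_const.sub (continuous_character _)).pow n).measurable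
  exact h2.aemeasurable.mul
    (aemeasurable_vecMul_apply hrow (aemeasurable_obsDensity_inv hf hg) p)

theorem aemeasurable_errorPart₂ (hf : IsDensity f) (hg : IsDensity g) (p : Fin T) :
    AEMeasurable (fun x => errorPart₂ n μ N f g a x p) freq :=
  ((by fun_prop : Measurable fun x : ℝ => (Complex.I * (x : ℂ)) ^ n).aemeasurable.mul
    (aemeasurable_errorPart₁ hf hg p)).sub (continuous_trigPoly _ p).measurable.aemeasurable

theorem integrable_errorDensity_add (hμ : 0 < μ) (hf : IsDensity f) (hg : IsDensity g)
    (hmin : MinimalityCondition n μ f g) :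
    Integrable (fun x => errorDensity₁ n μ N f g a x + errorDensity₂ n μ N f g a x) freq := by
  refine ((integrable_trigPoly_form (integrable_qSymbol hf hg hmin) (stack N a)).add
    (integrable_trigPoly_form (integrable_pSymbol hμ hf hg hmin) (cVector n μ N f g a))).congr ?_
  filter_upwards [ae_regular hμ hf hg hmin] with x ⟨_, h2, h3, h4, h5⟩
  exact (errorDensity_add_eq h2 h3 h4 h5.isUnit).symm

theorem integral_errorDensity_add (hμ : 0 < μ) (hf : IsDensity f) (hg : IsDensity g)
    (hmin : MinimalityCondition n μ f g) :
    ∫ x, (errorDensity₁ n μ N f g a x + errorDensity₂ n μ N f g a x) ∂freq =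
      errorForm n μ N f g a := by
  have hq := integrable_qSymbol hf hg hmin
  have hp := integrable_pSymbol hμ hf hg hmin
  have hae : (fun x => errorDensity₁ n μ N f g a x + errorDensity₂ n μ N f g a x) =ᵐ[freq] fun x =>
      (trigPoly (stack N a) x ᵥ* qSymbol n f g x) ⬝ᵥ star (trigPoly (stack N a) x) +
      (trigPoly (cVector n μ N f g a) x ᵥ* pSymbol n μ f g x) ⬝ᵥ
        star (trigPoly (cVector n μ N f g a) x) := by
    filter_upwards [ae_regular hμ hf hg hmin] with x ⟨_, h2, h3, h4, h5⟩
    exact errorDensity_add_eq h2 h3 h4 h5.isUnit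
  have hunit : IsUnit (pMatrix n μ N f g) :=
    isUnit_blockToeplitz hp (ae_posDef_pSymbol hμ hf hg hmin)
  have hc : pMatrix n μ N f g *ᵥ cVector n μ N f g a = rhsVector n μ N f g a := by
    unfold cVector
    rw [Matrix.mulVec_mulVec, Matrix.mul_nonsing_inv _ ((Matrix.isUnit_iff_isUnit_det _).1 hunit),
      Matrix.one_mulVec]
  rw [integral_congr_ae hae, integral_add (integrable_trigPoly_form hq _)
    (integrable_trigPoly_form hp _), integral_trigPoly_form hq, integral_trigPoly_form hp]
  unfold errorForm
  rw [← hc, add_comm]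
  rfl

/-- The algebra gives integrability of the sum of the error densities only; nonnegativity passes it
on to each of them. -/
theorem integrable_of_add_nonneg {F H : ℝ → ℂ} (hF : AEMeasurable F freq)
    (hF0 : ∀ᵐ x ∂freq, 0 ≤ F x) (hH0 : ∀ᵐ x ∂freq, 0 ≤ H x)
    (h : Integrable (fun x => F x + H x) freq) : Integrable F freq := by
  refine h.norm.mono' hF.aestronglyMeasurable ?_
  filter_upwards [hF0, hH0] with x h1 h2
  have h3 : ((‖F x‖ : ℝ) : ℂ) ≤ ((‖F x + H x‖ : ℝ) : ℂ) := by
    rw [Complex.norm_of_nonneg' h1, Complex.norm_of_nonneg' (add_nonneg h1 h2)]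
    exact le_add_of_nonneg_right h2
  exact_mod_cast h3

theorem integrable_errorDensity₁ (hμ : 0 < μ) (hf : IsDensity f) (hg : IsDensity g)
    (hmin : MinimalityCondition n μ f g) : Integrable (errorDensity₁ n μ N f g a) freq := by
  have hreg := ae_regular hμ hf hg hmin
  have hm1 := aemeasurable_errorPart₁ (n := n) (μ := μ) (N := N) (a := a) hf hg
  refine integrable_of_add_nonneg ?_ ?_ ?_ (integrable_errorDensity_add hμ hf hg hmin)
  · refine (aemeasurable_dotProduct_star (aemeasurable_vecMul_apply hm1
      fun i j => (hf.integrable i j).aemeasurable) hm1).congr ?_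
    filter_upwards [hreg] with x ⟨_, _, _, _, h5⟩
    exact (errorDensity₁_eq h5).symm
  · filter_upwards [hreg] with x ⟨_, _, h3, _, h5⟩
    rw [errorDensity₁_eq h5]
    exact vecMul_dotProduct_star_nonneg h3 _
  · filter_upwards [hreg] with x ⟨_, h2, _, h4, h5⟩
    rw [errorDensity₂_eq h2 h5]
    exact vecMul_dotProduct_star_nonneg h4 _

theorem integrable_errorDensity₂ (hμ : 0 < μ) (hf : IsDensity f) (hg : IsDensity g)
    (hmin : MinimalityCondition n μ f g) : Integrable (errorDensity₂ n μ N f g a) freq := by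
  refine ((integrable_errorDensity_add (N := N) (a := a) hμ hf hg hmin).sub
    (integrable_errorDensity₁ (N := N) (a := a) hμ hf hg hmin)).congr ?_
  exact Filter.Eventually.of_forall fun x => by simp

/-! ### Fourier coefficients -/

theorem integral_character_mul_trigPoly_eq_zero {L : ℕ} (c : Fin (L + 1) × Fin T → ℂ) {k : ℤ}
    (hk : k < 0 ∨ (L : ℤ) < k) (p : Fin T) :
    ∫ x, character (-k) x * trigPoly c x p ∂freq = 0 := by
  unfold trigPoly
  simp only [Finset.mul_sum]
  rw [integral_finsetSum _ fun k _ =>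
    integrable_character_mul ((integrable_character _).const_mul _)]
  refine Finset.sum_eq_zero fun j _ => ?_
  have hx : ∀ x, character (-k) x * (c (j, p) * character (j : ℕ) x) =
      c (j, p) * character (-k + (j : ℕ)) x := fun x => by
    rw [character_add]; ring
  simp only [hx]
  have hj := j.2
  rw [integral_const_mul, integral_character, if_neg (by omega), mul_zero]

/-- The quotient of the spectral characteristic by the increment factor. -/
noncomputable def charQuotient (n μ N : ℕ) (f g : ℝ → Matrix (Fin T) (Fin T) ℂ)
    (a : ℕ → Fin T → ℂ) (x : ℝ) : Fin T → ℂ :=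
  trigPoly (stack (N + μ * n) (bCoeff n μ N a)) x
    - trigPoly (stack (N + μ * n) (aMuCoeff n μ N a)) x ᵥ* tSymbol n μ f g x
    - trigPoly (cVector n μ N f g a) x ᵥ* pSymbol n μ f g x

theorem trigPoly_bCoeff (n μ N : ℕ) (a : ℕ → Fin T → ℂ) (x : ℝ) :
    trigPoly (stack (N + μ * n) (bCoeff n μ N a)) x = trigPoly (stack N (bCoeff n μ N a)) x := by
  ext p
  rw [trigPoly_stack, trigPoly_stack]
  symm
  refine Finset.sum_subset (Finset.range_mono (by omega)) fun k _ hk => ?_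
  rw [Finset.mem_range] at hk
  rw [bCoeff_eq_zero a (by omega), zero_mul]

/-- The factor `χ` times the weight is `(-iλ)^n / (1 - e^{iλμ})^n`; in the term with `A` the
denominator is absorbed by passing from `a` to `a_μ`. -/
theorem spectralChar_eq_smul (hμ : 0 < μ) {x : ℝ} (hx : x ≠ 0) (hs : character μ x ≠ 1) :
    spectralChar n μ N f g a x = incFactor n μ x • charQuotient n μ N f g a x := by
  have hs0 : (1 - character μ x) ^ n ≠ 0 := pow_ne_zero _ (sub_ne_zero.2 (Ne.symm hs))
  unfold spectralChar charQuotient tSymbol pSymbol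
  rw [trigPoly_bCoeff, trigPoly_aMuCoeff hμ, smul_sub, smul_sub, Matrix.vecMul_smul,
    Matrix.vecMul_smul, smul_smul, smul_smul, incFactor_mul_weight hx hs, Matrix.smul_vecMul,
    smul_smul, div_mul_cancel₀ _ hs0]

theorem integrable_charQuotient (hμ : 0 < μ) (hf : IsDensity f) (hg : IsDensity g)
    (hmin : MinimalityCondition n μ f g)
    (ht : ∀ p q, Integrable (fun x => tSymbol n μ f g x p q) freq) (p : Fin T) :
    Integrable (fun x => charQuotient n μ N f g a x p) freq :=
  ((integrable_trigPoly _ p).sub (integrable_trigPoly_vecMul ht _ p)).sub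
    (integrable_trigPoly_vecMul (integrable_pSymbol hμ hf hg hmin) _ p)

/-- At the index `j` of the gap, the coefficient is the block `j` of `b - T a_μ - P c`; the vector
`c` is defined so that this vanishes. -/
theorem integral_character_mul_charQuotient (hμ : 0 < μ) (hf : IsDensity f) (hg : IsDensity g)
    (hmin : MinimalityCondition n μ f g)
    (ht : ∀ p q, Integrable (fun x => tSymbol n μ f g x p q) freq) {k : ℤ}
    (hk : k ∈ Finset.Icc (0 : ℤ) (N + μ * n)) (p : Fin T) :
    ∫ x, character (-k) x * charQuotient n μ N f g a x p ∂freq = 0 := by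
  have hp := integrable_pSymbol hμ hf hg hmin
  rw [Finset.mem_Icc] at hk
  obtain ⟨j, rfl⟩ : ∃ j : Fin (N + μ * n + 1), k = ((j : ℕ) : ℤ) := by
    refine ⟨⟨k.toNat, ?_⟩, by simp [hk.1]⟩
    have h2 : k ≤ ((N + μ * n : ℕ) : ℤ) := by push_cast; exact hk.2
    omega
  have hunit : IsUnit (pMatrix n μ N f g) :=
    isUnit_blockToeplitz hp (ae_posDef_pSymbol hμ hf hg hmin)
  have hc : pMatrix n μ N f g *ᵥ cVector n μ N f g a = rhsVector n μ N f g a := by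
    unfold cVector
    rw [Matrix.mulVec_mulVec, Matrix.mul_nonsing_inv _ ((Matrix.isUnit_iff_isUnit_det _).1 hunit),
      Matrix.one_mulVec]
  simp only [charQuotient, Pi.sub_apply, mul_sub]
  rw [integral_sub, integral_sub, integral_character_mul_trigPoly,
    integral_character_mul_vecMul ht, integral_character_mul_vecMul hp]
  · change _ - _ - (pMatrix n μ N f g *ᵥ cVector n μ N f g a) (j, p) = 0
    rw [hc]
    simp [rhsVector]
  · exact integrable_character_mul (integrable_trigPoly _ p)
  · exact integrable_character_mul (integrable_trigPoly_vecMul ht _ p)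
  · exact (integrable_character_mul (integrable_trigPoly _ p)).sub
      (integrable_character_mul (integrable_trigPoly_vecMul ht _ p))
  · exact integrable_character_mul (integrable_trigPoly_vecMul hp _ p)

/-- The error row is orthogonal to the rows of the increments, up to the coefficients of `C`. -/
theorem errorPart_form_incRow {x : ℝ} (hx : x ≠ 0) (hs : character μ x ≠ 1)
    (hp : IsUnit (obsDensity n f g x)) (k : ℤ) (p : Fin T) :
    (Sum.elim (errorPart₁ n μ N f g a x) (errorPart₂ n μ N f g a x) ᵥ* jointDensity f g x) ⬝ᵥ
      star (obsRow n (incRow n (k, μ, p)) x) =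
    character (-k) x * trigPoly (cVector n μ N f g a) x p := by
  have hs0 : (1 - character μ x) ^ n ≠ 0 := pow_ne_zero _ (sub_ne_zero.2 (Ne.symm hs))
  have hIx : (-(Complex.I * (x : ℂ))) ^ n ≠ 0 :=
    pow_ne_zero _ (neg_ne_zero.2 (mul_ne_zero Complex.I_ne_zero (by exact_mod_cast hx)))
  have hinv : (obsDensity n f g x)⁻¹ * obsDensity n f g x = 1 :=
    Matrix.nonsing_inv_mul _ ((Matrix.isUnit_iff_isUnit_det _).1 hp)
  have h1 : errorPart₁ n μ N f g a x ᵥ* obsDensity n f g x =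
      ((-(Complex.I * (x : ℂ))) ^ n / (1 - character μ x) ^ n) • errorRow₁ n μ N f g a x := by
    unfold errorPart₁
    rw [Matrix.smul_vecMul, Matrix.vecMul_vecMul, hinv, Matrix.vecMul_one]
  -- The factor `(-iλ)^n` is the conjugate of the one in `obsRow`. The terms with `f` and `g`
  -- combine into `E₁ p`, and the part `A g` of `r₁` cancels, so only `C` remains.
  have h2 : errorPart₁ n μ N f g a x ᵥ* f x +
      (-(Complex.I * (x : ℂ))) ^ n • (errorPart₂ n μ N f g a x ᵥ* g x) =
      ((-(Complex.I * (x : ℂ))) ^ n / (1 - character μ x) ^ n) •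
        trigPoly (cVector n μ N f g a) x := by
    have h3 : errorPart₁ n μ N f g a x ᵥ* f x +
        (-(Complex.I * (x : ℂ))) ^ n • (errorPart₂ n μ N f g a x ᵥ* g x) =
        errorPart₁ n μ N f g a x ᵥ* obsDensity n f g x -
          (-(Complex.I * (x : ℂ))) ^ n • (trigPoly (stack N a) x ᵥ* g x) := by
      unfold errorPart₂ obsDensity
      rw [Matrix.sub_vecMul, Matrix.smul_vecMul, smul_sub, smul_smul, mul_comm,
        I_mul_pow_mul_neg_pow, Matrix.vecMul_add, Matrix.vecMul_smul, add_sub_assoc]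
    rw [h3, h1]
    unfold errorRow₁
    rw [smul_add, smul_smul, div_mul_cancel₀ _ hs0]
    abel
  unfold obsRow
  rw [jointDensity_form, star_smul, dotProduct_smul, star_I_mul_pow, ← smul_dotProduct,
    ← add_dotProduct, h2]
  have hstar : star (incRow n (k, (μ : ℤ), p) x) =
      Pi.single p (character (-k) x * star (incFactor n μ x)) := by
    ext q
    rcases eq_or_ne q p with rfl | hq
    · simp [incRow]
    · simp [incRow, hq]
  rw [hstar, dotProduct_single, star_incFactor, Pi.smul_apply, smul_eq_mul]
  field_simp

end PerStat

/-! ### The target and its projection -/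

namespace PerStat

variable {T n μ N : ℕ} {f g : ℝ → Matrix (Fin T) (Fin T) ℂ} {a : ℕ → Fin T → ℂ}

theorem rowModel_sub {ι : Type*} [Fintype ι] (R : ℝ → Matrix ι ι ℂ) (v w : ℝ → ι → ℂ) :
    rowModel R (v - w) = rowModel R v - rowModel R w := by
  ext x : 1
  simp [rowModel, Matrix.sub_vecMul]

/-- The functional of the increments of the observed sequence minus the functional of the noise. -/
noncomputable def target {Ω : Type*} (n μ N : ℕ) (a : ℕ → Fin T → ℂ) (ζ η : ℤ → Fin T → Ω → ℂ)
    (ω : Ω) : ℂ :=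
  ∑ k ∈ Finset.range (N + 1), ∑ p, bCoeff n μ N a k p * vecIncrement n μ ζ k p ω -
    ∑ m ∈ Finset.range (N + 1), ∑ p, a m p * η m p ω

/-- Apply the summation by parts to `ζ` and use `ϑ = ζ - η`. The right side is square integrable
even when `A` and `V` separately are not. -/
theorem scalarFunctional_add_initialValues {Ω : Type*} {M : ℕ} (hT : 0 < T) (hμ : 0 < μ)
    (α : ℕ → ℂ) (θ η : ℤ → Ω → ℂ) (ω : Ω) :
    scalarFunctional M α θ ω + initialValues n μ (M / T) (blockCoeff T M α)
        (block T fun m => θ m + η m) ω =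
      target n μ (M / T) (blockCoeff T M α) (block T fun m => θ m + η m) (block T η) ω := by
  unfold target
  rw [← sum_add_initialValues hμ, scalarFunctional_eq hT, eq_sub_iff_add_eq, add_right_comm,
    ← Finset.sum_add_distrib]
  congr 1
  refine Finset.sum_congr rfl fun m _ => ?_
  rw [← Finset.sum_add_distrib]
  refine Finset.sum_congr rfl fun p _ => ?_
  simp [block, mul_add]

/-- The row function of the target. -/
noncomputable def targetRow (n μ N : ℕ) (a : ℕ → Fin T → ℂ) (x : ℝ) : Fin T ⊕ Fin T → ℂ :=
  obsRow n (fun x => incFactor n μ x • trigPoly (stack N (bCoeff n μ N a)) x) x -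
    Sum.elim (0 : Fin T → ℂ) (trigPoly (stack N a) x)

variable {Ω : Type*} [MeasurableSpace Ω] {P : Measure Ω}

namespace IsSpectralIsometry

variable {ζ η : ℤ → Fin T → Ω → ℂ} {R : ℝ → Matrix (Fin T ⊕ Fin T) (Fin T ⊕ Fin T) ℂ}
  {G : Submodule ℂ (Lp ℂ 2 P × Lp (EuclideanSpace ℂ (Fin T ⊕ Fin T)) 2 freq)}

theorem corr_target (hI : IsSpectralIsometry n ζ η f g R G) (μ N : ℕ) (a : ℕ → Fin T → ℂ) :
    Corr R G (target n μ N a ζ η) (targetRow n μ N a) := by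
  have h1 := Corr.sum (Finset.range (N + 1)) fun k _ => Corr.sum Finset.univ fun p _ =>
    (hI.corr_increment ((k : ℤ), (μ : ℤ), p)).const_smul (bCoeff n μ N a k p)
  have h2 := Corr.sum (Finset.range (N + 1)) fun m _ => Corr.sum Finset.univ fun p _ =>
    (hI.corr_stationary m p).const_smul (a m p)
  have hs : ∀ (c : ℕ → Fin T → ℂ) (F : ℕ → ℂ) (q : Fin T),
      ∑ k ∈ Finset.range (N + 1), ∑ p, c k p * (Pi.single p (F k) : Fin T → ℂ) q =
        ∑ k ∈ Finset.range (N + 1), c k q * F k := by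
    intro c F q
    refine Finset.sum_congr rfl fun k _ => ?_
    rw [Finset.sum_eq_single q]
    · simp
    · intro p _ hp
      simp [hp.symm]
    · simp
  refine (h1.sub h2).congr (Filter.Eventually.of_forall fun ω => ?_)
    (Filter.Eventually.of_forall fun x => ?_)
  · simp [target]
  · ext i
    cases i with
    | inl q =>
      simp only [targetRow, Pi.sub_apply, Finset.sum_apply, Pi.smul_apply, obsRow, Sum.elim_inl, incRow,
        smul_eq_mul, hs, Pi.zero_apply, mul_zero, Finset.sum_const_zero, sub_zero, trigPoly_stack,
        Finset.mul_sum]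
      exact Finset.sum_congr rfl fun k _ => by ring
    | inr q =>
      simp only [targetRow, Pi.sub_apply, Finset.sum_apply, Pi.smul_apply, obsRow, Sum.elim_inr, incRow,
        smul_eq_mul, hs, trigPoly_stack, Finset.mul_sum]
      congr 1
      simp only [mul_left_comm _ ((Complex.I * (x : ℂ)) ^ n), ← Finset.mul_sum, hs]
      congr 1
      rw [Finset.mul_sum]
      exact Finset.sum_congr rfl fun k _ => by ring

/-- The spectral characteristic represents an element of the closed span of the observed
increments, and the difference from the target has the error rows. -/
theorem exists_projection (hI : IsSpectralIsometry n ζ η f g R G) (hμ : 0 < μ) (hf : IsDensity f)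
    (hg : IsDensity g) (hmin : MinimalityCondition n μ f g)
    (ht : ∀ p q, Integrable (fun x => tSymbol n μ f g x p q) freq) :
    ∃ u ∈ observedIncrements P n μ N ζ,
      Corr R G u (obsRow n (spectralChar n μ N f g a)) ∧
      Corr R G (target n μ N a ζ η - u)
        (fun x => Sum.elim (errorPart₁ n μ N f g a x) (errorPart₂ n μ N f g a x)) := by
  have hreg := ae_regular hμ hf hg hmin
  have hY := hI.corr_target μ N a
  have hrow : ∀ᵐ x ∂freq,
      targetRow n μ N a x - obsRow n (spectralChar n μ N f g a) x =
      Sum.elim (errorPart₁ n μ N f g a x) (errorPart₂ n μ N f g a x) := by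
    filter_upwards [hreg] with x ⟨_, h2, _, _, _⟩
    have hsc := spectralChar_eq (n := n) (N := N) (f := f) (g := g) (a := a) h2
    ext i
    cases i with
    | inl q => simp [targetRow, obsRow, hsc]
    | inr q =>
      simp only [Pi.sub_apply, targetRow, obsRow, hsc, Sum.elim_inr, Pi.smul_apply, smul_eq_mul, errorPart₂]
      ring
  -- The norm of the spectral characteristic is bounded indirectly: the error row has finite norm by
  -- the error identity, and `h` is the target minus the error.
  have herr : MemLp (rowModel R fun x =>
      Sum.elim (errorPart₁ n μ N f g a x) (errorPart₂ n μ N f g a x)) 2 freq := by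
    refine memLp_rowModel hI.aemeasurable hI.mul_conjTranspose
      (aemeasurable_sumElim (aemeasurable_errorPart₁ hf hg) (aemeasurable_errorPart₂ hf hg)) ?_
    refine (integrable_errorDensity_add (N := N) (a := a) hμ hf hg hmin).congr ?_
    filter_upwards [hreg] with x ⟨_, h2, _, _, h5⟩
    rw [jointDensity_form, errorDensity₁_eq h5, errorDensity₂_eq h2 h5]
  have hchar : MemLp (rowModel R (obsRow n (spectralChar n μ N f g a))) 2 freq := by
    refine (hY.2.1.sub herr).ae_eq ?_
    rw [← rowModel_sub]
    filter_upwards [hrow] with x hx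
    simp only [rowModel, Pi.sub_apply]
    congr 2
    rw [← hx]
    simp
  obtain ⟨u, hu, hcu⟩ := hI.exists_corr_mem_observedIncrements (μ := μ) (N := N) hchar
    (integrable_charQuotient (N := N) (a := a) hμ hf hg hmin ht)
    (by
      filter_upwards [hreg] with x ⟨h1, h2, _, _, _⟩
      exact spectralChar_eq_smul hμ h1 h2)
    (fun k hk p => integral_character_mul_charQuotient hμ hf hg hmin ht hk p)
  exact ⟨u, hu, hcu, (hY.sub hcu).congr Filter.EventuallyEq.rfl hrow⟩

end IsSpectralIsometry

end PerStat

/-! ### The theorem -/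

open PerStat

theorem theorem3p2 {Ω : Type*} [MeasurableSpace Ω] (P : Measure Ω) [IsProbabilityMeasure P]
    (T n μ M : ℕ) (hT : 0 < T) (hμ : 0 < μ)
    (θ η : ℤ → Ω → ℂ) (α : ℕ → ℂ) (f g : ℝ → Matrix (Fin T) (Fin T) ℂ)
    (hθ : PerStat.HasPeriodicallyStationaryIncrements P n T θ)
    (hf : PerStat.HasIncrementSpectralDensity P n (PerStat.block T θ) f)
    (hg : PerStat.HasSpectralDensity P (PerStat.block T η) g)
    (hunc : PerStat.Uncorrelated P n (PerStat.block T θ) (PerStat.block T η))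
    (hmin : PerStat.MinimalityCondition n μ f g)
    (htint : ∀ p q, Integrable (fun x => PerStat.tSymbol n μ f g x p q) PerStat.freq) :
    let N : ℕ := M / T
    let a : ℕ → Fin T → ℂ := PerStat.blockCoeff T M α
    let ζ : ℤ → Fin T → Ω → ℂ := PerStat.block T (fun m => θ m + η m)
    let V : Ω → ℂ := PerStat.initialValues n μ N a ζ
    let A : Ω → ℂ := PerStat.scalarFunctional M α θ
    let Opt : (Ω → ℂ) → Prop := PerStat.IsOptimalEstimate P n μ N ζ V A
    -- the Fourier coefficients entering the formulas exist, and `P` is invertible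
    (∀ p q, Integrable (fun x => PerStat.pSymbol n μ f g x p q) PerStat.freq) ∧
    (∀ p q, Integrable (fun x => PerStat.qSymbol n f g x p q) PerStat.freq) ∧
    IsUnit (PerStat.pMatrix n μ N f g) ∧
    -- the optimal linear estimate exists and is unique
    (∃ E, Opt E) ∧ (∀ E E', Opt E → Opt E' → E =ᵐ[P] E') ∧
    -- it is `∫ hᵀ dZ - V`, with the spectral characteristic `h`
    (∀ E, Opt E ↔
      PerStat.IsSpectralIntegral P n ζ (PerStat.obsDensity n f g)
        (PerStat.spectralChar n μ N f g a) (fun ω => E ω + V ω)) ∧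
    -- its mean square error
    Integrable (PerStat.errorDensity₁ n μ N f g a) PerStat.freq ∧
    Integrable (PerStat.errorDensity₂ n μ N f g a) PerStat.freq ∧
    ∀ E, Opt E →
      MemLp (fun ω => A ω - E ω) 2 P ∧
      (PerStat.mse P A E : ℂ) = ∫ x, PerStat.errorDensity₁ n μ N f g a x ∂PerStat.freq
        + ∫ x, PerStat.errorDensity₂ n μ N f g a x ∂PerStat.freq ∧
      (PerStat.mse P A E : ℂ) = PerStat.errorForm n μ N f g a := by
  intro N a ζ V A Opt
  have hfD := hf.isDensity
  have hgD := hg.isDensity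
  have hp := integrable_pSymbol hμ hfD hgD hmin
  have hreg := ae_regular hμ hfD hgD hmin
  obtain ⟨R, G, hI⟩ := exists_isSpectralIsometry hf hg hunc
  obtain ⟨u, huH, hcu, hce⟩ := hI.exists_projection (N := N) (a := a) hμ hfD hgD hmin htint
  have hY : MemLp (target n μ N a ζ (block T η)) 2 P := (hI.corr_target μ N a).1
  have hAV : ∀ ω, A ω + V ω = target n μ N a ζ (block T η) ω :=
    scalarFunctional_add_initialValues hT hμ α θ η
  have htoLp : hce.1.toLp _ = hY.toLp _ - u := by
    refine Lp.ext ?_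
    filter_upwards [hce.1.coeFn_toLp, hY.coeFn_toLp, Lp.coeFn_sub (hY.toLp _) u] with ω h1 h2 h3
    rw [h1, h3, Pi.sub_apply, Pi.sub_apply, h2]
  have horth : ∀ v ∈ observedIncrements P n μ N ζ, inner ℂ v (hY.toLp _ - u) = 0 := by
    rw [← htoLp]
    refine hI.inner_eq_zero_of_mem_observedIncrements hce fun k hk p => ?_
    -- An observed index `k` lies outside `0, …, N + μn`, where `C` has no frequency.
    rw [← integral_character_mul_trigPoly_eq_zero (cVector n μ N f g a) (k := k)
      (by push_cast; exact hk) p]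
    refine integral_congr_ae ?_
    filter_upwards [hreg] with x ⟨h1, h2, _, _, h5⟩
    exact errorPart_form_incRow h1 h2 h5.isUnit k p
  have hopt : ∀ E, Opt E ↔ (fun ω => E ω + V ω) =ᵐ[P] u := isOptimalEstimate_iff hAV hY huH horth
  have hi₁ := integrable_errorDensity₁ (N := N) (a := a) hμ hfD hgD hmin
  have hi₂ := integrable_errorDensity₂ (N := N) (a := a) hμ hfD hgD hmin
  have herr : ∀ E, Opt E → (fun ω => A ω - E ω) =ᵐ[P] target n μ N a ζ (block T η) - u := by
    intro E hE
    filter_upwards [(hopt E).1 hE] with ω hω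
    rw [Pi.sub_apply, ← hAV, ← hω]
    ring
  have hmse : ∀ E, Opt E → (mse P A E : ℂ) =
      ∫ x, (errorDensity₁ n μ N f g a x + errorDensity₂ n μ N f g a x) ∂freq := by
    intro E hE
    have h1 : (mse P A E : ℂ) = ∫ ω, (target n μ N a ζ (block T η) - u) ω *
        star ((target n μ N a ζ (block T η) - u) ω) ∂P := by
      unfold mse
      rw [← integral_complex_ofReal]
      refine integral_congr_ae ?_
      filter_upwards [herr E hE] with ω hω
      rw [hω, Complex.star_def, Complex.mul_conj, Complex.normSq_eq_norm_sq]
    rw [h1, hI.integral_mul_star hce hce]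
    refine integral_congr_ae ?_
    filter_upwards [hreg] with x ⟨_, h2, _, _, h5⟩
    rw [jointDensity_form, errorDensity₁_eq h5, errorDensity₂_eq h2 h5]
  refine ⟨hp, integrable_qSymbol hfD hgD hmin,
    isUnit_blockToeplitz hp (ae_posDef_pSymbol hμ hfD hgD hmin),
    ⟨fun ω => u ω - V ω, (hopt _).2 (Filter.Eventually.of_forall fun ω => sub_add_cancel _ _)⟩,
    fun E E' hE hE' => ?_, fun E => ⟨fun hE => ?_, fun hE => ?_⟩, hi₁, hi₂, fun E hE => ?_⟩
  · filter_upwards [(hopt E).1 hE, (hopt E').1 hE'] with ω h1 h2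
    exact add_right_cancel (h1.trans h2.symm)
  · have hcE := hcu.congr ((hopt E).1 hE).symm Filter.EventuallyEq.rfl
    refine hI.isSpectralIntegral ?_ hcE (s := obsIndex T n μ N) ?_
    · refine (aemeasurable_pi_lambda _ fun p => ?_ : AEMeasurable (fun x =>
        incFactor n μ x • trigPoly (stack N (bCoeff n μ N a)) x - errorPart₁ n μ N f g a x)
        freq).congr ?_
      · exact ((measurable_incFactor n μ).aemeasurable.mul
          (continuous_trigPoly _ p).measurable.aemeasurable).sub (aemeasurable_errorPart₁ hfD hgD p)
      · filter_upwards [hreg] with x ⟨_, h2, _, _, _⟩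
        exact (spectralChar_eq h2).symm
    · rw [← observedIncrements_eq μ N hI.memLp_increment]
      convert huH using 1
      exact Lp.ext (hcE.1.coeFn_toLp.trans ((hopt E).1 hE))
  · exact (hopt E).2 (hI.ae_eq_of_isSpectralIntegral hcu hE)
  · refine ⟨hce.1.ae_eq (herr E hE).symm, ?_, ?_⟩
    · rw [hmse E hE, integral_add hi₁ hi₂]
    · rw [hmse E hE, integral_errorDensity_add hμ hfD hgD hmin]
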